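/- Let $\mu,\nu$ be Borel probability measures on $\mathbb R^d$, where $\nu$ is finitely supported with support $\{y_1,\dots,y_n\}$ ($y_i$ distinct, each of positive mass). Assume that $\mu$ is absolutely continuous with finite second moment, that the interior of $\operatorname{supp}\mu$ is connected, that the boundary of $\operatorname{supp}\mu$ is Lebesgue-null, and that $\mu$ has a density (again denoted $\mu$) which is positive on the interior of $\operatorname{supp}\mu$. For $\eta>0$ let $\pi_\eta$ be the minimizer of $\mathbb E_\pi\|x-y\|^2+\frac1\eta \mathrm{KL}(\pi\,\|\,\mu\otimes\nu)$ over all couplings $\pi$ of $\mu$ and $\nu$, and let $W_2^2(\mu,\nu)$ be the infimum of $\mathbb E_\pi\|x-y\|^2$ over all couplings. Let $(f^*,g^*)$ maximize $\mathbb E_\mu f+\mathbb E_\nu g$ over $(f,g)\in L^1(\mu)\times L^1(\nu)$ with $f(x)+g(y)\le\|x-y\|^2$, subject to $\mathbb E_\nu g^*=0$. The minimizer $\pi_\eta$ exists and is unique, and such a pair $(f^*,g^*)$ exists. Define the power cells $$S_i=\{x:\ \|x-y_i\|^2-g^*(y_i)\le\|x-y_j\|^2-g^*(y_j)\ \ \forall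 j\},$$ the slacks $\Delta_{ij}(x)=\|x-y_j\|^2-g^*(y_j)-\|x-y_i\|^2+g^*(y_i)$ for $x\in S_i$, and, for $i\ne j$ and $t,a\ge 0$, $$H_{ij}(t;a)=\{x\in S_i:\ \Delta_{ij}(x)=t,\ \Delta_{ik}(x)\ge a\ \ \forall k\ne i,j\},\qquad h_{ij}(t;a)=\int_{H_{ij}(t;a)}\mu(x)\,d\mathcal H_{d-1}(x),$$ where $\mathcal H_{d-1}$ is the $(d-1)$-dimensional Hausdorff measure, normalized to agree with Lebesgue measure on hyperplanes. Write $h_{ij}(0)=h_{ij}(0;0)$. (General form.) Suppose that for all $i\neq j$ one has $h_{ij}(0)<\infty$ and that, for all sufficiently small $a\ge0$, the functions $t\mapsto h_{ij}(t;a)$ and $a\mapsto h_{ij}(0;a)$ on $[0,\infty)$ are continuous at $0$. Then $$\lim_{\eta\to\infty}\eta^2\bigl(\mathbb E_{\pi_\eta}\|x-y\|^2-W_2^2(\mu,\nu)\bigr)=\frac{\zeta(2)}2\sum_{i<j}\frac{h_{ij}(0)}{\|y_i-y_j\|}.$$ (Compactly supported form.) Suppose that $\mu$ is compactly supported and that its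 density is bounded, vanishes outside $\operatorname{supp}\mu$, is continuous on the interior of $\operatorname{supp}\mu$, and, for all $i\ne j$, is continuous (as a function on $\mathbb R^d$) at $\mathcal H_{d-1}$-almost every point of $S_i\cap S_j\cap\partial\operatorname{supp}\mu$. (The last condition holds, for instance, if the density is continuous on $\mathbb R^d$, or if $\operatorname{supp}\mu$ is convex.) Then, as $\eta\to\infty$, $$\mathbb E_{\pi_\eta}\|x-y\|^2=W_2^2(\mu,\nu)+\frac{\zeta(2)}{2\eta^2}\sum_{i<j}\frac{w_{ij}}{\|y_i-y_j\|}+o(\eta^{-2}),\qquad w_{ij}=\int_{S_i\cap S_j}\mu(x)\,d\mathcal H_{d-1}(x).$$ -/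

import Mathlib

open MeasureTheory Set Filter Topology Asymptotics
open scoped ENNReal NNReal

noncomputable section

namespace SemidiscreteOT

variable {d n : ℕ}

/-- `π` is a coupling of `μ` and `ν`: its marginals are `μ` and `ν`. -/
def IsCoupling (μ ν : Measure (EuclideanSpace ℝ (Fin d)))
    (π : Measure (EuclideanSpace ℝ (Fin d) × EuclideanSpace ℝ (Fin d))) : Prop :=
  π.fst = μ ∧ π.snd = ν

/-- The quadratic transport cost `E_π ‖x - y‖²`, with values in `[0, ∞]`. -/
def cost (π : Measure (EuclideanSpace ℝ (Fin d) × EuclideanSpace ℝ (Fin d))) : ℝ≥0∞ :=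
  ∫⁻ z, ‖z.1 - z.2‖ₑ ^ 2 ∂π

/-- The squared Wasserstein distance `W₂²(μ, ν)`. -/
def W2sq (μ ν : Measure (EuclideanSpace ℝ (Fin d))) : ℝ≥0∞ :=
  ⨅ (π : Measure (EuclideanSpace ℝ (Fin d) × EuclideanSpace ℝ (Fin d)))
    (_ : IsCoupling μ ν π), cost π

/-- The entropically regularized cost `E_π ‖x - y‖² + η⁻¹ KL(π ‖ μ ⊗ ν)`. -/
def entropicCost (μ ν : Measure (EuclideanSpace ℝ (Fin d))) (η : ℝ)
    (π : Measure (EuclideanSpace ℝ (Fin d) × EuclideanSpace ℝ (Fin d))) : ℝ≥0∞ :=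
  cost π + ENNReal.ofReal (1 / η) * InformationTheory.klDiv π (μ.prod ν)

/-- `π` minimizes the entropically regularized cost among all couplings of `μ` and `ν`. -/
def IsEntropicOptimal (μ ν : Measure (EuclideanSpace ℝ (Fin d))) (η : ℝ)
    (π : Measure (EuclideanSpace ℝ (Fin d) × EuclideanSpace ℝ (Fin d))) : Prop :=
  IsCoupling μ ν π ∧ ∀ π', IsCoupling μ ν π' → entropicCost μ ν η π ≤ entropicCost μ ν η π'

/-- Feasible pairs `(f, g) ∈ L¹(μ) × L¹(ν)` of the dual of the transport problem. Since `f` and `g`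
are classes of functions, the constraint `f(x) + g(y) ≤ ‖x - y‖²` is imposed almost everywhere;
for a finitely supported `ν` this means at every atom of `ν`. -/
structure IsDualFeasible (μ ν : Measure (EuclideanSpace ℝ (Fin d)))
    (f g : EuclideanSpace ℝ (Fin d) → ℝ) : Prop where
  integrable_left : Integrable f μ
  integrable_right : Integrable g ν
  add_le : ∀ᵐ x ∂μ, ∀ᵐ y ∂ν, f x + g y ≤ ‖x - y‖ ^ 2

/-- Optimal (unregularized) potentials: maximizers `(f, g)` of the dual of the transport problem,
normalized by `E_ν g = 0`. -/
structure IsOptimalPotential (μ ν : Measure (EuclideanSpace ℝ (Fin d)))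
    (f g : EuclideanSpace ℝ (Fin d) → ℝ) : Prop where
  feasible : IsDualFeasible μ ν f g
  optimal : ∀ f' g', IsDualFeasible μ ν f' g' →
    ∫ x, f' x ∂μ + ∫ y, g' y ∂ν ≤ ∫ x, f x ∂μ + ∫ y, g y ∂ν
  normalized : ∫ y, g y ∂ν = 0

/-- The power cell `S_i` of the site `y i`, with respect to the potential `g`. -/
def powerCell (y : Fin n → EuclideanSpace ℝ (Fin d)) (g : EuclideanSpace ℝ (Fin d) → ℝ)
    (i : Fin n) : Set (EuclideanSpace ℝ (Fin d)) :=
  {x | ∀ j, ‖x - y i‖ ^ 2 - g (y i) ≤ ‖x - y j‖ ^ 2 - g (y j)}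

/-- The slack `Δ_ij(x) = ‖x - y_j‖² - f(x) - g(y_j)`, for `x` in the cell `S_i`, where
`f(x) = ‖x - y_i‖² - g(y_i)`. -/
def slack (y : Fin n → EuclideanSpace ℝ (Fin d)) (g : EuclideanSpace ℝ (Fin d) → ℝ)
    (i j : Fin n) (x : EuclideanSpace ℝ (Fin d)) : ℝ :=
  ‖x - y j‖ ^ 2 - (‖x - y i‖ ^ 2 - g (y i)) - g (y j)

/-- `S_ij(a)`: the part of the cell `S_i` where the slacks of all `k ≠ i, j` are at least `a`. -/
def shrunkCell (y : Fin n → EuclideanSpace ℝ (Fin d)) (g : EuclideanSpace ℝ (Fin d) → ℝ)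
    (i j : Fin n) (a : ℝ) : Set (EuclideanSpace ℝ (Fin d)) :=
  {x ∈ powerCell y g i | ∀ k, k ≠ i → k ≠ j → a ≤ slack y g i k x}

/-- `H_ij(t; a)`: the slice of `S_ij(a)` on which the `j`-th slack equals `t`. -/
def slice (y : Fin n → EuclideanSpace ℝ (Fin d)) (g : EuclideanSpace ℝ (Fin d) → ℝ)
    (i j : Fin n) (t a : ℝ) : Set (EuclideanSpace ℝ (Fin d)) :=
  {x ∈ shrunkCell y g i j a | slack y g i j x = t}

/-- `h_ij(t; a)`: the integral of the density `ρ` over `H_ij(t; a)` with respect to the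
`(d - 1)`-dimensional Hausdorff measure (normalized to agree with Lebesgue measure). -/
def sliceMass (ρ : EuclideanSpace ℝ (Fin d) → ℝ≥0) (y : Fin n → EuclideanSpace ℝ (Fin d))
    (g : EuclideanSpace ℝ (Fin d) → ℝ) (i j : Fin n) (t a : ℝ) : ℝ≥0∞ :=
  ∫⁻ x in slice y g i j t a, (ρ x : ℝ≥0∞) ∂(Measure.euclideanHausdorffMeasure (d - 1))

/-- `w_ij`: the `(d - 1)`-dimensional integral of the density `ρ` over the common face
`S_i ∩ S_j` of two power cells. -/
def faceMass (ρ : EuclideanSpace ℝ (Fin d) → ℝ≥0) (y : Fin n → EuclideanSpace ℝ (Fin d))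
    (g : EuclideanSpace ℝ (Fin d) → ℝ) (i j : Fin n) : ℝ≥0∞ :=
  ∫⁻ x in powerCell y g i ∩ powerCell y g j, (ρ x : ℝ≥0∞)
    ∂(Measure.euclideanHausdorffMeasure (d - 1))

/-- `μ` is absolutely continuous with density `ρ` and has finite second moment, the interior of its
support is connected, the boundary of its support is Lebesgue-null, and `ρ` is positive on the
interior of the support. -/
structure HasRegularDensity (μ : Measure (EuclideanSpace ℝ (Fin d)))
    (ρ : EuclideanSpace ℝ (Fin d) → ℝ≥0) : Prop where
  measurable : Measurable ρ
  eq_withDensity : μ = volume.withDensity (fun x => (ρ x : ℝ≥0∞))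
  secondMoment : ∫⁻ x, ‖x‖ₑ ^ 2 ∂μ < ∞
  connected : IsConnected (interior μ.support)
  frontier_null : volume (frontier μ.support) = 0
  pos : ∀ x ∈ interior μ.support, 0 < ρ x

/-- Regularity along hyperplanes: the `h_ij(0; 0)` are finite and, for all sufficiently small
`a ≥ 0`, the functions `t ↦ h_ij(t; a)` and `a ↦ h_ij(0; a)` on `[0, ∞)` are continuous at `0`. -/
def ContinuousSlices (ρ : EuclideanSpace ℝ (Fin d) → ℝ≥0)
    (y : Fin n → EuclideanSpace ℝ (Fin d)) (g : EuclideanSpace ℝ (Fin d) → ℝ) : Prop :=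
  ∀ i j, i ≠ j →
    sliceMass ρ y g i j 0 0 < ∞ ∧
    (∃ a₀ > 0, ∀ a ∈ Icc (0 : ℝ) a₀,
      ContinuousWithinAt (fun t => sliceMass ρ y g i j t a) (Ici 0) 0) ∧
    ContinuousWithinAt (fun a => sliceMass ρ y g i j 0 a) (Ici 0) 0

/-- `μ` is compactly supported, and its density `ρ` is bounded, vanishes off the support, is
continuous on the interior of the support, and is continuous at almost every point (for the
`(d - 1)`-dimensional measure) where a common face of two power cells meets the boundary of the
support. -/
structure IsCompactContinuous (μ : Measure (EuclideanSpace ℝ (Fin d)))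
    (ρ : EuclideanSpace ℝ (Fin d) → ℝ≥0) (y : Fin n → EuclideanSpace ℝ (Fin d))
    (g : EuclideanSpace ℝ (Fin d) → ℝ) : Prop where
  isCompact : IsCompact μ.support
  bounded : ∃ C, ∀ x, ρ x ≤ C
  eq_zero : ∀ x ∉ μ.support, ρ x = 0
  continuousOn : ContinuousOn ρ (interior μ.support)
  continuousAt_face : ∀ i j, i ≠ j →
    ∀ᵐ x ∂((Measure.euclideanHausdorffMeasure (d - 1)).restrict
      (powerCell y g i ∩ powerCell y g j)), x ∈ frontier μ.support → ContinuousAt ρ x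

end SemidiscreteOT

end

/-! Write b_i(x) = ‖x - y_i‖² - g*(y_i). The entropic optimum is a Gibbs plan: given x, the site y_j
has probability softmax(θ - η b(x))_j, where the vector θ = θ(η) is fixed by the second marginal
(`isEntropicOptimal_iff`). Strong duality for the unregularized problem turns the suboptimality into
the μ-integral of ∑_j softmax_j · (b_j - min b) (`exists_softmax_reducedCost`).

On S_i the excess b_j - b_i is the slack Δ_ij, an affine function whose gradient has norm 2‖y_i -
y_j‖. Hence μ restricted to S_i pushes forward under Δ_ij to the density h_ij(t;0) / (2‖y_i - y_j‖)
(`map_slack_eq_withDensity`). As η grows only a layer of width 1/η along each face contributes, and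
there, away from third cells, the softmax weight is the two-point logistic weight
e^{δ-s}/(1+e^{δ-s}) with s = ηΔ_ij and δ = θ_j - θ_i. With c_ij = h_ij(0) / (2‖y_i - y_j‖), the mass
moved from S_i to y_j is therefore about c_ij log(1+e^δ)/η, and its excess cost is about c_ij/η²
times the integral of s·logistic(δ,s) over s > 0 (`tendsto_weighted_flux`).

It remains to see that δ → 0 across every face with c_ij > 0. Since μ(S_j) = ν{y_j}, the mass
entering a cell equals the mass leaving it, and log(1+e^δ) - log(1+e^{-δ}) = δ makes this balance
linear: the graph Laplacian of θ with weights c_ij tends to 0. If the spread of θ stays bounded,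
summation by parts sends the Dirichlet energy to 0 (`tendsto_mul_sq_sub`). Bounded spread comes from
comparing the fluxes across each cut of the adjacency graph of the cells (`exists_no_gap`); every
cut carries positive weight because the interior of the support is connected
(`exists_faceMass_pos`). At δ = 0 the logistic integral is π²/12 = ζ(2)/2
(`integral_mul_logistic_zero`).

In the compactly supported case, dominated convergence along parallel hyperplanes gives the
continuity hypotheses of the general form (`continuousSlices`). -/

set_option linter.unusedSectionVars false

noncomputable section

namespace SemidiscreteOT

variable {d n : ℕ}

/-! ### Laplace asymptotics at the endpoint of a half-line, uniform over a dominated family of test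
functions. -/

/-- The measure `m` on the half-line has Laplace asymptotics governed by the density `c` at `0`. -/
def HasLaplaceLimit (m : Measure ℝ) (c : ℝ) : Prop :=
  ∀ (φ : ℝ → ℝ → ℝ) (C : ℝ), (∀ η, Measurable (φ η)) →
    (∀ᶠ η in atTop, ∀ s, 0 ≤ s → |φ η s| ≤ C * Real.exp (-(1 / 2) * s)) →
    Tendsto (fun η => η * ∫ t, φ η (η * t) ∂m - c * ∫ s in Ioi (0 : ℝ), φ η s) atTop (𝓝 0)

lemma integrableOn_exp_half : IntegrableOn (fun s : ℝ => Real.exp (-(1 / 2) * s)) (Ioi 0) :=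
  exp_neg_integrableOn_Ioi 0 (by norm_num)

lemma tendsto_mul_exp_neg_mul {δ : ℝ} (hδ : 0 < δ) :
    Tendsto (fun η : ℝ => η * Real.exp (-(1 / 2) * (η * δ))) atTop (𝓝 0) := by
  have h1 := (Real.tendsto_pow_mul_exp_neg_atTop_nhds_zero 1)
  have h2 : Tendsto (fun η : ℝ => (δ / 2) * η) atTop atTop :=
    tendsto_id.const_mul_atTop (by positivity)
  have h3 := (h1.comp h2).const_mul (2 / δ)
  rw [mul_zero] at h3
  refine h3.congr fun η => ?_
  simp only [Function.comp, pow_one]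
  rw [show -(1 / 2) * (η * δ) = -(δ / 2 * η) by ring]
  field_simp

/-- Laplace asymptotics for an integrable density that is right-continuous at `0`. -/
lemma tendsto_laplace_of_integrable {h : ℝ → ℝ} (hm : Measurable h) (hint : Integrable h)
    (hneg : ∀ t < 0, h t = 0) (hc : ContinuousWithinAt h (Ici 0) 0)
    {φ : ℝ → ℝ → ℝ} {C : ℝ} (hφ : ∀ η, Measurable (φ η))
    (hb : ∀ᶠ η in atTop, ∀ s, 0 ≤ s → |φ η s| ≤ C * Real.exp (-(1 / 2) * s)) :
    Tendsto (fun η => η * (∫ t, h t * φ η (η * t)) - h 0 * ∫ s in Ioi (0 : ℝ), φ η s)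
      atTop (𝓝 0) := by
  have hC : 0 ≤ C := by
    obtain ⟨η, hη⟩ := hb.exists
    have := (abs_nonneg _).trans (hη 0 le_rfl)
    simpa using this
  -- Continuity with tolerance 1 only serves to bound h on [0, δ), which gives the dominating
  -- function for the part near 0.
  obtain ⟨δ, hδ, hδh⟩ : ∃ δ > 0, ∀ t, 0 ≤ t → t < δ → |h t - h 0| ≤ 1 := by
    have := Metric.continuousWithinAt_iff.1 hc 1 one_pos
    obtain ⟨δ, hδ, H⟩ := this
    refine ⟨δ, hδ, fun t ht htδ => ?_⟩
    have := H (x := t) ht (by rw [Real.dist_eq, sub_zero, abs_of_nonneg ht]; exact htδ)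
    rw [Real.dist_eq] at this
    exact this.le
  set h1 : ℝ → ℝ := (Iio δ).indicator h with hh1
  set h2 : ℝ → ℝ := (Ici δ).indicator h with hh2
  have h1m : Measurable h1 := hm.indicator measurableSet_Iio
  have hint2 : Integrable h2 := hint.indicator measurableSet_Ici
  have hint1 : Integrable h1 := hint.indicator measurableSet_Iio
  have hsplit : ∀ t, h t = h1 t + h2 t := by
    intro t
    by_cases ht : t < δ
    · simp [hh1, hh2, ht, not_le.2 ht]
    · simp [hh1, hh2, ht, not_lt.1 ht]
  have h1bd : ∀ t, 0 < t → |h1 t - h 0| ≤ 1 + |h 0| := by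
    intro t ht
    by_cases htδ : t < δ
    · simp only [hh1, indicator_of_mem (show t ∈ Iio δ from htδ)]
      linarith [hδh t ht.le htδ, abs_nonneg (h 0)]
    · simp only [hh1, indicator_of_notMem (show t ∉ Iio δ from htδ)]
      rw [zero_sub, abs_neg]; linarith
  -- the main term
  have main : Tendsto (fun η : ℝ => ∫ s in Ioi (0 : ℝ),
      |h1 (s / η) - h 0| * (C * Real.exp (-(1 / 2) * s))) atTop (𝓝 0) := by
    rw [show 𝓝 (0 : ℝ) = 𝓝 (∫ s in Ioi (0 : ℝ), (0 : ℝ)) by simp]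
    refine tendsto_integral_filter_of_dominated_convergence (l := atTop)
      (F := fun η s => |h1 (s / η) - h 0| * (C * Real.exp (-(1 / 2) * s)))
      (fun s => (1 + |h 0|) * (C * Real.exp (-(1 / 2) * s))) ?_ ?_ ?_ ?_
    · refine Eventually.of_forall fun η => ?_
      exact Measurable.aestronglyMeasurable (by fun_prop)
    · filter_upwards [eventually_gt_atTop 0] with η hη
      filter_upwards [ae_restrict_mem measurableSet_Ioi] with s hs
      have hE : 0 ≤ C * Real.exp (-(1 / 2) * s) := by positivity
      rw [Real.norm_eq_abs, abs_mul, abs_abs, abs_of_nonneg hE]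
      exact mul_le_mul_of_nonneg_right (h1bd _ (div_pos hs hη)) hE
    · exact (integrableOn_exp_half.const_mul C).const_mul _
    · filter_upwards [ae_restrict_mem measurableSet_Ioi] with s hs
      have hs' : (0 : ℝ) < s := hs
      have ht : Tendsto (fun η : ℝ => s / η) atTop (𝓝[Ici 0] 0) := by
        refine tendsto_nhdsWithin_iff.2 ⟨tendsto_const_nhds.div_atTop tendsto_id, ?_⟩
        filter_upwards [eventually_gt_atTop 0] with η hη using (div_pos hs hη).le
      have h3 : Tendsto (fun η : ℝ => h (s / η)) atTop (𝓝 (h 0)) := Tendsto.comp hc ht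
      have h4 : Tendsto (fun η : ℝ => h1 (s / η)) atTop (𝓝 (h 0)) := by
        refine h3.congr' ?_
        filter_upwards [(tendsto_nhds_of_tendsto_nhdsWithin ht).eventually
          (gt_mem_nhds hδ)] with η hη
        simp only [hh1, indicator_of_mem (show s / η ∈ Iio δ from hη)]
      have h5 := ((h4.sub_const (h 0)).abs).mul_const (C * Real.exp (-(1 / 2) * s))
      simpa using h5
  -- Beyond δ the test function is at most C e^{-ηδ/2}, which beats the prefactor η.
  have tail : Tendsto (fun η : ℝ => C * (∫ t, |h2 t|) * (η * Real.exp (-(1 / 2) * (η * δ))))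
      atTop (𝓝 0) := by
    simpa using (tendsto_mul_exp_neg_mul hδ).const_mul (C * ∫ t, |h2 t|)
  refine squeeze_zero_norm' ?_ (by simpa only [add_zero] using main.add tail)
  filter_upwards [hb, eventually_gt_atTop 0] with η hη hη0
  have hφint : IntegrableOn (φ η) (Ioi 0) := by
    refine Integrable.mono' (integrableOn_exp_half.const_mul C)
      (hφ η).aestronglyMeasurable ?_
    filter_upwards [ae_restrict_mem measurableSet_Ioi] with s hs
    exact hη s (le_of_lt hs)
  have hbd2 : ∀ t, |h2 t * φ η (η * t)| ≤ |h2 t| * (C * Real.exp (-(1 / 2) * (η * δ))) := by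
    intro t
    by_cases ht : δ ≤ t
    · rw [abs_mul]
      refine mul_le_mul_of_nonneg_left ((hη _ (mul_nonneg hη0.le (hδ.le.trans ht))).trans ?_)
        (abs_nonneg _)
      refine mul_le_mul_of_nonneg_left (Real.exp_le_exp.2 ?_) hC
      nlinarith
    · simp [hh2, ht]
  have hmφ : Measurable fun t => φ η (η * t) := (hφ η).comp (measurable_const_mul η)
  have hi2 : Integrable (fun t => h2 t * φ η (η * t)) := by
    refine Integrable.mono' (hint2.abs.mul_const (C * Real.exp (-(1 / 2) * (η * δ))))
      ((hm.indicator measurableSet_Ici).mul hmφ).aestronglyMeasurable (ae_of_all _ hbd2)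
  have hi1 : Integrable (fun t => h1 t * φ η (η * t)) := by
    refine Integrable.mono' (hint1.abs.mul_const C) (h1m.mul hmφ).aestronglyMeasurable
      (ae_of_all _ fun t => ?_)
    by_cases ht : 0 ≤ t
    · rw [Real.norm_eq_abs, abs_mul]
      refine mul_le_mul_of_nonneg_left ((hη _ (by positivity)).trans ?_) (abs_nonneg _)
      refine mul_le_of_le_one_right hC (Real.exp_le_one_iff.2 ?_)
      have : 0 ≤ η * t := by positivity
      linarith
    · have : h1 t = 0 := by
        simp only [hh1, indicator_apply, hneg t (not_le.1 ht), ite_self]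
      simp [this]
  have e1 : η * ∫ t, h1 t * φ η (η * t) = ∫ s in Ioi (0 : ℝ), h1 (s / η) * φ η s := by
    have : ∫ t, h1 t * φ η (η * t) = ∫ t in Ioi (0 : ℝ), h1 t * φ η (η * t) := by
      rw [← integral_Ici_eq_integral_Ioi, ← integral_indicator measurableSet_Ici]
      congr 1 with t
      by_cases ht : 0 ≤ t
      · simp [ht]
      · have : h1 t = 0 := by
          simp only [hh1, indicator_apply, hneg t (not_le.1 ht), ite_self]
        simp [this, indicator_apply]
    rw [this]
    have := integral_comp_mul_left_Ioi (fun s => h1 (s / η) * φ η s) 0 hη0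
    simp only [mul_zero, smul_eq_mul] at this
    rw [← mul_inv_cancel_left₀ hη0.ne' (∫ s in Ioi (0 : ℝ), h1 (s / η) * φ η s), ← this]
    congr 2 with t
    rw [mul_div_cancel_left₀ _ hη0.ne']
  have hi1' : IntegrableOn (fun s => h1 (s / η) * φ η s) (Ioi 0) := by
    have h6 := (hi1.comp_div hη0.ne').integrableOn (s := Ioi 0)
    refine h6.congr_fun (fun s _ => ?_) measurableSet_Ioi
    simp only []
    rw [mul_div_cancel₀ _ hη0.ne']
  have e2 : η * (∫ t, h t * φ η (η * t)) - h 0 * ∫ s in Ioi (0 : ℝ), φ η s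
      = (∫ s in Ioi (0 : ℝ), (h1 (s / η) - h 0) * φ η s) + η * ∫ t, h2 t * φ η (η * t) := by
    have : ∫ t, h t * φ η (η * t) = (∫ t, h1 t * φ η (η * t)) + ∫ t, h2 t * φ η (η * t) := by
      rw [← integral_add hi1 hi2]
      congr 1 with t
      rw [hsplit t]; ring
    rw [this, mul_add, e1]
    simp_rw [sub_mul]
    rw [integral_sub hi1' (hφint.const_mul _), integral_const_mul]
    ring
  rw [e2]
  refine (norm_add_le _ _).trans (add_le_add ?_ ?_)
  · refine norm_integral_le_of_norm_le
      (g := fun s => |h1 (s / η) - h 0| * (C * Real.exp (-(1 / 2) * s))) ?_ ?_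
    · refine Integrable.mono' ((integrableOn_exp_half.const_mul C).const_mul (1 + |h 0|))
        (Measurable.aestronglyMeasurable (by fun_prop)) ?_
      filter_upwards [ae_restrict_mem measurableSet_Ioi] with s hs
      have hE : 0 ≤ C * Real.exp (-(1 / 2) * s) := by positivity
      rw [Real.norm_eq_abs, abs_mul, abs_abs, abs_of_nonneg hE]
      exact mul_le_mul_of_nonneg_right (h1bd _ (div_pos hs hη0)) hE
    · filter_upwards [ae_restrict_mem measurableSet_Ioi] with s hs
      rw [Real.norm_eq_abs, abs_mul]
      exact mul_le_mul_of_nonneg_left (hη s (le_of_lt hs)) (abs_nonneg _)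
  · rw [Real.norm_eq_abs, abs_mul, abs_of_pos hη0]
    have : |∫ t, h2 t * φ η (η * t)| ≤ (∫ t, |h2 t|) * (C * Real.exp (-(1 / 2) * (η * δ))) := by
      rw [← integral_mul_const, ← Real.norm_eq_abs]
      exact norm_integral_le_of_norm_le (hint2.abs.mul_const _) (ae_of_all _ hbd2)
    calc η * |∫ t, h2 t * φ η (η * t)|
        ≤ η * ((∫ t, |h2 t|) * (C * Real.exp (-(1 / 2) * (η * δ)))) :=
          mul_le_mul_of_nonneg_left this hη0.le
      _ = _ := by ring

lemma hasLaplaceLimit_withDensity {H : ℝ → ℝ≥0∞} (hm : Measurable H) (hfin : ∫⁻ t, H t ≠ ∞)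
    (hneg : ∀ t < 0, H t = 0) (hc : ContinuousWithinAt H (Ici 0) 0) (h0 : H 0 ≠ ∞) :
    HasLaplaceLimit (volume.withDensity H) (H 0).toReal := by
  intro φ C hφ hb
  have hae : ∀ᵐ t, H t < ∞ := ae_lt_top hm hfin
  have := tendsto_laplace_of_integrable (h := fun t => (H t).toReal) hm.ennreal_toReal
    (integrable_toReal_of_lintegral_ne_top hm.aemeasurable hfin)
    (fun t ht => by simp [hneg t ht])
    (show Tendsto _ _ _ from (ENNReal.tendsto_toReal h0).comp hc) hφ hb
  refine this.congr fun η => ?_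
  rw [integral_withDensity_eq_integral_toReal_smul hm hae]
  simp only [smul_eq_mul]

/-! ### Logistic integrals and ζ(2). -/

/-- The logistic weight `e^{δ-s} / (1 + e^{δ-s})`. -/
def logistic (δ s : ℝ) : ℝ := Real.exp (δ - s) / (1 + Real.exp (δ - s))

lemma measurable_logistic (δ : ℝ) : Measurable (logistic δ) := by
  unfold logistic; fun_prop

lemma logistic_nonneg (δ s : ℝ) : 0 ≤ logistic δ s := by unfold logistic; positivity

lemma logistic_le (δ s : ℝ) : logistic δ s ≤ Real.exp δ * Real.exp (-s) := by
  unfold logistic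
  rw [← Real.exp_add, ← sub_eq_add_neg]
  exact div_le_self (Real.exp_pos _).le (by linarith [Real.exp_pos (δ - s)])

lemma integrableOn_exp_neg : IntegrableOn (fun s : ℝ => Real.exp (-s)) (Ioi 0) := by
  simpa using exp_neg_integrableOn_Ioi 0 one_pos

lemma integrableOn_logistic (δ : ℝ) : IntegrableOn (logistic δ) (Ioi 0) := by
  refine Integrable.mono' (integrableOn_exp_neg.const_mul (Real.exp δ))
    (measurable_logistic δ).aestronglyMeasurable (ae_of_all _ fun s => ?_)
  rw [Real.norm_eq_abs, abs_of_nonneg (logistic_nonneg _ _)]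
  exact logistic_le δ s

lemma integral_logistic (δ : ℝ) :
    ∫ s in Ioi (0 : ℝ), logistic δ s = Real.log (1 + Real.exp δ) := by
  have hd : ∀ s : ℝ, HasDerivAt (fun s => -Real.log (1 + Real.exp (δ - s))) (logistic δ s) s := by
    intro s
    have h1 : HasDerivAt (fun s => 1 + Real.exp (δ - s)) (Real.exp (δ - s) * -1) s := by
      simpa using (((hasDerivAt_id s).const_sub δ).exp).const_add 1
    have h2 := (h1.log (by positivity)).neg
    refine h2.congr_deriv ?_
    unfold logistic; ring
  have ht : Tendsto (fun s => -Real.log (1 + Real.exp (δ - s))) atTop (𝓝 0) := by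
    have h1 : Tendsto (fun s : ℝ => Real.exp (δ - s)) atTop (𝓝 0) :=
      Real.tendsto_exp_atBot.comp (tendsto_const_nhds.add_atBot tendsto_neg_atTop_atBot)
    have h2 : Tendsto (fun s : ℝ => 1 + Real.exp (δ - s)) atTop (𝓝 1) := by
      simpa using h1.const_add 1
    simpa using (h2.log one_ne_zero).neg
  have := integral_Ioi_of_hasDerivAt_of_tendsto (a := 0) (hd 0).continuousAt.continuousWithinAt
    (fun x _ => hd x) (integrableOn_logistic δ) ht
  rw [this]; simp

/-- This identity makes the net flux between two cells linear in the difference of their potentials.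
-/
lemma log_one_add_exp_sub (δ : ℝ) :
    Real.log (1 + Real.exp δ) - Real.log (1 + Real.exp (-δ)) = δ := by
  have : 1 + Real.exp δ = Real.exp δ * (1 + Real.exp (-δ)) := by
    rw [mul_add, ← Real.exp_add]; simp [add_comm]
  rw [this, Real.log_mul (Real.exp_ne_zero _) (by positivity), Real.log_exp]
  ring

lemma abs_logistic_sub_le (δ s : ℝ) :
    |logistic δ s - logistic 0 s| ≤ |Real.exp δ - 1| * Real.exp (-s) := by
  unfold logistic
  have h1 : Real.exp (δ - s) = Real.exp δ * Real.exp (-s) := by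
    rw [← Real.exp_add, sub_eq_add_neg]
  rw [h1, zero_sub]
  set u := Real.exp (-s)
  have hu : 0 < u := Real.exp_pos _
  set e := Real.exp δ
  have he : 0 < e := Real.exp_pos _
  rw [show e * u / (1 + e * u) - u / (1 + u) = (e - 1) * u / ((1 + e * u) * (1 + u)) by
    field_simp; ring, abs_div, abs_mul, abs_of_pos hu]
  refine div_le_self (by positivity) ?_
  rw [abs_of_pos (by positivity)]
  nlinarith [mul_pos he hu, mul_pos (mul_pos he hu) hu]

/-- Half of the exponential decay is spent on absorbing the factor s, so that the cost weight v(s) =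
s satisfies the domination in `HasLaplaceLimit`. -/
lemma mul_exp_neg_le {s : ℝ} : s * Real.exp (-s) ≤ 2 * Real.exp (-(1 / 2) * s) := by
  have h1 : Real.exp (-s) = Real.exp (-(1 / 2) * s) * Real.exp (-(1 / 2) * s) := by
    rw [← Real.exp_add]; ring_nf
  have h2 : s * Real.exp (-(1 / 2) * s) ≤ 2 := by
    have h3 : s / 2 ≤ Real.exp (s / 2) := (Real.add_one_le_exp (s / 2)).trans' (by linarith)
    have h4 : Real.exp (s / 2) * Real.exp (-(1 / 2) * s) = 1 := by
      rw [← Real.exp_add]; ring_nf; simp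
    nlinarith [Real.exp_pos (-(1 / 2) * s)]
  rw [h1, ← mul_assoc]
  exact mul_le_mul_of_nonneg_right h2 (Real.exp_pos _).le

/-- The terms of odd index form a quarter of the Basel series, π²/24, so those of even index sum to
π²/6 - π²/24 = π²/8; the difference is π²/12. -/
lemma hasSum_alternating_zeta_two :
    HasSum (fun n : ℕ => (-1 : ℝ) ^ n * (1 / ((n : ℝ) + 1) ^ 2)) (Real.pi ^ 2 / 12) := by
  have h1 : HasSum (fun n : ℕ => 1 / ((n : ℝ) + 1) ^ 2) (Real.pi ^ 2 / 6) := by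
    have := (hasSum_nat_add_iff' 1).2 hasSum_zeta_two
    simpa using this
  have h2 : HasSum (fun k : ℕ => 1 / (((2 * k + 1 : ℕ) : ℝ) + 1) ^ 2) (Real.pi ^ 2 / 24) := by
    have := h1.mul_left (1 / 4)
    rw [show (1 / 4 : ℝ) * (Real.pi ^ 2 / 6) = Real.pi ^ 2 / 24 by ring] at this
    have e : (fun k : ℕ => 1 / (((2 * k + 1 : ℕ) : ℝ) + 1) ^ 2)
        = fun k : ℕ => 1 / 4 * (1 / ((k : ℝ) + 1) ^ 2) := by
      funext k
      push_cast
      rw [show (2 * (k : ℝ) + 1 + 1) ^ 2 = 4 * ((k : ℝ) + 1) ^ 2 by ring, ← one_div_mul_one_div]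
    rwa [e]
  have h3 : Summable (fun k : ℕ => 1 / (((2 * k : ℕ) : ℝ) + 1) ^ 2) :=
    h1.summable.comp_injective (i := fun k : ℕ => 2 * k) (fun a b hab => by simpa using hab)
  have h4 := h3.hasSum
  have h5 := (h4.even_add_odd (f := fun n : ℕ => 1 / ((n : ℝ) + 1) ^ 2) h2).unique h1
  have h6 : HasSum (fun k : ℕ => (-1 : ℝ) ^ (2 * k) * (1 / (((2 * k : ℕ) : ℝ) + 1) ^ 2))
      (Real.pi ^ 2 / 8) := by
    simp only [pow_mul, neg_one_sq, one_pow, one_mul]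
    convert h4 using 1
    linarith
  have h7 : HasSum (fun k : ℕ => (-1 : ℝ) ^ (2 * k + 1) * (1 / (((2 * k + 1 : ℕ) : ℝ) + 1) ^ 2))
      (-(Real.pi ^ 2 / 24)) := by
    have e : (fun k : ℕ => (-1 : ℝ) ^ (2 * k + 1) * (1 / (((2 * k + 1 : ℕ) : ℝ) + 1) ^ 2))
        = fun k : ℕ => -(1 / (((2 * k + 1 : ℕ) : ℝ) + 1) ^ 2) := by
      funext k
      rw [pow_succ (-1 : ℝ), pow_mul, neg_one_sq, one_pow]
      ring
    rw [e]
    exact h2.neg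
  have h8 := h6.even_add_odd (f := fun n : ℕ => (-1 : ℝ) ^ n * (1 / ((n : ℝ) + 1) ^ 2)) h7
  convert h8 using 1
  ring

lemma integral_mul_logistic_zero :
    ∫ s in Ioi (0 : ℝ), s * logistic 0 s = (riemannZeta 2).re / 2 := by
  have hz : (riemannZeta 2).re / 2 = Real.pi ^ 2 / 12 := by
    rw [riemannZeta_two, show (Real.pi : ℂ) ^ 2 / 6 = ((Real.pi ^ 2 / 6 : ℝ) : ℂ) by push_cast; rfl,
      Complex.ofReal_re]
    ring
  have hI : ∀ n : ℕ, ∫ s in Ioi (0 : ℝ), s * Real.exp (-((n + 1 : ℝ) * s))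
      = 1 / ((n : ℝ) + 1) ^ 2 := by
    intro n
    have := Real.integral_rpow_mul_exp_neg_mul_Ioi (a := 2) (r := n + 1) two_pos (by positivity)
    rw [Real.Gamma_two, mul_one, show (2 : ℝ) - 1 = 1 by norm_num] at this
    simp only [Real.rpow_one] at this
    rw [this, Real.rpow_two, one_div_pow]
  -- A nonintegrable function would have integral 0, contradicting the value just computed.
  have hint : ∀ n : ℕ, IntegrableOn (fun s : ℝ => s * Real.exp (-((n + 1 : ℝ) * s))) (Ioi 0) := by
    intro n
    by_contra h
    have := integral_undef h
    rw [hI n] at this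
    exact absurd this (by positivity)
  -- Termwise integration of the geometric expansion of e^{-s}/(1+e^{-s}); the integrals of the
  -- norms are 1/(n+1)², hence summable.
  have hs := hasSum_integral_of_summable_integral_norm (μ := volume.restrict (Ioi (0 : ℝ)))
    (F := fun (n : ℕ) (s : ℝ) => (-1 : ℝ) ^ n * (s * Real.exp (-((n + 1 : ℝ) * s))))
    (fun n => (hint n).const_mul _) (by
      refine hasSum_alternating_zeta_two.summable.abs.congr fun n => ?_
      rw [abs_mul, abs_pow, abs_neg, abs_one, one_pow, one_mul, abs_of_nonneg (by positivity),
        ← hI n]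
      refine setIntegral_congr_fun measurableSet_Ioi fun s hs => ?_
      have : 0 ≤ s * Real.exp (-((n + 1 : ℝ) * s)) := mul_nonneg (le_of_lt hs) (Real.exp_pos _).le
      simp only [norm_mul, norm_pow, norm_neg, norm_one, one_pow, one_mul]
      rw [← norm_mul, Real.norm_of_nonneg this])
  simp only [integral_const_mul, hI] at hs
  rw [hz, ← hs.unique hasSum_alternating_zeta_two]
  refine setIntegral_congr_fun measurableSet_Ioi fun s hs => ?_
  have hu : Real.exp (-s) < 1 := Real.exp_lt_one_iff.2 (neg_neg_of_pos hs)
  have hg := (hasSum_geometric_of_abs_lt_one (r := -Real.exp (-s))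
    (by rw [abs_neg, abs_of_pos (Real.exp_pos _)]; exact hu)).mul_left (s * Real.exp (-s))
  rw [show s * logistic 0 s = s * Real.exp (-s) * (1 - -Real.exp (-s))⁻¹ by
    unfold logistic; rw [zero_sub, sub_neg_eq_add]; ring, ← hg.tsum_eq]
  refine tsum_congr fun n => ?_
  rw [show -((n + 1 : ℝ) * s) = n * (-s) + -s by ring, Real.exp_add, Real.exp_nat_mul,
    neg_pow (Real.exp (-s))]
  ring

/-! ### Slicing Lebesgue measure by parallel hyperplanes. -/

/-- A parametrization of the hyperplane `⟪w, x⟫ + κ = t` by the orthogonal complement of `w`. -/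
def hyperplaneParam (w : EuclideanSpace ℝ (Fin d)) (κ t : ℝ)
    (z : (Submodule.span ℝ {w})ᗮ) : EuclideanSpace ℝ (Fin d) :=
  z + ((t - κ) / ‖w‖ ^ 2) • w

lemma continuous_hyperplaneParam (w : EuclideanSpace ℝ (Fin d)) (κ : ℝ) :
    Continuous fun q : ℝ × (Submodule.span ℝ {w})ᗮ => hyperplaneParam w κ q.1 q.2 := by
  unfold hyperplaneParam; fun_prop

lemma inner_hyperplaneParam {w : EuclideanSpace ℝ (Fin d)} (hw : w ≠ 0) (κ t : ℝ)
    (z : (Submodule.span ℝ {w})ᗮ) : inner ℝ w (hyperplaneParam w κ t z) + κ = t := by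
  have h1 : inner ℝ w (z : EuclideanSpace ℝ (Fin d)) = 0 :=
    Submodule.mem_orthogonal_singleton_iff_inner_right.1 z.2
  have h2 : ‖w‖ ≠ 0 := norm_ne_zero_iff.2 hw
  unfold hyperplaneParam
  rw [inner_add_right, h1, inner_smul_right, real_inner_self_eq_norm_sq]
  field_simp
  ring

lemma isometry_hyperplaneParam (w : EuclideanSpace ℝ (Fin d)) (κ t : ℝ) :
    Isometry (hyperplaneParam w κ t) := by
  refine Isometry.of_dist_eq fun z z' => ?_
  unfold hyperplaneParam
  rw [dist_add_right]; rfl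

lemma range_hyperplaneParam {w : EuclideanSpace ℝ (Fin d)} (hw : w ≠ 0) (κ t : ℝ) :
    range (hyperplaneParam w κ t) = {x | inner ℝ w x + κ = t} := by
  ext x
  constructor
  · rintro ⟨z, rfl⟩; exact inner_hyperplaneParam hw κ t z
  · intro hx
    have h2 : ‖w‖ ≠ 0 := norm_ne_zero_iff.2 hw
    refine ⟨⟨x - ((t - κ) / ‖w‖ ^ 2) • w, ?_⟩, by simp [hyperplaneParam]⟩
    rw [Submodule.mem_orthogonal_singleton_iff_inner_right, inner_sub_right, inner_smul_right,
      real_inner_self_eq_norm_sq]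
    have : inner ℝ w x + κ = t := hx
    field_simp
    linarith

lemma finrank_orthogonal_span_singleton_eq {w : EuclideanSpace ℝ (Fin d)} (hw : w ≠ 0) :
    Module.finrank ℝ (Submodule.span ℝ {w})ᗮ = d - 1 := by
  have h := (Submodule.span ℝ {w}).finrank_add_finrank_orthogonal
  rw [finrank_span_singleton hw, finrank_euclideanSpace_fin] at h
  omega

lemma hausdorff_orthogonal_eq_volume {w : EuclideanSpace ℝ (Fin d)} (hw : w ≠ 0) :
    (Measure.euclideanHausdorffMeasure (d - 1) : Measure (Submodule.span ℝ {w})ᗮ) = volume := by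
  rw [← finrank_orthogonal_span_singleton_eq hw]
  exact InnerProductSpace.euclideanHausdorffMeasure_eq_volume

/-- The parametrization is an isometry onto the hyperplane, and on the (d-1)-dimensional space of
parameters the normalized Hausdorff measure is Lebesgue measure. -/
lemma map_hyperplaneParam {w : EuclideanSpace ℝ (Fin d)} (hw : w ≠ 0) (κ t : ℝ) :
    (volume : Measure (Submodule.span ℝ {w})ᗮ).map (hyperplaneParam w κ t)
      = (Measure.euclideanHausdorffMeasure (d - 1)).restrict {x | inner ℝ w x + κ = t} := by
  rw [← range_hyperplaneParam hw, ← hausdorff_orthogonal_eq_volume hw]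
  exact (isometry_hyperplaneParam w κ t).map_euclideanHausdorffMeasure

lemma lintegral_hyperplane {w : EuclideanSpace ℝ (Fin d)} (hw : w ≠ 0) (κ t : ℝ)
    {F : EuclideanSpace ℝ (Fin d) → ℝ≥0∞} (hF : Measurable F) :
    ∫⁻ x in {x | inner ℝ w x + κ = t}, F x ∂(Measure.euclideanHausdorffMeasure (d - 1))
      = ∫⁻ z, F (hyperplaneParam w κ t z) := by
  rw [← map_hyperplaneParam hw, lintegral_map hF]
  exact (isometry_hyperplaneParam w κ t).continuous.measurable

lemma lintegral_span_singleton {w : EuclideanSpace ℝ (Fin d)} (hw : w ≠ 0)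
    {G : Submodule.span ℝ {w} → ℝ≥0∞} (hG : Measurable G) :
    ∫⁻ a, G a = ‖w‖ₑ * ∫⁻ r : ℝ, G (r • ⟨w, Submodule.mem_span_singleton_self w⟩) := by
  have h1 : (⟨w, Submodule.mem_span_singleton_self w⟩ : Submodule.span ℝ {w}) ≠ 0 := by
    simpa using hw
  have hv := volume_eq_of_finrank_eq_one (finrank_span_singleton hw) h1
  have hm : Measurable fun r : ℝ =>
      r • (⟨w, Submodule.mem_span_singleton_self w⟩ : Submodule.span ℝ {w}) :=
    measurable_id.smul_const _
  rw [hv, lintegral_smul_measure, smul_eq_mul, lintegral_map hG hm]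
  rfl

lemma lintegral_eq_lintegral_line {w : EuclideanSpace ℝ (Fin d)} (hw : w ≠ 0)
    {F : EuclideanSpace ℝ (Fin d) → ℝ≥0∞} (hF : Measurable F) :
    ∫⁻ x, F x = ‖w‖ₑ * ∫⁻ r : ℝ, ∫⁻ z : (Submodule.span ℝ {w})ᗮ, F (z + r • w) := by
  have hp := (Submodule.span ℝ {w}).measurePreserving_measurableEquivProd
    (0 : EuclideanSpace ℝ (Fin d))
  rw [InnerProductSpace.euclideanHausdorffMeasure_eq_volume] at hp
  have hF' : Measurable fun q : Submodule.span ℝ {w} × (Submodule.span ℝ {w})ᗮ =>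
      F ((q.2 : EuclideanSpace ℝ (Fin d)) + q.1) := by fun_prop
  have e1 : ∫⁻ x, F x = ∫⁻ q : Submodule.span ℝ {w} × (Submodule.span ℝ {w})ᗮ,
      F ((q.2 : EuclideanSpace ℝ (Fin d)) + q.1) := by
    rw [← hp.symm.lintegral_comp hF]
    refine lintegral_congr fun q => ?_
    rw [Submodule.measurableEquivProd_symm_apply, vadd_eq_add, add_zero, add_comm]
  rw [e1, Measure.volume_eq_prod, lintegral_prod _ hF'.aemeasurable]
  exact lintegral_span_singleton hw hF'.lintegral_prod_right'

/-- The coarea formula for an affine function with gradient w: the line ℝw contributes ‖w‖ dr, and r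
= (t - κ)/‖w‖² gives dr = dt/‖w‖², leaving ‖w‖⁻¹. -/
lemma lintegral_eq_lintegral_hyperplaneParam {w : EuclideanSpace ℝ (Fin d)} (hw : w ≠ 0) (κ : ℝ)
    {F : EuclideanSpace ℝ (Fin d) → ℝ≥0∞} (hF : Measurable F) :
    ∫⁻ x, F x = ‖w‖ₑ⁻¹ * ∫⁻ t : ℝ, ∫⁻ z, F (hyperplaneParam w κ t z) := by
  have hmeas : Measurable fun r : ℝ => ∫⁻ z : (Submodule.span ℝ {w})ᗮ, F (z + r • w) := by
    apply Measurable.lintegral_prod_right'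
      (f := fun q : ℝ × (Submodule.span ℝ {w})ᗮ => F (q.2 + q.1 • w))
    fun_prop
  have hn : 0 < ‖w‖ := norm_pos_iff.2 hw
  rw [lintegral_eq_lintegral_line hw hF]
  unfold hyperplaneParam
  have e1 := lintegral_sub_right_eq_self (μ := (volume : Measure ℝ))
    (fun t => ∫⁻ z : (Submodule.span ℝ {w})ᗮ, F (z + (t / ‖w‖ ^ 2) • w)) κ
  rw [e1]
  have e2 := Real.map_volume_mul_left (a := (‖w‖ ^ 2)⁻¹) (by positivity)
  have e3 := congrArg (fun m => ∫⁻ r, (∫⁻ z : (Submodule.span ℝ {w})ᗮ, F (z + r • w)) ∂m) e2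
  simp only [lintegral_smul_measure, smul_eq_mul] at e3
  rw [lintegral_map hmeas (measurable_const_mul _)] at e3
  simp_rw [div_eq_inv_mul]
  rw [e3, ← mul_assoc, inv_inv, abs_of_pos (by positivity), ENNReal.ofReal_pow hn.le,
    ofReal_norm, pow_two, ← mul_assoc, ENNReal.inv_mul_cancel (by simpa using hw) (by simp), one_mul]

lemma measurable_sliceIntegral {w : EuclideanSpace ℝ (Fin d)} (κ : ℝ)
    {F : EuclideanSpace ℝ (Fin d) → ℝ≥0∞} (hF : Measurable F) :
    Measurable fun t => ∫⁻ z, F (hyperplaneParam w κ t z) :=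
  Measurable.lintegral_prod_right' (f := fun q : ℝ × (Submodule.span ℝ {w})ᗮ =>
    F (hyperplaneParam w κ q.1 q.2)) (hF.comp (continuous_hyperplaneParam w κ).measurable)

lemma map_restrict_eq_withDensity {w : EuclideanSpace ℝ (Fin d)} (hw : w ≠ 0) (κ : ℝ)
    {ρ : EuclideanSpace ℝ (Fin d) → ℝ≥0∞} (hρ : Measurable ρ)
    {S : Set (EuclideanSpace ℝ (Fin d))} (hS : MeasurableSet S) :
    ((volume.withDensity ρ).restrict S).map (fun x => inner ℝ w x + κ)
      = volume.withDensity (fun t => ‖w‖ₑ⁻¹ *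
          ∫⁻ z, S.indicator ρ (hyperplaneParam w κ t z)) := by
  have hl : Measurable fun x : EuclideanSpace ℝ (Fin d) => inner ℝ w x + κ := by fun_prop
  ext A hA
  have hm := measurable_sliceIntegral (w := w) κ (hρ.indicator hS)
  rw [Measure.map_apply hl hA, Measure.restrict_apply (hl hA), withDensity_apply _ ((hl hA).inter hS),
    withDensity_apply _ hA, lintegral_const_mul _ hm, ← lintegral_indicator ((hl hA).inter hS),
    lintegral_eq_lintegral_hyperplaneParam hw κ (hρ.indicator ((hl hA).inter hS)),
    ← lintegral_indicator hA]
  congr 2 with t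
  by_cases ht : t ∈ A
  · rw [indicator_of_mem ht]
    refine lintegral_congr fun z => ?_
    by_cases hz : hyperplaneParam w κ t z ∈ S
    · rw [indicator_of_mem hz, indicator_of_mem]
      exact ⟨by rwa [mem_preimage, inner_hyperplaneParam hw], hz⟩
    · rw [indicator_of_notMem hz, indicator_of_notMem]
      exact fun h => hz h.2
  · rw [indicator_of_notMem ht]
    refine (lintegral_congr fun z => ?_).trans lintegral_zero
    refine indicator_of_notMem (fun h => ht ?_) _
    have := h.1
    rwa [mem_preimage, inner_hyperplaneParam hw] at this

/-! ### The slack as an affine function -/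

lemma slack_eq_inner (y : Fin n → EuclideanSpace ℝ (Fin d)) (g : EuclideanSpace ℝ (Fin d) → ℝ)
    (i j : Fin n) (x : EuclideanSpace ℝ (Fin d)) :
    slack y g i j x = inner ℝ ((2 : ℝ) • (y i - y j)) x
      + (‖y j‖ ^ 2 - ‖y i‖ ^ 2 + g (y i) - g (y j)) := by
  unfold slack
  rw [norm_sub_sq_real, norm_sub_sq_real, inner_smul_left, inner_sub_left,
    real_inner_comm x (y i), real_inner_comm x (y j)]
  simp only [conj_trivial]
  ring

lemma continuous_slack (y : Fin n → EuclideanSpace ℝ (Fin d)) (g : EuclideanSpace ℝ (Fin d) → ℝ)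
    (i j : Fin n) : Continuous (slack y g i j) := by
  unfold slack; fun_prop

lemma slack_self (y : Fin n → EuclideanSpace ℝ (Fin d)) (g : EuclideanSpace ℝ (Fin d) → ℝ)
    (i : Fin n) (x : EuclideanSpace ℝ (Fin d)) : slack y g i i x = 0 := by unfold slack; ring

lemma slack_swap (y : Fin n → EuclideanSpace ℝ (Fin d)) (g : EuclideanSpace ℝ (Fin d) → ℝ)
    (i j : Fin n) (x : EuclideanSpace ℝ (Fin d)) : slack y g j i x = -slack y g i j x := by
  unfold slack; ring

lemma slack_sub (y : Fin n → EuclideanSpace ℝ (Fin d)) (g : EuclideanSpace ℝ (Fin d) → ℝ)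
    (i j k : Fin n) (x : EuclideanSpace ℝ (Fin d)) :
    slack y g i k x - slack y g i j x = slack y g j k x := by
  unfold slack; ring

lemma mem_powerCell_iff {y : Fin n → EuclideanSpace ℝ (Fin d)} {g : EuclideanSpace ℝ (Fin d) → ℝ}
    {i : Fin n} {x : EuclideanSpace ℝ (Fin d)} :
    x ∈ powerCell y g i ↔ ∀ j, 0 ≤ slack y g i j x := by
  unfold powerCell slack
  refine forall_congr' fun j => ?_
  constructor <;> intro h <;> linarith

lemma isClosed_powerCell (y : Fin n → EuclideanSpace ℝ (Fin d))
    (g : EuclideanSpace ℝ (Fin d) → ℝ) (i : Fin n) : IsClosed (powerCell y g i) := by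
  have : powerCell y g i = ⋂ j, {x | 0 ≤ slack y g i j x} := by
    ext x; simp [mem_powerCell_iff]
  rw [this]
  exact isClosed_iInter fun j => isClosed_le continuous_const (continuous_slack y g i j)

lemma isClosed_shrunkCell (y : Fin n → EuclideanSpace ℝ (Fin d))
    (g : EuclideanSpace ℝ (Fin d) → ℝ) (i j : Fin n) (a : ℝ) :
    IsClosed (shrunkCell y g i j a) := by
  have : shrunkCell y g i j a
      = powerCell y g i ∩ ⋂ k, ⋂ (_ : k ≠ i), ⋂ (_ : k ≠ j), {x | a ≤ slack y g i k x} := by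
    ext x; simp [shrunkCell]
  rw [this]
  exact (isClosed_powerCell y g i).inter (isClosed_iInter fun k => isClosed_iInter fun _ =>
    isClosed_iInter fun _ => isClosed_le continuous_const (continuous_slack y g i k))

lemma shrunkCell_zero (y : Fin n → EuclideanSpace ℝ (Fin d))
    (g : EuclideanSpace ℝ (Fin d) → ℝ) (i j : Fin n) :
    shrunkCell y g i j 0 = powerCell y g i := by
  ext x
  simp only [shrunkCell, mem_ofPred_eq, and_iff_left_iff_imp]
  exact fun h k _ _ => mem_powerCell_iff.1 h k

/-- By the cocycle relation `slack_sub`, moving the base site from i to j changes no slack where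
Δ_ij = 0. Hence both forms of the theorem have the same constants. -/
lemma slice_zero_zero (y : Fin n → EuclideanSpace ℝ (Fin d))
    (g : EuclideanSpace ℝ (Fin d) → ℝ) (i j : Fin n) :
    slice y g i j 0 0 = powerCell y g i ∩ powerCell y g j := by
  ext x
  rw [slice, shrunkCell_zero]
  constructor
  · rintro ⟨h1, h2⟩
    refine ⟨h1, mem_powerCell_iff.2 fun k => ?_⟩
    rw [← slack_sub y g i j k x, h2, sub_zero]
    exact mem_powerCell_iff.1 h1 k
  · rintro ⟨h1, h2⟩
    refine ⟨h1, le_antisymm ?_ (mem_powerCell_iff.1 h1 j)⟩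
    have := mem_powerCell_iff.1 h2 i
    rw [slack_swap] at this
    linarith

lemma sliceMass_zero_zero (ρ : EuclideanSpace ℝ (Fin d) → ℝ≥0)
    (y : Fin n → EuclideanSpace ℝ (Fin d)) (g : EuclideanSpace ℝ (Fin d) → ℝ) (i j : Fin n) :
    sliceMass ρ y g i j 0 0 = faceMass ρ y g i j := by
  rw [sliceMass, slice_zero_zero, faceMass]

lemma faceMass_comm (ρ : EuclideanSpace ℝ (Fin d) → ℝ≥0)
    (y : Fin n → EuclideanSpace ℝ (Fin d)) (g : EuclideanSpace ℝ (Fin d) → ℝ) (i j : Fin n) :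
    faceMass ρ y g i j = faceMass ρ y g j i := by
  rw [faceMass, inter_comm, faceMass]

/-- The constant term of the affine function `slack y g i j`. -/
def slackConst (y : Fin n → EuclideanSpace ℝ (Fin d)) (g : EuclideanSpace ℝ (Fin d) → ℝ)
    (i j : Fin n) : ℝ := ‖y j‖ ^ 2 - ‖y i‖ ^ 2 + g (y i) - g (y j)

lemma two_smul_sub_ne_zero {y : Fin n → EuclideanSpace ℝ (Fin d)} (hy : Function.Injective y)
    {i j : Fin n} (hij : i ≠ j) : (2 : ℝ) • (y i - y j) ≠ 0 :=
  smul_ne_zero two_ne_zero (sub_ne_zero.2 (hy.ne hij))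

lemma sliceMass_eq_lintegral {ρ : EuclideanSpace ℝ (Fin d) → ℝ≥0} (hρ : Measurable ρ)
    {y : Fin n → EuclideanSpace ℝ (Fin d)} (hy : Function.Injective y)
    (g : EuclideanSpace ℝ (Fin d) → ℝ) {i j : Fin n} (hij : i ≠ j) (t a : ℝ) :
    sliceMass ρ y g i j t a = ∫⁻ z, (shrunkCell y g i j a).indicator (fun x => (ρ x : ℝ≥0∞))
      (hyperplaneParam ((2 : ℝ) • (y i - y j)) (slackConst y g i j) t z) := by
  have hS := (isClosed_shrunkCell y g i j a).measurableSet
  rw [← lintegral_hyperplane (two_smul_sub_ne_zero hy hij) _ _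
    (hρ.coe_nnreal_ennreal.indicator hS), lintegral_indicator hS, Measure.restrict_restrict hS,
    sliceMass]
  congr 2
  ext x
  simp only [slice, slack_eq_inner, slackConst, mem_ofPred_eq, mem_inter_iff]

/-- The gradient 2(y_i - y_j) of the slack is the source of the denominators ‖y_i - y_j‖ in the
final formula. -/
lemma map_slack_eq_withDensity {ρ : EuclideanSpace ℝ (Fin d) → ℝ≥0} (hρ : Measurable ρ)
    {y : Fin n → EuclideanSpace ℝ (Fin d)} (hy : Function.Injective y)
    (g : EuclideanSpace ℝ (Fin d) → ℝ) {i j : Fin n} (hij : i ≠ j) (a : ℝ) :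
    ((volume.withDensity fun x => (ρ x : ℝ≥0∞)).restrict (shrunkCell y g i j a)).map (slack y g i j)
      = volume.withDensity (fun t => (ENNReal.ofReal (2 * ‖y i - y j‖))⁻¹ *
          sliceMass ρ y g i j t a) := by
  have hS := (isClosed_shrunkCell y g i j a).measurableSet
  have := map_restrict_eq_withDensity (two_smul_sub_ne_zero hy hij) (slackConst y g i j)
    hρ.coe_nnreal_ennreal hS
  simp_rw [sliceMass_eq_lintegral hρ hy g hij]
  rw [show slack y g i j = _ from funext fun x => slack_eq_inner y g i j x, ← slackConst, this,
    ← ofReal_norm, norm_smul, Real.norm_two]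

lemma hasLaplaceLimit_map_slack {ρ : EuclideanSpace ℝ (Fin d) → ℝ≥0} (hρ : Measurable ρ)
    [IsFiniteMeasure (volume.withDensity fun x => (ρ x : ℝ≥0∞))]
    {y : Fin n → EuclideanSpace ℝ (Fin d)} (hy : Function.Injective y)
    {g : EuclideanSpace ℝ (Fin d) → ℝ} {i j : Fin n} (hij : i ≠ j) {a : ℝ}
    (hc : ContinuousWithinAt (fun t => sliceMass ρ y g i j t a) (Ici 0) 0)
    (hfin : sliceMass ρ y g i j 0 a ≠ ∞) :
    HasLaplaceLimit
      (((volume.withDensity fun x => (ρ x : ℝ≥0∞)).restrict (shrunkCell y g i j a)).map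
        (slack y g i j))
      ((sliceMass ρ y g i j 0 a).toReal / (2 * ‖y i - y j‖)) := by
  have hpos : 0 < 2 * ‖y i - y j‖ :=
    mul_pos two_pos (norm_pos_iff.2 (sub_ne_zero.2 (hy.ne hij)))
  have hS := (isClosed_shrunkCell y g i j a).measurableSet
  have hinv : (ENNReal.ofReal (2 * ‖y i - y j‖))⁻¹ ≠ ∞ := by
    simpa using hpos
  have hm : Measurable fun t => (ENNReal.ofReal (2 * ‖y i - y j‖))⁻¹ * sliceMass ρ y g i j t a := by
    simp_rw [sliceMass_eq_lintegral hρ hy g hij]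
    exact (measurable_sliceIntegral _ (hρ.coe_nnreal_ennreal.indicator hS)).const_mul _
  have key := map_slack_eq_withDensity hρ hy g hij a
  rw [key]
  have := hasLaplaceLimit_withDensity hm ?_ ?_
    (ENNReal.Tendsto.const_mul hc (Or.inr hinv)) (ENNReal.mul_ne_top hinv hfin)
  · rwa [ENNReal.toReal_mul, ENNReal.toReal_inv, ENNReal.toReal_ofReal hpos.le,
      ← div_eq_inv_mul] at this
  · rw [← setLIntegral_univ, ← withDensity_apply _ MeasurableSet.univ, ← key]
    exact measure_ne_top _ _
  · intro t ht
    have : slice y g i j t a = ∅ := by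
      refine eq_empty_of_forall_notMem fun x hx => ?_
      have := mem_powerCell_iff.1 hx.1.1 j
      rw [hx.2] at this
      linarith
    simp [sliceMass, this]

/-! ### Existence of dual maximizers -/

section DualMaximizer

variable {X : Type*} [MeasurableSpace X] {μ : Measure X} [IsProbabilityMeasure μ]

/-- Raising b' by ‖b - b'‖ in every coordinate puts it above b. The two hypotheses are shared by the
minimum and the soft minimum, so one existence proof covers the unregularized and the entropic dual.
-/
lemma abs_sub_le_norm_of_monotone_of_shift {m : (Fin n → ℝ) → ℝ} (hmono : Monotone m)
    (hshift : ∀ b s, m (fun i => b i + s) = m b + s) (b b' : Fin n → ℝ) :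
    |m b - m b'| ≤ ‖b - b'‖ := by
  have key : ∀ b b' : Fin n → ℝ, m b - m b' ≤ ‖b - b'‖ := by
    intro b b'
    rw [sub_le_iff_le_add', ← hshift]
    refine hmono fun i => ?_
    have := (le_abs_self _).trans (norm_le_pi_norm (b - b') i)
    simp only [Pi.sub_apply] at this
    linarith
  refine abs_sub_le_iff.2 ⟨key b b', ?_⟩
  rw [norm_sub_rev]
  exact key b' b

lemma integrable_comp_sub {m : (Fin n → ℝ) → ℝ} (hmono : Monotone m)
    (hshift : ∀ b s, m (fun i => b i + s) = m b + s) {c : X → Fin n → ℝ} (hc : Integrable c μ)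
    (g : Fin n → ℝ) : Integrable (fun x => m (c x - g)) μ := by
  have hL := abs_sub_le_norm_of_monotone_of_shift hmono hshift
  have hcont : Continuous m := by
    refine LipschitzWith.continuous (K := 1) (LipschitzWith.of_dist_le_mul fun b b' => ?_)
    rw [Real.dist_eq, dist_eq_norm, NNReal.coe_one, one_mul]
    exact hL b b'
  have h1 : Integrable (fun x => ‖c x - g‖ + |m 0|) μ :=
    ((hc.sub (integrable_const g)).norm).add (integrable_const _)
  refine h1.mono' (hcont.comp_aestronglyMeasurable (hc.1.sub aestronglyMeasurable_const))
    (ae_of_all _ fun x => ?_)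
  have := hL (c x - g) 0
  rw [sub_zero] at this
  rw [Real.norm_eq_abs]
  calc |m (c x - g)| = |(m (c x - g) - m 0) + m 0| := by rw [sub_add_cancel]
    _ ≤ _ := (abs_add_le _ _).trans (by gcongr)

/-- A concave-type dual functional built from a soft or hard minimum `m` attains its maximum. -/
lemma exists_dual_maximizer {w : Fin n → ℝ} (hw : ∀ i, 0 < w i) (hw1 : ∑ i, w i = 1)
    {m : (Fin n → ℝ) → ℝ} (hmono : Monotone m)
    (hshift : ∀ b s, m (fun i => b i + s) = m b + s) (hle : ∀ b k, m b ≤ b k)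
    {c : X → Fin n → ℝ} (hc : Integrable c μ) :
    ∃ g : Fin n → ℝ, ∀ g' : Fin n → ℝ,
      ∑ i, w i * g' i + ∫ x, m (c x - g') ∂μ ≤ ∑ i, w i * g i + ∫ x, m (c x - g) ∂μ := by
  set Φ : (Fin n → ℝ) → ℝ := fun g => ∑ i, w i * g i + ∫ x, m (c x - g) ∂μ with hΦ
  have hint := integrable_comp_sub hmono hshift hc
  have hci : ∀ k, Integrable (fun x => c x k) μ := fun k => hc.eval k
  have hcontΦ : Continuous Φ := by
    refine Continuous.add (by fun_prop) ?_
    refine LipschitzWith.continuous (K := 1) (LipschitzWith.of_dist_le_mul fun g g' => ?_)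
    rw [Real.dist_eq, dist_eq_norm, NNReal.coe_one, one_mul, ← integral_sub (hint g) (hint g'),
      ← Real.norm_eq_abs]
    refine (norm_integral_le_of_norm_le_const (C := ‖g - g'‖) (ae_of_all _ fun x => ?_)).trans
      (by simp)
    refine (abs_sub_le_norm_of_monotone_of_shift hmono hshift _ _).trans ?_
    rw [sub_sub_sub_cancel_left, norm_sub_rev]
  have hshiftΦ : ∀ g s, Φ (fun i => g i + s) = Φ g := by
    intro g s
    have : ∀ x, m (c x - fun i => g i + s) = m (c x - g) - s := by
      intro x
      rw [sub_eq_add_neg (m _), ← hshift]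
      congr 1 with i
      simp only [Pi.sub_apply]; ring
    simp only [hΦ, this, mul_add, Finset.sum_add_distrib, ← Finset.sum_mul, hw1]
    rw [integral_sub (hint g) (integrable_const _)]
    simp
  -- Coercivity after normalization: a single large coordinate of g already makes the functional
  -- small, because m is below every coordinate.
  have hcoer : ∀ g k, ∑ i, w i * g i = 0 → Φ g ≤ ∫ x, c x k ∂μ - g k := by
    intro g k hg
    simp only [hΦ, hg, zero_add]
    rw [← sub_nonneg, show g k = ∫ _, g k ∂μ by simp, ← integral_sub (hci k) (integrable_const _),
      sub_nonneg]
    exact integral_mono (hint g) ((hci k).sub (integrable_const _)) fun x => hle _ k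
  set D : Fin n → ℝ := fun k => ∫ x, c x k ∂μ - Φ 0 with hD
  have hD0 : ∀ k, 0 ≤ D k := by
    intro k
    have := hcoer 0 k (by simp)
    simp only [Pi.zero_apply, sub_zero] at this
    simp only [hD]; linarith
  -- B dominates every D_k, so a normalized g with some coordinate above B does worse than g = 0 and
  -- can be discarded.
  set B : ℝ := ∑ k, D k with hB
  have hDB : ∀ k, D k ≤ B := fun k => Finset.single_le_sum (fun i _ => hD0 i) (Finset.mem_univ k)
  set K : Set (Fin n → ℝ) := {g | ∑ i, w i * g i = 0} ∩ {g | ∀ k, g k ≤ B} with hK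
  have hKc : IsClosed K := by
    refine (isClosed_eq (by fun_prop) continuous_const).inter ?_
    have : {g : Fin n → ℝ | ∀ k, g k ≤ B} = Iic (fun _ => B) := by ext g; simp [Pi.le_def]
    rw [this]; exact isClosed_Iic
  have hB0 : 0 ≤ B := Finset.sum_nonneg fun i _ => hD0 i
  -- The upper bounds together with the zero weighted mean give the lower bounds, since the weights
  -- are positive and sum to 1.
  have hKsub : K ⊆ Icc (fun k => -B / w k) (fun _ => B) := by
    rintro g ⟨h1, h2⟩
    refine ⟨fun k => ?_, h2⟩
    rw [div_le_iff₀ (hw k)]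
    have h3 : ∑ i ∈ Finset.univ.erase k, w i * g i ≤ ∑ i ∈ Finset.univ.erase k, w i * B :=
      Finset.sum_le_sum fun i _ => mul_le_mul_of_nonneg_left (h2 i) (hw i).le
    have h4 : ∑ i ∈ Finset.univ.erase k, w i * B ≤ B := by
      rw [← Finset.sum_mul]
      refine mul_le_of_le_one_left hB0 ?_
      rw [← hw1]
      exact Finset.sum_le_sum_of_subset_of_nonneg (Finset.erase_subset _ _) fun i _ _ => (hw i).le
    have h5 := Finset.add_sum_erase Finset.univ (fun i => w i * g i) (Finset.mem_univ k)
    have h1' : ∑ i, w i * g i = 0 := h1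
    linarith
  have hKcomp : IsCompact K := isCompact_Icc.of_isClosed_subset hKc hKsub
  obtain ⟨g, hgK, hg⟩ := hKcomp.exists_isMaxOn (f := Φ) ⟨0, by simp, fun k => hB0⟩
    hcontΦ.continuousOn
  refine ⟨g, fun g' => ?_⟩
  set s := -∑ i, w i * g' i with hs
  change Φ g' ≤ Φ g
  rw [← hshiftΦ g' s]
  have hsum : ∑ i, w i * (g' i + s) = 0 := by
    simp only [mul_add, Finset.sum_add_distrib, ← Finset.sum_mul, hw1, hs]; ring
  by_cases h : ∀ k, g' k + s ≤ B
  · exact hg ⟨hsum, h⟩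
  · push Not at h
    obtain ⟨k, hk⟩ := h
    have h0 : Φ 0 ≤ Φ g := hg ⟨by simp, fun k => hB0⟩
    have h1 := hcoer _ k hsum
    have h2 := hDB k
    simp only [hD] at h2
    linarith

end DualMaximizer

/-! ### Soft minimum and softmax weights -/

/-- The Gibbs weights `e^{b_i} / ∑_k e^{b_k}`. -/
def softmax (b : Fin n → ℝ) (i : Fin n) : ℝ := Real.exp (b i) / ∑ k, Real.exp (b k)

/-- The soft minimum `-log ∑_k e^{-b_k}`. -/
def softmin (b : Fin n → ℝ) : ℝ := -Real.log (∑ k, Real.exp (-b k))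

lemma sum_exp_pos [NeZero n] (b : Fin n → ℝ) : 0 < ∑ k, Real.exp (b k) :=
  Finset.sum_pos (fun _ _ => Real.exp_pos _) ⟨0, Finset.mem_univ _⟩

lemma softmax_nonneg (b : Fin n → ℝ) (i : Fin n) : 0 ≤ softmax b i :=
  div_nonneg (Real.exp_pos _).le (Finset.sum_nonneg fun _ _ => (Real.exp_pos _).le)

lemma sum_softmax [NeZero n] (b : Fin n → ℝ) : ∑ i, softmax b i = 1 := by
  unfold softmax
  rw [← Finset.sum_div, div_self (sum_exp_pos b).ne']

lemma softmax_le_one [NeZero n] (b : Fin n → ℝ) (i : Fin n) : softmax b i ≤ 1 := by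
  rw [← sum_softmax b]
  exact Finset.single_le_sum (fun j _ => softmax_nonneg b j) (Finset.mem_univ i)

lemma continuous_softmax [NeZero n] (i : Fin n) : Continuous fun b : Fin n → ℝ => softmax b i := by
  unfold softmax
  exact Continuous.div (by fun_prop) (by fun_prop) fun b => (sum_exp_pos b).ne'

lemma softmin_mono [NeZero n] : Monotone (softmin (n := n)) := by
  intro b b' h
  unfold softmin
  refine neg_le_neg (Real.log_le_log (sum_exp_pos _) (Finset.sum_le_sum fun k _ => ?_))
  exact Real.exp_le_exp.2 (neg_le_neg (h k))

lemma softmin_add [NeZero n] (b : Fin n → ℝ) (s : ℝ) :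
    softmin (fun i => b i + s) = softmin b + s := by
  unfold softmin
  have : ∑ k, Real.exp (-(b k + s)) = Real.exp (-s) * ∑ k, Real.exp (-b k) := by
    rw [Finset.mul_sum]
    refine Finset.sum_congr rfl fun k _ => ?_
    rw [← Real.exp_add]; ring_nf
  rw [this, Real.log_mul (Real.exp_ne_zero _) (sum_exp_pos _).ne', Real.log_exp]
  ring

lemma softmin_le [NeZero n] (b : Fin n → ℝ) (k : Fin n) : softmin b ≤ b k := by
  unfold softmin
  rw [neg_le]
  calc -b k = Real.log (Real.exp (-b k)) := (Real.log_exp _).symm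
    _ ≤ _ := Real.log_le_log (Real.exp_pos _)
      (Finset.single_le_sum (f := fun k => Real.exp (-b k)) (fun _ _ => (Real.exp_pos _).le)
        (Finset.mem_univ k))

lemma softmax_eq_exp [NeZero n] (b : Fin n → ℝ) (i : Fin n) :
    softmax b i = Real.exp (b i + softmin (-b)) := by
  unfold softmax softmin
  simp only [Pi.neg_apply, neg_neg]
  rw [Real.exp_add, Real.exp_neg, Real.exp_log (sum_exp_pos _), div_eq_mul_inv]

/-- Lowering b_i by ε multiplies the partition sum by 1 + p_i(e^ε - 1), where p_i is the Gibbs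
weight; then log(1+x) ≤ x. -/
lemma softmin_sub_single_ge [NeZero n] (b : Fin n → ℝ) (i : Fin n) {ε : ℝ} (hε : 0 ≤ ε) :
    softmin b - softmax (-b) i * (Real.exp ε - 1) ≤ softmin (b - Pi.single i ε) := by
  have h0 := sum_exp_pos (-b)
  have h1 : 0 ≤ softmax (-b) i * (Real.exp ε - 1) :=
    mul_nonneg (softmax_nonneg _ _) (by linarith [Real.add_one_le_exp ε])
  have h2 : ∑ k, Real.exp (-(b - Pi.single i ε : Fin n → ℝ) k)
      = (∑ k, Real.exp (-b k)) * (1 + softmax (-b) i * (Real.exp ε - 1)) := by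
    unfold softmax
    simp only [Pi.neg_apply] at h0 ⊢
    rw [mul_add, mul_one, ← mul_assoc, mul_div_cancel₀ _ h0.ne',
      ← Finset.add_sum_erase _ _ (Finset.mem_univ i),
      ← Finset.add_sum_erase _ (fun k => Real.exp (-b k)) (Finset.mem_univ i)]
    have : ∑ k ∈ Finset.univ.erase i, Real.exp (-(b - Pi.single i ε : Fin n → ℝ) k)
        = ∑ k ∈ Finset.univ.erase i, Real.exp (-b k) := by
      refine Finset.sum_congr rfl fun k hk => ?_
      simp [Finset.ne_of_mem_erase hk]
    rw [this]
    simp only [Pi.sub_apply, Pi.single_eq_same]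
    rw [show -(b i - ε) = -b i + ε by ring, Real.exp_add]
    ring
  unfold softmin
  simp only [Pi.neg_apply] at h0
  rw [h2, Real.log_mul h0.ne' (by positivity)]
  have := Real.log_le_sub_one_of_pos (show 0 < 1 + softmax (-b) i * (Real.exp ε - 1) by positivity)
  linarith

/-! ### First-order conditions at dual maximizers. -/

section FirstOrder

variable {X : Type*} [MeasurableSpace X] {μ : Measure X} [IsProbabilityMeasure μ]

lemma integrable_softmax [NeZero n] {b : X → Fin n → ℝ} (hb : AEStronglyMeasurable b μ)
    (i : Fin n) : Integrable (fun x => softmax (b x) i) μ := by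
  refine (integrable_const (1 : ℝ)).mono' ((continuous_softmax i).comp_aestronglyMeasurable hb)
    (ae_of_all _ fun x => ?_)
  rw [Real.norm_eq_abs, abs_of_nonneg (softmax_nonneg _ _)]
  exact softmax_le_one _ _

/-- Existence of Gibbs weights with prescribed total masses. -/
lemma exists_softmax_integral_eq [NeZero n] {w : Fin n → ℝ} (hw : ∀ i, 0 < w i)
    (hw1 : ∑ i, w i = 1) {c : X → Fin n → ℝ} (hc : Integrable c μ) :
    ∃ θ : Fin n → ℝ, ∀ i, ∫ x, softmax (θ - c x) i ∂μ = w i := by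
  obtain ⟨θ, hθ⟩ := exists_dual_maximizer hw hw1 softmin_mono softmin_add softmin_le hc
  refine ⟨θ, ?_⟩
  have hint : ∀ i, Integrable (fun x => softmax (θ - c x) i) μ := fun i =>
    integrable_softmax (aestronglyMeasurable_const.sub hc.1) i
  -- Only upward perturbations of θ_i are tested. The resulting inequalities suffice, since both
  -- families of masses sum to 1 and must then agree termwise.
  have hge : ∀ i, w i ≤ ∫ x, softmax (θ - c x) i ∂μ := by
    intro i
    set P := ∫ x, softmax (θ - c x) i ∂μ with hP
    have h1 : ∀ ε > 0, w i ≤ P * ((Real.exp ε - 1) / ε) := by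
      intro ε hε
      have h2 := hθ (θ + Pi.single i ε)
      have h3 : ∫ x, softmin (c x - θ) ∂μ - P * (Real.exp ε - 1)
          ≤ ∫ x, softmin (c x - (θ + Pi.single i ε)) ∂μ := by
        rw [hP, ← integral_mul_const, ← integral_sub
          (integrable_comp_sub softmin_mono softmin_add hc θ) ((hint i).mul_const _)]
        refine integral_mono ((integrable_comp_sub softmin_mono softmin_add hc θ).sub
          ((hint i).mul_const _)) (integrable_comp_sub softmin_mono softmin_add hc _) fun x => ?_
        have := softmin_sub_single_ge (c x - θ) i hε.le
        rwa [neg_sub, sub_sub] at this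
      have h4 : ∑ j, w j * (θ + Pi.single i ε : Fin n → ℝ) j = ∑ j, w j * θ j + w i * ε := by
        simp [mul_add, Finset.sum_add_distrib, Pi.single_apply]
      rw [h4] at h2
      rw [← mul_div_assoc, le_div_iff₀ hε]
      linarith
    have h5 : Tendsto (fun ε : ℝ => P * ((Real.exp ε - 1) / ε)) (𝓝[>] 0) (𝓝 (P * 1)) := by
      refine Tendsto.const_mul _ ?_
      have := (Real.hasDerivAt_exp 0).tendsto_slope_zero_right
      simpa [div_eq_inv_mul] using this
    rw [mul_one] at h5
    exact ge_of_tendsto h5 (eventually_nhdsWithin_of_forall fun ε hε => h1 ε hε)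
  have hsum : ∑ i, w i = ∑ i, ∫ x, softmax (θ - c x) i ∂μ := by
    rw [hw1, ← integral_finsetSum _ fun i _ => hint i]
    simp [sum_softmax]
  intro i
  exact ((Finset.sum_eq_sum_iff_of_le fun i _ => hge i).1 hsum i (Finset.mem_univ i)).symm

lemma iInf_mono_pi [NeZero n] : Monotone fun b : Fin n → ℝ => ⨅ k, b k := fun b _ h =>
  ciInf_mono (Finite.bddBelow_range b) h

lemma iInf_add_const [NeZero n] (b : Fin n → ℝ) (s : ℝ) : ⨅ k, (b k + s) = (⨅ k, b k) + s :=
  (ciInf_add (Finite.bddBelow_range b) s).symm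

/-- First-order condition: at a dual maximizer every cell has at least the prescribed mass. -/
lemma le_measureReal_cell_of_isMax [NeZero n] {w : Fin n → ℝ}
    {c : X → Fin n → ℝ} (hc : Integrable c μ) (hcm : Measurable c) {g : Fin n → ℝ}
    (hg : ∀ g' : Fin n → ℝ, ∑ i, w i * g' i + ∫ x, ⨅ k, (c x - g') k ∂μ
      ≤ ∑ i, w i * g i + ∫ x, ⨅ k, (c x - g) k ∂μ) (i : Fin n) :
    w i ≤ μ.real {x | c x i - g i ≤ ⨅ k, (c x - g) k} := by
  have hint := integrable_comp_sub (μ := μ) iInf_mono_pi iInf_add_const hc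
  have hmm : Measurable fun x => ⨅ k, (c x - g) k :=
    Measurable.iInf fun k => by
      exact (measurable_pi_apply k).comp (hcm.sub_const g)
  -- Raising g_i by ε lowers the minimum by at most ε, and only on this enlarged cell. Maximality
  -- thus gives w_i ≤ μ(A ε), and the enlarged cells decrease to the cell as ε ↓ 0.
  set A : ℝ → Set X := fun ε => {x | c x i - g i - ε ≤ ⨅ k, (c x - g) k} with hA
  have hAm : ∀ ε, MeasurableSet (A ε) := fun ε => by
    refine measurableSet_le ?_ hmm
    exact (((measurable_pi_apply i).comp hcm).sub_const _).sub_const _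
  have h1 : ∀ ε > 0, w i ≤ μ.real (A ε) := by
    intro ε hε
    have h2 := hg (g + Pi.single i ε)
    have hi : Integrable ((A ε).indicator fun _ => ε) μ := (integrable_const ε).indicator (hAm ε)
    have h3 : ∫ x, ⨅ k, (c x - g) k ∂μ - ε * μ.real (A ε)
          ≤ ∫ x, ⨅ k, (c x - (g + Pi.single i ε) : Fin n → ℝ) k ∂μ := by
      rw [show ε * μ.real (A ε) = ∫ x, (A ε).indicator (fun _ => ε) x ∂μ by
        rw [integral_indicator (hAm ε), setIntegral_const, smul_eq_mul, mul_comm],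
        ← integral_sub (hint g) hi]
      refine integral_mono ((hint g).sub hi) (hint _) fun x => ?_
      refine le_ciInf fun k => ?_
      have hk : ⨅ k, (c x - g) k ≤ (c x - g) k := ciInf_le (Finite.bddBelow_range (c x - g)) k
      simp only [Pi.sub_apply, Pi.add_apply] at hk ⊢
      by_cases hx : x ∈ A ε
      · rw [indicator_of_mem hx]
        by_cases hki : k = i
        · subst hki; simp only [Pi.single_eq_same]; linarith
        · simp only [Pi.single_eq_of_ne hki]; linarith
      · rw [indicator_of_notMem hx]
        by_cases hki : k = i
        · subst hki
          have : ¬ (c x k - g k - ε ≤ ⨅ k, (c x - g) k) := hx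
          simp only [Pi.single_eq_same, Pi.sub_apply] at this ⊢; linarith
        · simp only [Pi.single_eq_of_ne hki]; linarith
    have h4 : ∑ j, w j * (g + Pi.single i ε : Fin n → ℝ) j = ∑ j, w j * g j + w i * ε := by
      simp [mul_add, Finset.sum_add_distrib, Pi.single_apply]
    rw [h4] at h2
    have : w i * ε ≤ μ.real (A ε) * ε := by linarith
    exact le_of_mul_le_mul_right this hε
  have h5 : {x | c x i - g i ≤ ⨅ k, (c x - g) k} = ⋂ k : ℕ, A (1 / ((k : ℝ) + 1)) := by
    ext x
    simp only [hA, mem_iInter, mem_ofPred_eq]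
    constructor
    · intro h k
      have : (0 : ℝ) < 1 / ((k : ℝ) + 1) := by positivity
      linarith
    · intro h
      refine le_of_forall_pos_le_add fun ε hε => ?_
      obtain ⟨k, hk⟩ := exists_nat_one_div_lt hε
      have := h k
      linarith
  have hanti : Antitone fun k : ℕ => A (1 / ((k : ℝ) + 1)) := by
    intro k l hkl x hx
    have h6 : 1 / ((l : ℝ) + 1) ≤ 1 / ((k : ℝ) + 1) := Nat.one_div_le_one_div hkl
    simp only [hA, mem_ofPred_eq] at hx ⊢
    linarith
  have h7 := tendsto_measure_iInter_atTop (μ := μ)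
    (fun k : ℕ => (hAm (1 / ((k : ℝ) + 1))).nullMeasurableSet) hanti ⟨0, measure_ne_top _ _⟩
  rw [← h5] at h7
  have h8 := (ENNReal.tendsto_toReal (measure_ne_top μ _)).comp h7
  exact ge_of_tendsto h8 (Eventually.of_forall fun k => h1 _ (by positivity))

end FirstOrder

/-! ### The semidiscrete setting: integrals against ν and against couplings. -/

/-- The standing assumptions on the marginals that concern neither the density of `μ` nor the
geometry of its support. -/
structure IsSemidiscrete (μ ν : Measure (EuclideanSpace ℝ (Fin d)))
    (y : Fin n → EuclideanSpace ℝ (Fin d)) : Prop where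
  injective : Function.Injective y
  null_compl : ν (range y)ᶜ = 0
  pos : ∀ i, 0 < ν {y i}
  secondMoment : ∫⁻ x, ‖x‖ₑ ^ 2 ∂μ < ∞

/-- The vector of transport costs from `x` to the sites. -/
def siteCost (y : Fin n → EuclideanSpace ℝ (Fin d)) (x : EuclideanSpace ℝ (Fin d)) : Fin n → ℝ :=
  fun i => ‖x - y i‖ ^ 2

/-- The function equal to `g i` at the site `y i` and to `0` elsewhere. -/
def extendSites (y : Fin n → EuclideanSpace ℝ (Fin d)) (g : Fin n → ℝ)
    (z : EuclideanSpace ℝ (Fin d)) : ℝ := ∑ i, ({y i} : Set _).indicator (fun _ => g i) z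

/-- The `c`-transform of a potential on the sites. -/
def cTransform (y : Fin n → EuclideanSpace ℝ (Fin d)) (g : Fin n → ℝ)
    (x : EuclideanSpace ℝ (Fin d)) : ℝ := ⨅ k, (siteCost y x - g) k

lemma continuous_siteCost (y : Fin n → EuclideanSpace ℝ (Fin d)) : Continuous (siteCost y) := by
  unfold siteCost; fun_prop

lemma measurable_extendSites (y : Fin n → EuclideanSpace ℝ (Fin d)) (g : Fin n → ℝ) :
    Measurable (extendSites y g) :=
  Finset.measurable_sum _ fun _ _ => measurable_const.indicator (measurableSet_singleton _)

lemma measurable_cTransform (y : Fin n → EuclideanSpace ℝ (Fin d)) (g : Fin n → ℝ) :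
    Measurable (cTransform y g) :=
  Measurable.iInf fun k =>
    ((measurable_pi_apply k).comp (continuous_siteCost y).measurable).sub_const (g k)

lemma cTransform_le (y : Fin n → EuclideanSpace ℝ (Fin d)) (g : Fin n → ℝ)
    (x : EuclideanSpace ℝ (Fin d)) (i : Fin n) : cTransform y g x ≤ ‖x - y i‖ ^ 2 - g i :=
  ciInf_le (Finite.bddBelow_range (siteCost y x - g)) i

section
variable {μ ν : Measure (EuclideanSpace ℝ (Fin d))} [IsProbabilityMeasure μ]
  [IsProbabilityMeasure ν] {y : Fin n → EuclideanSpace ℝ (Fin d)}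

lemma extendSites_apply (hy : Function.Injective y) (g : Fin n → ℝ) (i : Fin n) :
    extendSites y g (y i) = g i := by
  unfold extendSites
  rw [Finset.sum_eq_single i]
  · simp
  · intro j _ hj
    simp [hy.ne hj.symm]
  · simp

namespace IsSemidiscrete

open scoped Classical in
lemma eq_sum_dirac (h : IsSemidiscrete μ ν y) :
    ν = ∑ i, ν {y i} • Measure.dirac (y i) := by
  ext A hA
  have h1 : ν A = ν (⋃ i ∈ Finset.univ.filter (fun i => y i ∈ A), {y i}) := by
    refine measure_congr ?_
    have : ∀ᵐ z ∂ν, z ∈ range y := h.null_compl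
    filter_upwards [this] with z hz
    obtain ⟨i, rfl⟩ := hz
    refine propext ⟨fun hi => ?_, fun hi => ?_⟩
    · exact mem_iUnion₂.2 ⟨i, Finset.mem_filter.2 ⟨Finset.mem_univ i, hi⟩, rfl⟩
    · obtain ⟨j, hj, e⟩ := mem_iUnion₂.1 hi
      have := (Finset.mem_filter.1 hj).2
      rw [mem_singleton_iff] at e
      change y i ∈ A
      rwa [e]
  rw [h1, measure_biUnion_finset]
  · rw [Finset.sum_filter]
    simp [Measure.dirac_apply' _ hA, indicator_apply]
  · intro i _ j _ hij
    simpa [Function.onFun] using h.injective.ne hij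
  · exact fun _ _ => measurableSet_singleton _

lemma lintegral_eq (h : IsSemidiscrete μ ν y) {F : EuclideanSpace ℝ (Fin d) → ℝ≥0∞}
    (hF : Measurable F) : ∫⁻ z, F z ∂ν = ∑ i, ν {y i} * F (y i) := by
  conv_lhs => rw [h.eq_sum_dirac]
  rw [lintegral_finsetSum_measure]
  simp [lintegral_dirac' _ hF]

lemma ae_iff (h : IsSemidiscrete μ ν y) {P : EuclideanSpace ℝ (Fin d) → Prop} :
    (∀ᵐ z ∂ν, P z) ↔ ∀ i, P (y i) := by
  constructor
  · intro hP i
    by_contra hi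
    have : ν {y i} ≤ ν {z | ¬ P z} := measure_mono (by simpa using hi)
    rw [MeasureTheory.ae_iff.1 hP] at this
    exact (h.pos i).not_ge this
  · intro hP
    have : ∀ᵐ z ∂ν, z ∈ range y := h.null_compl
    filter_upwards [this] with z hz
    obtain ⟨i, rfl⟩ := hz
    exact hP i

lemma integrable_right (h : IsSemidiscrete μ ν y) (F : EuclideanSpace ℝ (Fin d) → ℝ) :
    Integrable F ν := by
  rw [h.eq_sum_dirac, integrable_finsetSum_measure]
  intro i _
  exact (integrable_dirac (by simp)).smul_measure (measure_ne_top _ _)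

lemma integral_eq (h : IsSemidiscrete μ ν y) (F : EuclideanSpace ℝ (Fin d) → ℝ) :
    ∫ z, F z ∂ν = ∑ i, ν.real {y i} * F (y i) := by
  conv_lhs => rw [h.eq_sum_dirac]
  rw [integral_finsetSum_measure]
  · simp [Measure.real]
  · intro i _
    exact (integrable_dirac (by simp)).smul_measure (measure_ne_top _ _)

lemma real_pos (h : IsSemidiscrete μ ν y) (i : Fin n) : 0 < ν.real {y i} :=
  ENNReal.toReal_pos (h.pos i).ne' (measure_ne_top _ _)

lemma sum_real (h : IsSemidiscrete μ ν y) : ∑ i, ν.real {y i} = 1 := by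
  have := h.integral_eq (fun _ => (1 : ℝ))
  simpa using this.symm

lemma neZero (h : IsSemidiscrete μ ν y) : NeZero n := by
  refine ⟨fun hn => ?_⟩
  subst hn
  have := h.sum_real
  simp at this

lemma integrable_norm_sq (h : IsSemidiscrete μ ν y) : Integrable (fun x => ‖x‖ ^ 2) μ := by
  refine ⟨by fun_prop, ?_⟩
  have := h.secondMoment
  simpa [HasFiniteIntegral] using this

lemma integrable_siteCost (h : IsSemidiscrete μ ν y) : Integrable (siteCost y) μ := by
  refine Integrable.of_eval fun i => ?_
  refine Integrable.mono' ((h.integrable_norm_sq.const_mul 2).add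
    (integrable_const (2 * ‖y i‖ ^ 2))) (by unfold siteCost; fun_prop) (ae_of_all _ fun x => ?_)
  unfold siteCost
  rw [Real.norm_eq_abs, abs_of_nonneg (by positivity)]
  have h1 := norm_sub_le x (y i)
  have h2 := norm_nonneg (x - y i)
  simp only [Pi.add_apply]
  nlinarith [sq_nonneg (‖x‖ - ‖y i‖)]

lemma ae_snd (h : IsSemidiscrete μ ν y)
    {π : Measure (EuclideanSpace ℝ (Fin d) × EuclideanSpace ℝ (Fin d))}
    (hπ : IsCoupling μ ν π) : ∀ᵐ z ∂π, ∃ i, z.2 = y i := by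
  have h1 : ∀ᵐ z ∂π.snd, z ∈ range y := by rw [hπ.2]; exact h.null_compl
  have h2 := ae_of_ae_map measurable_snd.aemeasurable h1
  filter_upwards [h2] with z hz
  obtain ⟨i, hi⟩ := hz
  exact ⟨i, hi.symm⟩

end IsSemidiscrete

lemma IsCoupling.isProbabilityMeasure
    {π : Measure (EuclideanSpace ℝ (Fin d) × EuclideanSpace ℝ (Fin d))}
    (hπ : IsCoupling μ ν π) : IsProbabilityMeasure π := by
  refine ⟨?_⟩
  rw [← Measure.fst_univ, hπ.1, measure_univ]

lemma IsCoupling.integrable_fst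
    {π : Measure (EuclideanSpace ℝ (Fin d) × EuclideanSpace ℝ (Fin d))}
    (hπ : IsCoupling μ ν π) {F : EuclideanSpace ℝ (Fin d) → ℝ} (hF : Integrable F μ) :
    Integrable (fun z => F z.1) π := by
  rw [← hπ.1, Measure.fst] at hF
  exact hF.comp_measurable measurable_fst

lemma IsCoupling.integral_fst
    {π : Measure (EuclideanSpace ℝ (Fin d) × EuclideanSpace ℝ (Fin d))}
    (hπ : IsCoupling μ ν π) {F : EuclideanSpace ℝ (Fin d) → ℝ} (hF : Integrable F μ) :
    ∫ z, F z.1 ∂π = ∫ x, F x ∂μ := by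
  rw [← hπ.1, Measure.fst] at hF ⊢
  exact (integral_map measurable_fst.aemeasurable hF.1).symm

lemma IsCoupling.integrable_snd
    {π : Measure (EuclideanSpace ℝ (Fin d) × EuclideanSpace ℝ (Fin d))}
    (hπ : IsCoupling μ ν π) {F : EuclideanSpace ℝ (Fin d) → ℝ} (hF : Integrable F ν) :
    Integrable (fun z => F z.2) π := by
  rw [← hπ.2, Measure.snd] at hF
  exact hF.comp_measurable measurable_snd

lemma IsCoupling.integral_snd
    {π : Measure (EuclideanSpace ℝ (Fin d) × EuclideanSpace ℝ (Fin d))}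
    (hπ : IsCoupling μ ν π) {F : EuclideanSpace ℝ (Fin d) → ℝ} (hF : Integrable F ν) :
    ∫ z, F z.2 ∂π = ∫ x, F x ∂ν := by
  rw [← hπ.2, Measure.snd] at hF ⊢
  exact (integral_map measurable_snd.aemeasurable hF.1).symm

namespace IsSemidiscrete

lemma integrable_cost (h : IsSemidiscrete μ ν y)
    {π : Measure (EuclideanSpace ℝ (Fin d) × EuclideanSpace ℝ (Fin d))}
    (hπ : IsCoupling μ ν π) : Integrable (fun z => ‖z.1 - z.2‖ ^ 2) π := by
  have := hπ.isProbabilityMeasure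
  refine Integrable.mono' (((hπ.integrable_fst h.integrable_norm_sq).const_mul 2).add
    ((hπ.integrable_snd (h.integrable_right fun x => ‖x‖ ^ 2)).const_mul 2))
    (by fun_prop) (ae_of_all _ fun z => ?_)
  rw [Real.norm_eq_abs, abs_of_nonneg (by positivity)]
  have h1 := norm_sub_le z.1 z.2
  have h2 := norm_nonneg (z.1 - z.2)
  simp only [Pi.add_apply]
  nlinarith [sq_nonneg (‖z.1‖ - ‖z.2‖)]

lemma cost_ne_top (h : IsSemidiscrete μ ν y)
    {π : Measure (EuclideanSpace ℝ (Fin d) × EuclideanSpace ℝ (Fin d))}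
    (hπ : IsCoupling μ ν π) : cost π ≠ ∞ := by
  have := (h.integrable_cost hπ).2
  unfold cost
  simp only [HasFiniteIntegral, enorm_pow, enorm_norm] at this
  exact this.ne

lemma toReal_cost
    (π : Measure (EuclideanSpace ℝ (Fin d) × EuclideanSpace ℝ (Fin d))) :
    (cost π).toReal = ∫ z, ‖z.1 - z.2‖ ^ 2 ∂π := by
  rw [integral_eq_lintegral_of_nonneg_ae (ae_of_all _ fun _ => by positivity) (by fun_prop), cost]
  congr 2 with z
  rw [ENNReal.ofReal_pow (norm_nonneg _), ofReal_norm]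

/-! ### Duality -/

/-- The value of the dual functional at a potential on the sites. -/
lemma integrable_cTransform (h : IsSemidiscrete μ ν y) (g : Fin n → ℝ) :
    Integrable (cTransform y g) μ := by
  have := h.neZero
  exact integrable_comp_sub iInf_mono_pi iInf_add_const h.integrable_siteCost g

lemma integral_cTransform_add (h : IsSemidiscrete μ ν y)
    {π : Measure (EuclideanSpace ℝ (Fin d) × EuclideanSpace ℝ (Fin d))}
    (hπ : IsCoupling μ ν π) (g : Fin n → ℝ) :
    ∫ z, (cTransform y g z.1 + extendSites y g z.2) ∂π
      = ∑ i, ν.real {y i} * g i + ∫ x, cTransform y g x ∂μ := by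
  have h2 := h.integrable_right (extendSites y g)
  rw [integral_add (hπ.integrable_fst (h.integrable_cTransform g)) (hπ.integrable_snd h2),
    hπ.integral_fst (h.integrable_cTransform g), hπ.integral_snd h2, h.integral_eq, add_comm]
  simp [extendSites_apply h.injective]

lemma isDualFeasible_cTransform (h : IsSemidiscrete μ ν y) (g : Fin n → ℝ) :
    IsDualFeasible μ ν (cTransform y g) (extendSites y g) where
  integrable_left := h.integrable_cTransform g
  integrable_right := h.integrable_right _
  add_le := ae_of_all _ fun x => h.ae_iff.2 fun i => by
    rw [extendSites_apply h.injective]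
    linarith [cTransform_le y g x i]

/-- For fixed values of g at the sites, the c-transform is the largest feasible partner, so the dual
over pairs in L¹ reduces to finitely many variables. -/
lemma dual_le (h : IsSemidiscrete μ ν y) {f g : EuclideanSpace ℝ (Fin d) → ℝ}
    (hfg : IsDualFeasible μ ν f g) :
    ∫ x, f x ∂μ + ∫ z, g z ∂ν
      ≤ ∑ i, ν.real {y i} * g (y i) + ∫ x, cTransform y (g ∘ y) x ∂μ := by
  have := h.neZero
  rw [h.integral_eq g, add_comm]
  refine add_le_add le_rfl (integral_mono_ae hfg.integrable_left (h.integrable_cTransform _) ?_)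
  filter_upwards [hfg.add_le] with x hx
  refine le_ciInf fun i => ?_
  have := h.ae_iff.1 hx i
  simp only [Pi.sub_apply, siteCost, Function.comp]
  linarith

lemma dual_extend (h : IsSemidiscrete μ ν y) (g : Fin n → ℝ) :
    ∫ x, cTransform y g x ∂μ + ∫ z, extendSites y g z ∂ν
      = ∑ i, ν.real {y i} * g i + ∫ x, cTransform y g x ∂μ := by
  rw [h.integral_eq, add_comm]
  simp [extendSites_apply h.injective]

lemma exists_isOptimalPotential (h : IsSemidiscrete μ ν y) :
    ∃ f g, IsOptimalPotential μ ν f g := by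
  have := h.neZero
  obtain ⟨g, hg⟩ := exists_dual_maximizer (μ := μ) h.real_pos h.sum_real iInf_mono_pi
    iInf_add_const (fun b k => ciInf_le (Finite.bddBelow_range b) k) h.integrable_siteCost
  set s := ∑ i, ν.real {y i} * g i with hs
  set g0 : Fin n → ℝ := fun i => g i - s with hg0
  have hsum : ∑ i, ν.real {y i} * g0 i = 0 := by
    simp only [hg0, mul_sub, Finset.sum_sub_distrib, ← Finset.sum_mul, h.sum_real]
    rw [hs]; ring
  have hT : ∀ x, cTransform y g0 x = cTransform y g x + s := by
    intro x
    unfold cTransform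
    rw [← iInf_add_const]
    congr 1 with k
    simp only [hg0, Pi.sub_apply]; ring
  have hmax : ∀ g' : Fin n → ℝ, ∑ i, ν.real {y i} * g' i + ∫ x, cTransform y g' x ∂μ
      ≤ ∑ i, ν.real {y i} * g0 i + ∫ x, cTransform y g0 x ∂μ := by
    intro g'
    refine (hg g').trans (le_of_eq ?_)
    simp_rw [hsum, hT]
    rw [integral_add (h.integrable_cTransform g) (integrable_const _)]
    simp only [integral_const, probReal_univ, one_smul, zero_add]
    rw [add_comm]; rfl
  refine ⟨cTransform y g0, extendSites y g0, h.isDualFeasible_cTransform g0, ?_, ?_⟩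
  · intro f' g' hfg'
    refine (h.dual_le hfg').trans ((hmax (g' ∘ y)).trans (h.dual_extend g0).ge)
  · rw [h.integral_eq]
    simpa [extendSites_apply h.injective] using hsum

lemma isMax_of_isOptimalPotential (h : IsSemidiscrete μ ν y)
    {f g : EuclideanSpace ℝ (Fin d) → ℝ} (hfg : IsOptimalPotential μ ν f g) (g' : Fin n → ℝ) :
    ∑ i, ν.real {y i} * g' i + ∫ x, cTransform y g' x ∂μ
      ≤ ∑ i, ν.real {y i} * g (y i) + ∫ x, cTransform y (g ∘ y) x ∂μ := by
  rw [← h.dual_extend]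
  exact (hfg.optimal _ _ (h.isDualFeasible_cTransform g')).trans (h.dual_le hfg.feasible)

lemma powerCell_eq [NeZero n] (g : EuclideanSpace ℝ (Fin d) → ℝ) (i : Fin n) :
    powerCell y g i = {x | siteCost y x i - (g ∘ y) i ≤ ⨅ k, (siteCost y x - g ∘ y) k} := by
  ext x
  exact (le_ciInf_iff (Finite.bddBelow_range _)).symm

lemma le_measureReal_powerCell (h : IsSemidiscrete μ ν y)
    {f g : EuclideanSpace ℝ (Fin d) → ℝ} (hfg : IsOptimalPotential μ ν f g) (i : Fin n) :
    ν.real {y i} ≤ μ.real (powerCell y g i) := by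
  have := h.neZero
  rw [powerCell_eq]
  exact le_measureReal_cell_of_isMax (w := fun i => ν.real {y i}) h.integrable_siteCost
    (continuous_siteCost y).measurable (h.isMax_of_isOptimalPotential hfg) i

end IsSemidiscrete

/-! ### Null overlaps of the cells, masses of the cells and strong duality. -/

lemma measure_slack_eq_zero (hac : μ ≪ volume) (hy : Function.Injective y)
    (g : EuclideanSpace ℝ (Fin d) → ℝ) {i j : Fin n} (hij : i ≠ j) :
    μ {x | slack y g i j x = 0} = 0 := by
  refine hac ?_
  have hm : MeasurableSet {x | slack y g i j x = 0} :=
    (isClosed_eq (continuous_slack y g i j) continuous_const).measurableSet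
  have hw := two_smul_sub_ne_zero hy hij
  rw [← lintegral_indicator_one hm,
    lintegral_eq_lintegral_hyperplaneParam hw (slackConst y g i j) (measurable_one.indicator hm)]
  have : ∀ t : ℝ, t ≠ 0 → ∫⁻ z, {x | slack y g i j x = 0}.indicator (1 : EuclideanSpace ℝ (Fin d) → ℝ≥0∞)
      (hyperplaneParam ((2 : ℝ) • (y i - y j)) (slackConst y g i j) t z) = 0 := by
    intro t ht
    refine (lintegral_congr fun z => ?_).trans lintegral_zero
    refine indicator_of_notMem (fun hz => ht ?_) _
    rw [mem_ofPred_eq, slack_eq_inner, ← slackConst, inner_hyperplaneParam hw] at hz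
    exact hz
  rw [lintegral_eq_zero_of_ae_eq_zero, mul_zero]
  have h0 : ∀ᵐ t : ℝ, t ≠ 0 := by simp [ae_iff]
  filter_upwards [h0] with t ht using this t ht

lemma measure_powerCell_inter (hac : μ ≪ volume) (hy : Function.Injective y)
    (g : EuclideanSpace ℝ (Fin d) → ℝ) {i j : Fin n} (hij : i ≠ j) :
    μ (powerCell y g i ∩ powerCell y g j) = 0 := by
  refine measure_mono_null ?_ (measure_slack_eq_zero hac hy g hij)
  rw [← slice_zero_zero]
  exact fun x hx => hx.2

lemma iUnion_powerCell [NeZero n] (y : Fin n → EuclideanSpace ℝ (Fin d))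
    (g : EuclideanSpace ℝ (Fin d) → ℝ) : ⋃ i, powerCell y g i = univ := by
  refine eq_univ_of_forall fun x => ?_
  obtain ⟨i, hi⟩ := Finite.exists_min fun i => ‖x - y i‖ ^ 2 - g (y i)
  exact mem_iUnion.2 ⟨i, hi⟩

lemma aedisjoint_powerCell (hac : μ ≪ volume) (hy : Function.Injective y)
    (g : EuclideanSpace ℝ (Fin d) → ℝ) :
    Pairwise (Function.onFun (AEDisjoint μ) (powerCell y g)) :=
  fun _ _ hij => measure_powerCell_inter hac hy g hij

lemma sum_restrict_powerCell [NeZero n] (hac : μ ≪ volume) (hy : Function.Injective y)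
    (g : EuclideanSpace ℝ (Fin d) → ℝ) :
    ∑ i, μ.restrict (powerCell y g i) = μ := by
  rw [← Measure.sum_fintype, ← Measure.restrict_iUnion_ae (aedisjoint_powerCell hac hy g)
    fun i => (isClosed_powerCell y g i).measurableSet.nullMeasurableSet, iUnion_powerCell,
    Measure.restrict_univ]

namespace IsSemidiscrete

/-- The first-order condition gives one inequality per cell. As the cells cover the space with null
overlaps, both sides sum to 1, which forces equality. -/
lemma measureReal_powerCell (h : IsSemidiscrete μ ν y) (hac : μ ≪ volume)
    {f g : EuclideanSpace ℝ (Fin d) → ℝ} (hfg : IsOptimalPotential μ ν f g) (i : Fin n) :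
    μ.real (powerCell y g i) = ν.real {y i} := by
  have := h.neZero
  have h1 : ∑ i, ν.real {y i} = ∑ i, μ.real (powerCell y g i) := by
    rw [h.sum_real]
    have := congrArg (fun m => m.real univ) (sum_restrict_powerCell hac h.injective g)
    simp only [probReal_univ] at this
    rw [← this, Measure.real, Measure.finsetSum_apply, ENNReal.toReal_sum
      (fun _ _ => measure_ne_top _ _)]
    simp [Measure.real]
  exact ((Finset.sum_eq_sum_iff_of_le fun i _ => h.le_measureReal_powerCell hfg i).1 h1 i
    (Finset.mem_univ i)).symm

/-- Strong duality for the transport problem. -/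
lemma toReal_W2sq (h : IsSemidiscrete μ ν y) (hac : μ ≪ volume)
    {f g : EuclideanSpace ℝ (Fin d) → ℝ} (hfg : IsOptimalPotential μ ν f g) :
    (W2sq μ ν).toReal = ∑ i, ν.real {y i} * g (y i) + ∫ x, cTransform y (g ∘ y) x ∂μ := by
  have := h.neZero
  set Φ := ∑ i, ν.real {y i} * g (y i) + ∫ x, cTransform y (g ∘ y) x ∂μ with hΦ
  -- The plan sending each cell to its site. It is a coupling because the cells have the right
  -- masses, and it is optimal because the dual constraint is tight on its support.
  set π₀ : Measure (EuclideanSpace ℝ (Fin d) × EuclideanSpace ℝ (Fin d)) :=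
    ∑ i, (μ.restrict (powerCell y g i)).map fun x => (x, y i) with hπ₀
  have hΦ' : ∑ i, ν.real {y i} * (g ∘ y) i + ∫ x, cTransform y (g ∘ y) x ∂μ = Φ := rfl
  have hmi : ∀ i, Measurable fun x : EuclideanSpace ℝ (Fin d) => (x, y i) := fun i => by fun_prop
  have hc : IsCoupling μ ν π₀ := by
    constructor
    · rw [Measure.fst, hπ₀, Measure.map_finset_sum measurable_fst.aemeasurable]
      conv_rhs => rw [← sum_restrict_powerCell hac h.injective g]
      refine Finset.sum_congr rfl fun i _ => ?_
      rw [Measure.map_map measurable_fst (hmi i)]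
      exact Measure.map_id
    · rw [Measure.snd, hπ₀, Measure.map_finset_sum measurable_snd.aemeasurable]
      conv_rhs => rw [h.eq_sum_dirac]
      refine Finset.sum_congr rfl fun i _ => ?_
      rw [Measure.map_map measurable_snd (hmi i)]
      change Measure.map (fun _ => y i) _ = _
      rw [Measure.map_const, Measure.restrict_apply_univ]
      congr 1
      have := h.measureReal_powerCell hac hfg i
      exact (ENNReal.toReal_eq_toReal_iff' (measure_ne_top _ _) (measure_ne_top _ _)).1 this
  have hle : ∀ π, IsCoupling μ ν π → Φ ≤ (cost π).toReal := by
    intro π hπ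
    have := hπ.isProbabilityMeasure
    rw [toReal_cost, ← hΦ', ← h.integral_cTransform_add hπ (g ∘ y)]
    refine integral_mono_ae ((hπ.integrable_fst (h.integrable_cTransform _)).add
      (hπ.integrable_snd (h.integrable_right _))) (h.integrable_cost hπ) ?_
    filter_upwards [h.ae_snd hπ] with z hz
    obtain ⟨i, hi⟩ := hz
    simp only [hi]
    rw [extendSites_apply h.injective]
    linarith [cTransform_le y (g ∘ y) z.1 i]
  have heq : (cost π₀).toReal = Φ := by
    have := hc.isProbabilityMeasure
    rw [toReal_cost, ← hΦ', ← h.integral_cTransform_add hc (g ∘ y)]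
    refine integral_congr_ae ?_
    have : ∀ i, ∀ᵐ z ∂((μ.restrict (powerCell y g i)).map fun x => (x, y i)),
        ‖z.1 - z.2‖ ^ 2 = cTransform y (g ∘ y) z.1 + extendSites y (g ∘ y) z.2 := by
      intro i
      rw [ae_map_iff (hmi i).aemeasurable]
      · filter_upwards [ae_restrict_mem (isClosed_powerCell y g i).measurableSet] with x hx
        rw [extendSites_apply h.injective]
        have h1 := cTransform_le y (g ∘ y) x i
        rw [powerCell_eq] at hx
        have h2 : siteCost y x i - (g ∘ y) i ≤ cTransform y (g ∘ y) x := hx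
        simp only [siteCost] at h2
        linarith
      · refine measurableSet_eq_fun (by fun_prop) ?_
        exact ((measurable_cTransform y _).comp measurable_fst).add
          ((measurable_extendSites y _).comp measurable_snd)
    rw [hπ₀, ← Measure.sum_fintype, Filter.EventuallyEq, Measure.ae_sum_iff]
    exact this
  have hW : W2sq μ ν = cost π₀ := by
    refine le_antisymm (iInf₂_le π₀ hc) (le_iInf₂ fun π hπ => ?_)
    rw [← ENNReal.toReal_le_toReal (h.cost_ne_top hc) (h.cost_ne_top hπ), heq]
    exact hle π hπ
  rw [hW, heq]

end IsSemidiscrete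
end

/-! ### Gibbs plans and the entropic problem. -/

/-- The log-density of the Gibbs plan with respect to `μ ⊗ ν`. -/
def gibbsExponent (y : Fin n → EuclideanSpace ℝ (Fin d)) (w θ : Fin n → ℝ) (η : ℝ)
    (z : EuclideanSpace ℝ (Fin d) × EuclideanSpace ℝ (Fin d)) : ℝ :=
  extendSites y (fun i => θ i - Real.log (w i)) z.2 - η * ‖z.1 - z.2‖ ^ 2
    + softmin (η • siteCost y z.1 - θ)

/-- The Gibbs plan with potential `θ` on the sites. -/
def gibbsPlan (μ ν : Measure (EuclideanSpace ℝ (Fin d))) (y : Fin n → EuclideanSpace ℝ (Fin d))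
    (θ : Fin n → ℝ) (η : ℝ) : Measure (EuclideanSpace ℝ (Fin d) × EuclideanSpace ℝ (Fin d)) :=
  (μ.prod ν).withDensity fun z =>
    ENNReal.ofReal (Real.exp (gibbsExponent y (fun i => ν.real {y i}) θ η z))

lemma continuous_softmin [NeZero n] : Continuous (softmin (n := n)) := by
  unfold softmin
  refine (Continuous.log (by fun_prop) fun b => (sum_exp_pos (-b)).ne').neg

lemma measurable_gibbsExponent [NeZero n] (y : Fin n → EuclideanSpace ℝ (Fin d))
    (w θ : Fin n → ℝ) (η : ℝ) : Measurable (gibbsExponent y w θ η) := by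
  have h1 := (continuous_softmin (n := n)).measurable
  have h2 := (continuous_siteCost y).measurable
  have h3 := measurable_extendSites y (fun i => θ i - Real.log (w i))
  unfold gibbsExponent
  refine Measurable.add (Measurable.sub (h3.comp measurable_snd) (by fun_prop)) (h1.comp ?_)
  exact ((h2.comp measurable_fst).const_smul η).sub_const θ

/-- The shift by log w_i cancels the mass of the atom, so that the conditional law of the site given
x is exactly a softmax. -/
lemma exp_gibbsExponent [NeZero n] {y : Fin n → EuclideanSpace ℝ (Fin d)}
    (hy : Function.Injective y) {w : Fin n → ℝ} (θ : Fin n → ℝ) (η : ℝ)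
    (x : EuclideanSpace ℝ (Fin d)) {i : Fin n} (hw : 0 < w i) :
    w i * Real.exp (gibbsExponent y w θ η (x, y i)) = softmax (θ - η • siteCost y x) i := by
  rw [softmax_eq_exp, neg_sub]
  unfold gibbsExponent
  simp only []
  rw [extendSites_apply hy]
  conv_lhs => rw [← Real.exp_log hw, ← Real.exp_add, Real.log_exp]
  congr 1
  simp only [Pi.sub_apply, Pi.smul_apply, siteCost, smul_eq_mul]
  ring

namespace IsSemidiscrete
variable {μ ν : Measure (EuclideanSpace ℝ (Fin d))} [IsProbabilityMeasure μ]
  [IsProbabilityMeasure ν] {y : Fin n → EuclideanSpace ℝ (Fin d)}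

lemma integrable_smul_siteCost (h : IsSemidiscrete μ ν y) (η : ℝ) :
    Integrable (fun x => η • siteCost y x) μ := h.integrable_siteCost.smul η

lemma lintegral_gibbsPlan (h : IsSemidiscrete μ ν y) (θ : Fin n → ℝ) (η : ℝ)
    {F : EuclideanSpace ℝ (Fin d) × EuclideanSpace ℝ (Fin d) → ℝ≥0∞} (hF : Measurable F) :
    ∫⁻ z, F z ∂(gibbsPlan μ ν y θ η)
      = ∫⁻ x, ∑ i, ENNReal.ofReal (softmax (θ - η • siteCost y x) i) * F (x, y i) ∂μ := by
  have := h.neZero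
  have hm : Measurable fun z => ENNReal.ofReal
      (Real.exp (gibbsExponent y (fun i => ν.real {y i}) θ η z)) :=
    (measurable_gibbsExponent y _ θ η).exp.ennreal_ofReal
  unfold gibbsPlan
  rw [lintegral_withDensity_eq_lintegral_mul _ hm hF,
    lintegral_prod _ (hm.mul hF).aemeasurable]
  refine lintegral_congr fun x => ?_
  refine (h.lintegral_eq ((hm.mul hF).comp measurable_prodMk_left)).trans ?_
  refine Finset.sum_congr rfl fun i _ => ?_
  rw [← exp_gibbsExponent (w := fun i => ν.real {y i}) h.injective θ η x (h.real_pos i), Function.comp_apply, Pi.mul_apply,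
    ENNReal.ofReal_mul (h.real_pos i).le, ← mul_assoc, Measure.real,
    ENNReal.ofReal_toReal (measure_ne_top _ _)]

lemma sum_ofReal_softmax [NeZero n] (b : Fin n → ℝ) :
    ∑ i, ENNReal.ofReal (softmax b i) = 1 := by
  rw [← ENNReal.ofReal_sum_of_nonneg fun i _ => softmax_nonneg b i, sum_softmax, ENNReal.ofReal_one]

lemma measurable_softmax_siteCost [NeZero n] (y : Fin n → EuclideanSpace ℝ (Fin d))
    (θ : Fin n → ℝ) (η : ℝ) (i : Fin n) :
    Measurable fun x => softmax (θ - η • siteCost y x) i := by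
  refine ((continuous_softmax i).comp ?_).measurable
  exact continuous_const.sub ((continuous_siteCost y).const_smul η)

/-- The first marginal is automatic, because softmax weights sum to 1; the second is the condition
on θ. -/
lemma isCoupling_gibbsPlan (h : IsSemidiscrete μ ν y) {θ : Fin n → ℝ} {η : ℝ}
    (hθ : ∀ i, ∫ x, softmax (θ - η • siteCost y x) i ∂μ = ν.real {y i}) :
    IsCoupling μ ν (gibbsPlan μ ν y θ η) := by
  have := h.neZero
  constructor
  · ext A hA
    rw [Measure.fst_apply hA, ← lintegral_indicator_one (measurable_fst hA),
      h.lintegral_gibbsPlan θ η (measurable_one.indicator (measurable_fst hA)),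
      ← lintegral_indicator_one hA]
    refine lintegral_congr fun x => ?_
    have : ∀ i, (Prod.fst ⁻¹' A : Set (EuclideanSpace ℝ (Fin d) × _)).indicator
        (1 : _ × EuclideanSpace ℝ (Fin d) → ℝ≥0∞) (x, y i) = A.indicator 1 x := fun i => rfl
    simp_rw [this]
    rw [← Finset.sum_mul, sum_ofReal_softmax, one_mul]
  · ext A hA
    rw [Measure.snd_apply hA, ← lintegral_indicator_one (measurable_snd hA),
      h.lintegral_gibbsPlan θ η (measurable_one.indicator (measurable_snd hA)),
      ← lintegral_indicator_one hA, h.lintegral_eq (measurable_one.indicator hA)]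
    have : ∀ x i, (Prod.snd ⁻¹' A : Set (_ × EuclideanSpace ℝ (Fin d))).indicator
        (1 : EuclideanSpace ℝ (Fin d) × _ → ℝ≥0∞) (x, y i) = A.indicator 1 (y i) :=
      fun x i => rfl
    simp_rw [this]
    rw [lintegral_finsetSum _ fun i _ =>
      (measurable_softmax_siteCost y θ η i).ennreal_ofReal.mul_const _]
    refine Finset.sum_congr rfl fun i _ => ?_
    have hi : Integrable (fun x => softmax (θ - η • siteCost y x) i) μ :=
      integrable_softmax (aestronglyMeasurable_const.sub (h.integrable_smul_siteCost η).1) i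
    rw [lintegral_mul_const _ (measurable_softmax_siteCost y θ η i).ennreal_ofReal,
      ← ofReal_integral_eq_lintegral_ofReal hi (ae_of_all _ fun x => softmax_nonneg _ _), hθ i, Measure.real,
      ENNReal.ofReal_toReal (measure_ne_top _ _)]

lemma toReal_cost_gibbsPlan (h : IsSemidiscrete μ ν y) (θ : Fin n → ℝ) (η : ℝ) :
    (cost (gibbsPlan μ ν y θ η)).toReal
      = ∫ x, ∑ i, softmax (θ - η • siteCost y x) i * ‖x - y i‖ ^ 2 ∂μ := by
  have := h.neZero
  have hm : Measurable fun z : EuclideanSpace ℝ (Fin d) × EuclideanSpace ℝ (Fin d) =>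
    ‖z.1 - z.2‖ₑ ^ 2 := by fun_prop
  rw [cost, h.lintegral_gibbsPlan θ η hm, integral_eq_lintegral_of_nonneg_ae]
  · congr 1
    refine lintegral_congr fun x => ?_
    rw [ENNReal.ofReal_sum_of_nonneg fun i _ => mul_nonneg (softmax_nonneg _ _) (by positivity)]
    refine Finset.sum_congr rfl fun i _ => ?_
    rw [ENNReal.ofReal_mul (softmax_nonneg _ _), ENNReal.ofReal_pow (norm_nonneg _), ofReal_norm]
  · exact ae_of_all _ fun x => Finset.sum_nonneg fun i _ =>
      mul_nonneg (softmax_nonneg _ _) (by positivity)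
  · refine Measurable.aestronglyMeasurable (Finset.measurable_sum _ fun i _ => ?_)
    exact (measurable_softmax_siteCost y θ η i).mul (by fun_prop)

/-- Viewing the plan as an exponential tilt gives access to the log-likelihood ratios of tilted
measures. The normalizing constant is 1 because a coupling has total mass 1. -/
lemma gibbsPlan_eq_tilted (h : IsSemidiscrete μ ν y) {θ : Fin n → ℝ} {η : ℝ}
    (hθ : ∀ i, ∫ x, softmax (θ - η • siteCost y x) i ∂μ = ν.real {y i}) :
    Integrable (fun z => Real.exp (gibbsExponent y (fun i => ν.real {y i}) θ η z)) (μ.prod ν) ∧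
    ∫ z, Real.exp (gibbsExponent y (fun i => ν.real {y i}) θ η z) ∂(μ.prod ν) = 1 ∧
    gibbsPlan μ ν y θ η = (μ.prod ν).tilted (gibbsExponent y (fun i => ν.real {y i}) θ η) := by
  have := h.neZero
  have := (h.isCoupling_gibbsPlan hθ).isProbabilityMeasure
  have hm := (measurable_gibbsExponent y (fun i => ν.real {y i}) θ η).exp
  have h1 : ∫⁻ z, ENNReal.ofReal (Real.exp (gibbsExponent y (fun i => ν.real {y i}) θ η z))
      ∂(μ.prod ν) = 1 := by
    have := measure_univ (μ := gibbsPlan μ ν y θ η)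
    rwa [gibbsPlan, withDensity_apply _ MeasurableSet.univ, setLIntegral_univ] at this
  have h2 : ∫ z, Real.exp (gibbsExponent y (fun i => ν.real {y i}) θ η z) ∂(μ.prod ν) = 1 := by
    rw [integral_eq_lintegral_of_nonneg_ae (ae_of_all _ fun z => (Real.exp_pos _).le)
      hm.aestronglyMeasurable, h1, ENNReal.toReal_one]
  refine ⟨?_, h2, ?_⟩
  · by_contra hn
    rw [integral_undef hn] at h2
    exact zero_ne_one h2
  · rw [gibbsPlan, Measure.tilted, h2]
    simp only [div_one]

/-- The exponent splits into a function of x, a function of the site and -η times the cost, so over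
couplings its integral depends on π through the cost alone. -/
lemma integrable_gibbsExponent (h : IsSemidiscrete μ ν y) (w θ : Fin n → ℝ) (η : ℝ)
    {π : Measure (EuclideanSpace ℝ (Fin d) × EuclideanSpace ℝ (Fin d))}
    (hπ : IsCoupling μ ν π) :
    Integrable (gibbsExponent y w θ η) π ∧
    ∫ z, gibbsExponent y w θ η z ∂π = ∑ i, ν.real {y i} * (θ i - Real.log (w i))
      - η * (cost π).toReal + ∫ x, softmin (η • siteCost y x - θ) ∂μ := by
  have := h.neZero
  have i1 := h.integrable_right (extendSites y (fun i => θ i - Real.log (w i)))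
  have i2 := h.integrable_cost hπ
  have i3 : Integrable (fun x => softmin (η • siteCost y x - θ)) μ :=
    integrable_comp_sub softmin_mono softmin_add (h.integrable_smul_siteCost η) θ
  have j1 := hπ.integrable_snd i1
  have j3 := hπ.integrable_fst i3
  have j2 : Integrable (fun z => extendSites y (fun i => θ i - Real.log (w i)) z.2
    - η * ‖z.1 - z.2‖ ^ 2) π := j1.sub (i2.const_mul η)
  refine ⟨j2.add j3, ?_⟩
  unfold gibbsExponent
  rw [integral_add j2 j3, integral_sub j1 (i2.const_mul η),
    integral_const_mul, ← toReal_cost, hπ.integral_fst i3, hπ.integral_snd i1, h.integral_eq]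
  simp [extendSites_apply h.injective]

open InformationTheory in
/-- Gibbs variational identity. -/
lemma toReal_cost_add_klDiv (h : IsSemidiscrete μ ν y) {θ : Fin n → ℝ} {η : ℝ} (hη : 0 < η)
    (hθ : ∀ i, ∫ x, softmax (θ - η • siteCost y x) i ∂μ = ν.real {y i})
    {π : Measure (EuclideanSpace ℝ (Fin d) × EuclideanSpace ℝ (Fin d))}
    (hπ : IsCoupling μ ν π) (hfin : klDiv π (μ.prod ν) ≠ ∞) :
    klDiv π (gibbsPlan μ ν y θ η) ≠ ∞ ∧
    (cost π).toReal + 1 / η * (klDiv π (μ.prod ν)).toReal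
      = 1 / η * (∑ i, ν.real {y i} * (θ i - Real.log (ν.real {y i}))
          + ∫ x, softmin (η • siteCost y x - θ) ∂μ)
        + 1 / η * (klDiv π (gibbsPlan μ ν y θ η)).toReal := by
  have := hπ.isProbabilityMeasure
  have hG := (h.isCoupling_gibbsPlan hθ).isProbabilityMeasure
  obtain ⟨he, he1, ht⟩ := h.gibbsPlan_eq_tilted hθ
  obtain ⟨hac, hllr⟩ := klDiv_ne_top_iff.1 hfin
  obtain ⟨hi, hI⟩ := h.integrable_gibbsExponent (fun i => ν.real {y i}) θ η hπ
  have hac2 : π ≪ gibbsPlan μ ν y θ η := by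
    rw [ht]
    exact hac.trans (absolutelyContinuous_tilted he)
  have hllr2 : Integrable (llr π (gibbsPlan μ ν y θ η)) π := by
    rw [ht]
    exact integrable_llr_tilted_right hac hi hllr he
  refine ⟨klDiv_ne_top hac2 hllr2, ?_⟩
  rw [toReal_klDiv_of_measure_eq hac (by simp), toReal_klDiv_of_measure_eq hac2 (by simp)]
  conv_rhs => rw [ht, integral_llr_tilted_right hac hi he hllr, he1, Real.log_one, add_zero, hI]
  field_simp
  ring

open InformationTheory in
lemma klDiv_gibbsPlan_ne_top (h : IsSemidiscrete μ ν y) {θ : Fin n → ℝ} {η : ℝ}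
    (hθ : ∀ i, ∫ x, softmax (θ - η • siteCost y x) i ∂μ = ν.real {y i}) :
    klDiv (gibbsPlan μ ν y θ η) (μ.prod ν) ≠ ∞ := by
  have hc := h.isCoupling_gibbsPlan hθ
  have hG := hc.isProbabilityMeasure
  obtain ⟨he, he1, ht⟩ := h.gibbsPlan_eq_tilted hθ
  obtain ⟨hi, hI⟩ := h.integrable_gibbsExponent (fun i => ν.real {y i}) θ η hc
  have hac : gibbsPlan μ ν y θ η ≪ μ.prod ν := by
    rw [ht]; exact tilted_absolutelyContinuous _ _
  refine klDiv_ne_top hac (hi.congr ?_)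
  have := h.neZero
  have h1 := hac.ae_le (log_rnDeriv_tilted_left_self he)
  filter_upwards [h1] with z hz
  rw [llr, ht, hz, he1, Real.log_one, sub_zero]

open InformationTheory in
lemma entropicCost_ne_top (h : IsSemidiscrete μ ν y) (η : ℝ)
    {π : Measure (EuclideanSpace ℝ (Fin d) × EuclideanSpace ℝ (Fin d))}
    (hπ : IsCoupling μ ν π) (hfin : klDiv π (μ.prod ν) ≠ ∞) : entropicCost μ ν η π ≠ ∞ :=
  ENNReal.add_ne_top.2 ⟨h.cost_ne_top hπ, ENNReal.mul_ne_top ENNReal.ofReal_ne_top hfin⟩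

open InformationTheory in
lemma toReal_entropicCost (h : IsSemidiscrete μ ν y) {η : ℝ} (hη : 0 < η)
    {π : Measure (EuclideanSpace ℝ (Fin d) × EuclideanSpace ℝ (Fin d))}
    (hπ : IsCoupling μ ν π) (hfin : klDiv π (μ.prod ν) ≠ ∞) :
    (entropicCost μ ν η π).toReal
      = (cost π).toReal + 1 / η * (klDiv π (μ.prod ν)).toReal := by
  rw [entropicCost, ENNReal.toReal_add (h.cost_ne_top hπ)
    (ENNReal.mul_ne_top ENNReal.ofReal_ne_top hfin), ENNReal.toReal_mul,
    ENNReal.toReal_ofReal (by positivity)]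

-- By `toReal_cost_add_klDiv`, on couplings of finite divergence the objective is a constant plus
-- KL(π ‖ Gibbs plan)/η, and this divergence vanishes only at the Gibbs plan.
open InformationTheory in
lemma isEntropicOptimal_iff (h : IsSemidiscrete μ ν y) {θ : Fin n → ℝ} {η : ℝ} (hη : 0 < η)
    (hθ : ∀ i, ∫ x, softmax (θ - η • siteCost y x) i ∂μ = ν.real {y i})
    (π : Measure (EuclideanSpace ℝ (Fin d) × EuclideanSpace ℝ (Fin d))) :
    IsEntropicOptimal μ ν η π ↔ π = gibbsPlan μ ν y θ η := by
  have hc := h.isCoupling_gibbsPlan hθ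
  have hG := hc.isProbabilityMeasure
  have hfinG := h.klDiv_gibbsPlan_ne_top hθ
  have hGtop := h.entropicCost_ne_top η hc hfinG
  have hGid := (h.toReal_cost_add_klDiv hη hθ hc hfinG).2
  rw [klDiv_self, ENNReal.toReal_zero, mul_zero, add_zero] at hGid
  constructor
  · rintro ⟨hπ, hmin⟩
    have hπp := hπ.isProbabilityMeasure
    have hle := hmin _ hc
    have hfin : klDiv π (μ.prod ν) ≠ ∞ := by
      intro htop
      have : entropicCost μ ν η π = ∞ := by
        rw [entropicCost, htop, ENNReal.mul_top (by simpa using hη), add_top]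
      rw [this, top_le_iff] at hle
      exact hGtop hle
    obtain ⟨hne, hid⟩ := h.toReal_cost_add_klDiv hη hθ hπ hfin
    have hle' := ENNReal.toReal_mono hGtop hle
    rw [h.toReal_entropicCost hη hπ hfin, h.toReal_entropicCost hη hc hfinG, hid, hGid] at hle'
    have h0 : 0 < 1 / η := by positivity
    have h1 : (klDiv π (gibbsPlan μ ν y θ η)).toReal ≤ 0 := by
      by_contra! hcon
      have := mul_pos h0 hcon
      linarith
    have h2 : klDiv π (gibbsPlan μ ν y θ η) = 0 :=
      ((ENNReal.toReal_eq_zero_iff _).1 (le_antisymm h1 ENNReal.toReal_nonneg)).resolve_right hne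
    exact klDiv_eq_zero_iff.1 h2
  · rintro rfl
    refine ⟨hc, fun π hπ => ?_⟩
    by_cases hfin : klDiv π (μ.prod ν) = ∞
    · have : entropicCost μ ν η π = ∞ := by
        rw [entropicCost, hfin, ENNReal.mul_top (by simpa using hη), add_top]
      rw [this]; exact le_top
    · obtain ⟨hne, hid⟩ := h.toReal_cost_add_klDiv hη hθ hπ hfin
      rw [← ENNReal.toReal_le_toReal hGtop (h.entropicCost_ne_top η hπ hfin),
        h.toReal_entropicCost hη hπ hfin, h.toReal_entropicCost hη hc hfinG, hid, hGid]
      have : 0 ≤ 1 / η * (klDiv π (gibbsPlan μ ν y θ η)).toReal := by positivity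
      linarith

lemma exists_gibbs_potential (h : IsSemidiscrete μ ν y) (η : ℝ) :
    ∃ θ : Fin n → ℝ, ∀ i, ∫ x, softmax (θ - η • siteCost y x) i ∂μ = ν.real {y i} := by
  have := h.neZero
  exact exists_softmax_integral_eq h.real_pos h.sum_real (h.integrable_smul_siteCost η)

lemma existsUnique_isEntropicOptimal (h : IsSemidiscrete μ ν y) {η : ℝ} (hη : 0 < η) :
    ∃! π, IsEntropicOptimal μ ν η π := by
  obtain ⟨θ, hθ⟩ := h.exists_gibbs_potential η
  exact ⟨gibbsPlan μ ν y θ η, (h.isEntropicOptimal_iff hη hθ _).2 rfl,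
    fun π hπ => (h.isEntropicOptimal_iff hη hθ π).1 hπ⟩

/-- The suboptimality of the entropic plan is the mean excess of the reduced costs
`‖x - y_i‖² - g(y_i)` under softmax weights. -/
lemma exists_softmax_reducedCost (h : IsSemidiscrete μ ν y) (hac : μ ≪ volume) {η : ℝ} (hη : 0 < η)
    {f g : EuclideanSpace ℝ (Fin d) → ℝ} (hfg : IsOptimalPotential μ ν f g)
    {π : Measure (EuclideanSpace ℝ (Fin d) × EuclideanSpace ℝ (Fin d))}
    (hπ : IsEntropicOptimal μ ν η π) :
    ∃ θ : Fin n → ℝ,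
      (∀ i, ∫ x, softmax (θ - η • (siteCost y x - g ∘ y)) i ∂μ = ν.real {y i}) ∧
      (cost π).toReal - (W2sq μ ν).toReal
        = ∫ x, ∑ i, softmax (θ - η • (siteCost y x - g ∘ y)) i
            * (‖x - y i‖ ^ 2 - g (y i) - cTransform y (g ∘ y) x) ∂μ := by
  have := h.neZero
  obtain ⟨θ₀, hθ₀⟩ := h.exists_gibbs_potential η
  rw [h.isEntropicOptimal_iff hη hθ₀] at hπ
  have e : ∀ x, (θ₀ - η • (g ∘ y)) - η • (siteCost y x - g ∘ y) = θ₀ - η • siteCost y x := by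
    intro x; rw [smul_sub]; abel
  -- Recentring by -η g leaves the weights unchanged and replaces the costs by reduced costs. These
  -- are the potentials whose spread will be shown to stay bounded as η → ∞.
  refine ⟨θ₀ - η • (g ∘ y), fun i => by simp_rw [e]; exact hθ₀ i, ?_⟩
  simp_rw [e]
  rw [hπ, h.toReal_cost_gibbsPlan, h.toReal_W2sq hac hfg]
  have hp : ∀ i, Integrable (fun x => softmax (θ₀ - η • siteCost y x) i) μ := fun i =>
    integrable_softmax (aestronglyMeasurable_const.sub (h.integrable_smul_siteCost η).1) i
  have hc : ∀ i, Integrable (fun x => softmax (θ₀ - η • siteCost y x) i * ‖x - y i‖ ^ 2) μ := by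
    intro i
    refine (h.integrable_siteCost.eval i).mono' ?_ (ae_of_all _ fun x => ?_)
    · exact (hp i).1.mul (h.integrable_siteCost.eval i).1
    · rw [norm_mul, Real.norm_of_nonneg (softmax_nonneg _ _), Real.norm_of_nonneg (by positivity)]
      exact mul_le_of_le_one_left (by positivity) (softmax_le_one _ _)
  have e2 : ∀ x, ∑ i, softmax (θ₀ - η • siteCost y x) i
      * (‖x - y i‖ ^ 2 - g (y i) - cTransform y (g ∘ y) x)
      = ∑ i, softmax (θ₀ - η • siteCost y x) i * ‖x - y i‖ ^ 2
        - ∑ i, softmax (θ₀ - η • siteCost y x) i * g (y i) - cTransform y (g ∘ y) x := by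
    intro x
    simp only [mul_sub, Finset.sum_sub_distrib, ← Finset.sum_mul, sum_softmax, one_mul]
  simp_rw [e2]
  have i1 : Integrable (fun x => ∑ i, softmax (θ₀ - η • siteCost y x) i * ‖x - y i‖ ^ 2) μ :=
    integrable_finsetSum _ fun i _ => hc i
  have i2 : Integrable (fun x => ∑ i, softmax (θ₀ - η • siteCost y x) i * g (y i)) μ :=
    integrable_finsetSum _ fun i _ => (hp i).mul_const _
  have i3 : Integrable (fun x => ∑ i, softmax (θ₀ - η • siteCost y x) i * ‖x - y i‖ ^ 2
    - ∑ i, softmax (θ₀ - η • siteCost y x) i * g (y i)) μ := i1.sub i2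
  rw [integral_sub i3 (h.integrable_cTransform _), integral_sub i1 i2,
    integral_finsetSum _ fun i _ => (hp i).mul_const _]
  simp_rw [integral_mul_const, hθ₀]
  ring

end IsSemidiscrete

/-! ### Pointwise bounds on softmax weights -/

/-- Dropping every term but i and j from the partition sum leaves the two-point weight. -/
lemma softmax_le_logistic [NeZero n] (u : Fin n → ℝ) {i j : Fin n} (hij : i ≠ j) {δ s : ℝ}
    (h : u j - u i = δ - s) : softmax u j ≤ logistic δ s := by
  have h1 : Real.exp (u i) + Real.exp (u j) ≤ ∑ k, Real.exp (u k) := by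
    rw [← Finset.sum_pair (f := fun k => Real.exp (u k)) hij]
    exact Finset.sum_le_sum_of_subset_of_nonneg (Finset.subset_univ _)
      fun k _ _ => (Real.exp_pos _).le
  unfold softmax logistic
  rw [← h]
  have h2 : Real.exp (u j - u i) / (1 + Real.exp (u j - u i))
      = Real.exp (u j) / (Real.exp (u i) + Real.exp (u j)) := by
    rw [Real.exp_sub]
    have := Real.exp_pos (u i)
    field_simp
  rw [h2]
  exact div_le_div_of_nonneg_left (Real.exp_pos _).le (by positivity) h1

/-- Each of the at most n other terms is at most r e^{u_i}, so together they enlarge the two-point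
partition sum by a factor of at most 1 + n r. -/
lemma logistic_le_softmax [NeZero n] (u : Fin n → ℝ) {i j : Fin n} (hij : i ≠ j) {δ s r : ℝ}
    (h : u j - u i = δ - s) (hr : 0 ≤ r) (hk : ∀ k, k ≠ i → k ≠ j → Real.exp (u k - u i) ≤ r) :
    logistic δ s / (1 + n * r) ≤ softmax u j := by
  have h1 : ∑ k, Real.exp (u k) ≤ (1 + n * r) * (Real.exp (u i) + Real.exp (u j)) := by
    have h3 : ∑ k ∈ Finset.univ \ {i, j}, Real.exp (u k) ≤ n * (r * Real.exp (u i)) := by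
      refine (Finset.sum_le_card_nsmul _ _ (r * Real.exp (u i)) fun k hk' => ?_).trans ?_
      · simp only [Finset.mem_sdiff, Finset.mem_univ, Finset.mem_insert, Finset.mem_singleton,
          true_and, not_or] at hk'
        have := hk k hk'.1 hk'.2
        rwa [Real.exp_sub, div_le_iff₀ (Real.exp_pos _)] at this
      · rw [nsmul_eq_mul]
        refine mul_le_mul_of_nonneg_right ?_ (by positivity)
        exact_mod_cast (Finset.card_le_univ _).trans (by simp)
    rw [← Finset.sum_sdiff (Finset.subset_univ {i, j}), Finset.sum_pair hij]
    have : 0 ≤ n * r * Real.exp (u j) := by positivity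
    linarith
  have h2 : logistic δ s = Real.exp (u j) / (Real.exp (u i) + Real.exp (u j)) := by
    unfold logistic
    rw [← h, Real.exp_sub]
    have := Real.exp_pos (u i)
    field_simp
  unfold softmax
  rw [h2, div_div]
  refine div_le_div_of_nonneg_left (Real.exp_pos _).le (sum_exp_pos u) (h1.trans (le_of_eq ?_))
  ring

lemma softmax_le_exp_sub [NeZero n] (u : Fin n → ℝ) (i j : Fin n) :
    softmax u j ≤ Real.exp (u j - u i) := by
  unfold softmax
  rw [Real.exp_sub]
  exact div_le_div_of_nonneg_left (Real.exp_pos _).le (Real.exp_pos _)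
    (Finset.single_le_sum (f := fun k => Real.exp (u k)) (fun _ _ => (Real.exp_pos _).le)
      (Finset.mem_univ i))

/-- If all weights outside `A` are dominated, the total softmax weight of `A` is bounded below. -/
lemma half_exp_le_sum_softmax [NeZero n] (u : Fin n → ℝ) (A : Finset (Fin n)) {j : Fin n}
    (hj : j ∈ A) {t s : ℝ} (hs : 0 ≤ s) (hu : u j = t - s)
    (hk : ∀ k ∉ A, n * Real.exp (u k) ≤ Real.exp t) :
    Real.exp (-s) / 2 ≤ ∑ k ∈ A, softmax u k := by
  set a := ∑ k ∈ A, Real.exp (u k) with ha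
  set b := ∑ k ∈ Aᶜ, Real.exp (u k) with hb
  have hab : ∑ k, Real.exp (u k) = a + b := (Finset.sum_add_sum_compl A _).symm
  have ha1 : Real.exp t * Real.exp (-s) ≤ a := by
    rw [← Real.exp_add, ← sub_eq_add_neg, ← hu]
    exact Finset.single_le_sum (f := fun k => Real.exp (u k)) (fun _ _ => (Real.exp_pos _).le) hj
  have hb1 : b ≤ Real.exp t := by
    have hn : (0 : ℝ) < n := by exact_mod_cast Nat.pos_of_ne_zero (NeZero.ne n)
    have h1 : n * b ≤ n * Real.exp t := by
      rw [hb, Finset.mul_sum]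
      refine (Finset.sum_le_card_nsmul _ _ (Real.exp t) fun k hk' =>
        hk k (by simpa using hk')).trans ?_
      rw [nsmul_eq_mul]
      refine mul_le_mul_of_nonneg_right ?_ (Real.exp_pos _).le
      exact_mod_cast (Finset.card_le_univ _).trans (by simp)
    exact le_of_mul_le_mul_left h1 hn
  have hb0 : 0 ≤ b := Finset.sum_nonneg fun _ _ => (Real.exp_pos _).le
  have hs1 : Real.exp (-s) ≤ 1 := Real.exp_le_one_iff.2 (by linarith)
  have hs0 := Real.exp_pos (-s)
  have ht := Real.exp_pos t
  have ha0 : 0 < a := (mul_pos ht hs0).trans_le ha1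
  unfold softmax
  rw [← Finset.sum_div, hab, ← ha, div_le_div_iff₀ two_pos (by positivity)]
  -- With a and b the sums over A and its complement, e^{-s} b ≤ e^{t-s} ≤ a and e^{-s} a ≤ a, hence
  -- e^{-s}(a + b) ≤ 2a.
  nlinarith [mul_le_mul_of_nonneg_left hb1 hs0.le, mul_le_mul_of_nonneg_right hs1 ha0.le]

/-- A family of reals without large gaps has bounded spread. -/
lemma sub_le_of_no_gap {θ : Fin n → ℝ} {K : ℝ} (hK : 0 ≤ K)
    (h : ∀ A : Finset (Fin n), A.Nonempty → A ≠ Finset.univ →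
      ∃ j ∈ A, ∃ i ∉ A, θ j < θ i + K) (i j : Fin n) : θ j - θ i ≤ n * K := by
  classical
  have : Nonempty (Fin n) := ⟨i⟩
  obtain ⟨m, hm⟩ := Finite.exists_max θ
  -- Starting from a maximizer of θ, each lowering of the threshold by K admits at least one new
  -- index until none is left, so n steps reach every index.
  set B : ℕ → Finset (Fin n) := fun l => Finset.univ.filter fun k => θ m - l * K ≤ θ k with hB
  have hmem : ∀ l k, k ∈ B l ↔ θ m - l * K ≤ θ k := by intro l k; simp [hB]
  have hcard : ∀ l, B l = Finset.univ ∨ l + 1 ≤ (B l).card := by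
    intro l
    induction l with
    | zero =>
      right
      exact Finset.card_pos.2 ⟨m, by simp [hmem]⟩
    | succ l ih =>
      have hsub : B l ⊆ B (l + 1) := by
        intro k hk
        rw [hmem] at hk ⊢
        push_cast
        nlinarith
      rcases ih with ih | ih
      · left
        rw [ih] at hsub
        exact Finset.univ_subset_iff.1 hsub
      · by_cases hu : B l = Finset.univ
        · left
          rw [hu] at hsub
          exact Finset.univ_subset_iff.1 hsub
        · right
          obtain ⟨j', hj', i', hi', hlt⟩ := h (B l) (Finset.card_pos.1 (by omega)) hu
          rw [hmem] at hj'
          have hi2 : i' ∈ B (l + 1) := by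
            rw [hmem]; push_cast; linarith
          have : B l ⊂ B (l + 1) := Finset.ssubset_iff_subset_ne.2
            ⟨hsub, fun e => hi' (e ▸ hi2)⟩
          have := Finset.card_lt_card this
          omega
  have hBn : B n = Finset.univ := by
    rcases hcard n with h | h
    · exact h
    · have := Finset.card_le_univ (B n)
      simp only [Fintype.card_fin] at this
      omega
  have := (hmem n i).1 (hBn ▸ Finset.mem_univ i)
  have := hm j
  linarith

/-! ### Asymptotics of softmax weights along cells -/

/-- A partition of a probability space into cells on which the coordinates of `b` are minimal, such
that the excesses `b_j - b_i` have Laplace asymptotics on the cell `S i`, and on the part `T i j a`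
of that cell where all other excesses are at least `a`. -/
structure IsLaplacePartition {X : Type*} [MeasurableSpace X] (μ : Measure X) (b : X → Fin n → ℝ)
    (S : Fin n → Set X) (T : Fin n → Fin n → ℝ → Set X) (c : Fin n → Fin n → ℝ)
    (ca : Fin n → Fin n → ℝ → ℝ) : Prop where
  measurable : Measurable b
  measurableSet : ∀ i, MeasurableSet (S i)
  nonneg : ∀ i j, ∀ x ∈ S i, 0 ≤ b x j - b x i
  sum_restrict : ∑ i, μ.restrict (S i) = μ
  measurableSet_inner : ∀ i j a, MeasurableSet (T i j a)
  inner_subset : ∀ i j a, T i j a ⊆ S i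
  inner_le : ∀ i j a, ∀ x ∈ T i j a, ∀ k, k ≠ i → k ≠ j → a ≤ b x k - b x i
  const_nonneg : ∀ i j, 0 ≤ c i j
  const_symm : ∀ i j, c i j = c j i
  const_self : ∀ i, c i i = 0
  laplace : ∀ i j, i ≠ j → HasLaplaceLimit ((μ.restrict (S i)).map fun x => b x j - b x i) (c i j)
  laplace_inner : ∀ i j, i ≠ j → ∃ a₀ > 0, ∀ a, 0 < a → a ≤ a₀ →
    HasLaplaceLimit ((μ.restrict (T i j a)).map fun x => b x j - b x i) (ca i j a)
  tendsto_const : ∀ i j, i ≠ j → Tendsto (ca i j) (𝓝[>] 0) (𝓝 (c i j))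
  connected : ∀ A : Finset (Fin n), A.Nonempty → A ≠ Finset.univ → ∃ i ∉ A, ∃ j ∈ A, 0 < c i j

namespace IsLaplacePartition

variable {X : Type*} [MeasurableSpace X] {μ : Measure X} [IsProbabilityMeasure μ]
  {b : X → Fin n → ℝ} {S : Fin n → Set X} {T : Fin n → Fin n → ℝ → Set X} {c : Fin n → Fin n → ℝ}
  {ca : Fin n → Fin n → ℝ → ℝ}

lemma measurable_excess (h : IsLaplacePartition μ b S T c ca) (i j : Fin n) :
    Measurable fun x => b x j - b x i :=
  ((measurable_pi_apply j).comp h.measurable).sub ((measurable_pi_apply i).comp h.measurable)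

lemma tendsto_of_hasLaplaceLimit {ψ : X → ℝ} (hψ : Measurable ψ) {R : Set X} {c₀ : ℝ}
    (hL : HasLaplaceLimit ((μ.restrict R).map ψ) c₀) {φ : ℝ → ℝ → ℝ} {C : ℝ}
    (hφ : ∀ η, Measurable (φ η))
    (hb : ∀ᶠ η in atTop, ∀ s, 0 ≤ s → |φ η s| ≤ C * Real.exp (-(1 / 2) * s)) :
    Tendsto (fun η => η * ∫ x in R, φ η (η * ψ x) ∂μ - c₀ * ∫ s in Ioi (0 : ℝ), φ η s)
      atTop (𝓝 0) := by
  refine (hL φ C hφ hb).congr fun η => ?_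
  rw [integral_map hψ.aemeasurable]
  exact ((hφ η).comp (measurable_const_mul η)).aestronglyMeasurable

lemma integrableOn_of_bound {ψ : X → ℝ} (hψ : Measurable ψ) {R : Set X} (hR : MeasurableSet R)
    (hpos : ∀ x ∈ R, 0 ≤ ψ x) {φ : ℝ → ℝ} {C η : ℝ} (hη : 0 ≤ η) (hφ : Measurable φ)
    (hb : ∀ s, 0 ≤ s → |φ s| ≤ C * Real.exp (-(1 / 2) * s)) :
    IntegrableOn (fun x => φ (η * ψ x)) R μ := by
  have hC : 0 ≤ C := by simpa using (abs_nonneg _).trans (hb 0 le_rfl)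
  refine Integrable.mono' (integrable_const C)
    (hφ.comp (hψ.const_mul η)).aestronglyMeasurable ?_
  filter_upwards [ae_restrict_mem hR] with x hx
  have h0 : 0 ≤ η * ψ x := mul_nonneg hη (hpos x hx)
  refine (hb _ h0).trans (mul_le_of_le_one_right hC (Real.exp_le_one_iff.2 ?_))
  linarith

lemma abs_exp_neg_le {s : ℝ} (hs : 0 ≤ s) :
    |Real.exp (-s)| ≤ 1 * Real.exp (-(1 / 2) * s) := by
  rw [abs_of_pos (Real.exp_pos _), one_mul]
  exact Real.exp_le_exp.2 (by linarith)

lemma tendsto_integral_exp (h : IsLaplacePartition μ b S T c ca) {i j : Fin n} (hij : i ≠ j) :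
    Tendsto (fun η => η * ∫ x in S i, Real.exp (-(η * (b x j - b x i))) ∂μ) atTop
      (𝓝 (c i j)) := by
  have h1 := tendsto_of_hasLaplaceLimit (h.measurable_excess i j) (h.laplace i j hij)
    (φ := fun _ s => Real.exp (-s)) (C := 1) (fun _ => by fun_prop)
    (Eventually.of_forall fun η s hs => abs_exp_neg_le hs)
  simp only [integral_exp_neg_Ioi_zero, mul_one] at h1
  simpa using h1.add_const (c i j)

/-- The `μ`-mass moved from the cell `S i` to the index `j`. -/
def flux (μ : Measure X) (b : X → Fin n → ℝ) (S : Fin n → Set X) (θ : Fin n → ℝ) (η : ℝ)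
    (i j : Fin n) : ℝ := ∫ x in S i, softmax (θ - η • b x) j ∂μ

lemma integrable_weight [NeZero n] (h : IsLaplacePartition μ b S T c ca) (θ : Fin n → ℝ) (η : ℝ)
    (j : Fin n) : Integrable (fun x => softmax (θ - η • b x) j) μ :=
  integrable_softmax (aestronglyMeasurable_const.sub
    (h.measurable.const_smul η).aestronglyMeasurable) j

lemma integral_eq_sum_cells (h : IsLaplacePartition μ b S T c ca) {F : X → ℝ}
    (hF : Integrable F μ) : ∫ x, F x ∂μ = ∑ i, ∫ x in S i, F x ∂μ := by
  conv_lhs => rw [← h.sum_restrict]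
  exact integral_finsetSum_measure fun i _ => hF.restrict

/-- The total outflow of a cell, including what stays, is its mass because the weights sum to 1; the
total inflow is the same number by the marginal condition. -/
lemma flux_balance [NeZero n] (h : IsLaplacePartition μ b S T c ca) {θ : Fin n → ℝ} {η : ℝ}
    (hθ : ∀ j, ∫ x, softmax (θ - η • b x) j ∂μ = μ.real (S j)) (j : Fin n) :
    ∑ i, flux μ b S θ η i j = ∑ i, flux μ b S θ η j i := by
  have h1 := h.integral_eq_sum_cells (h.integrable_weight θ η j)
  have h2 : ∑ i, flux μ b S θ η j i = μ.real (S j) := by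
    unfold flux
    rw [← integral_finsetSum _ fun i _ => (h.integrable_weight θ η i).restrict]
    simp [sum_softmax]
  rw [h2, ← hθ j, h1]
  rfl

lemma flux_balance_set [NeZero n] (h : IsLaplacePartition μ b S T c ca) {θ : Fin n → ℝ} {η : ℝ}
    (hθ : ∀ j, ∫ x, softmax (θ - η • b x) j ∂μ = μ.real (S j)) (A : Finset (Fin n)) :
    ∑ j ∈ A, ∑ i ∈ Aᶜ, flux μ b S θ η i j = ∑ j ∈ A, ∑ i ∈ Aᶜ, flux μ b S θ η j i := by
  have h1 : ∑ j ∈ A, ∑ i, flux μ b S θ η i j = ∑ j ∈ A, ∑ i, flux μ b S θ η j i :=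
    Finset.sum_congr rfl fun j _ => h.flux_balance hθ j
  simp only [← Finset.sum_add_sum_compl A (fun i => flux μ b S θ η _ i),
    ← Finset.sum_add_sum_compl A (fun i => flux μ b S θ η i _), Finset.sum_add_distrib] at h1
  have h2 : ∑ j ∈ A, ∑ i ∈ A, flux μ b S θ η i j = ∑ j ∈ A, ∑ i ∈ A, flux μ b S θ η j i :=
    Finset.sum_comm
  linarith

lemma flux_nonneg (θ : Fin n → ℝ) (η : ℝ) (i j : Fin n) : 0 ≤ flux μ b S θ η i j :=
  integral_nonneg fun _ => softmax_nonneg _ _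

lemma integrableOn_exp (h : IsLaplacePartition μ b S T c ca) {η : ℝ} (hη : 0 ≤ η) (i j : Fin n) :
    IntegrableOn (fun x => Real.exp (-(η * (b x j - b x i)))) (S i) μ :=
  integrableOn_of_bound (h.measurable_excess i j) (h.measurableSet i) (fun x hx => h.nonneg i j x hx)
    hη (φ := fun s => Real.exp (-s)) (C := 1) (by fun_prop) fun s hs => abs_exp_neg_le hs

lemma flux_le [NeZero n] (h : IsLaplacePartition μ b S T c ca) {θ : Fin n → ℝ} {η K : ℝ}
    (hη : 0 ≤ η) {i j : Fin n} (hK : θ j + K ≤ θ i) :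
    flux μ b S θ η i j ≤ Real.exp (-K) * ∫ x in S i, Real.exp (-(η * (b x j - b x i))) ∂μ := by
  rw [← integral_const_mul]
  refine integral_mono (h.integrable_weight θ η j).restrict ((h.integrableOn_exp hη i j).const_mul _)
    fun x => ?_
  refine (softmax_le_exp_sub _ i j).trans ?_
  rw [← Real.exp_add]
  refine Real.exp_le_exp.2 ?_
  simp only [Pi.sub_apply, Pi.smul_apply, smul_eq_mul]
  linarith

/-- On S_i the weights outside A are dominated: for k ∉ A the gap K absorbs both the factor n and
θ_k, while b_k ≥ b_i. Then `half_exp_le_sum_softmax` applies. -/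
lemma le_sum_flux [NeZero n] (h : IsLaplacePartition μ b S T c ca) {θ : Fin n → ℝ} {η K : ℝ}
    (hη : 0 ≤ η) {A : Finset (Fin n)} {i j : Fin n} (hj : j ∈ A)
    (hnK : (n : ℝ) ≤ Real.exp K) (hK : ∀ k ∉ A, θ k + K ≤ θ j) :
    (∫ x in S i, Real.exp (-(η * (b x j - b x i))) ∂μ) / 2 ≤ ∑ k ∈ A, flux μ b S θ η i k := by
  unfold flux
  rw [← integral_finsetSum _ fun k _ => (h.integrable_weight θ η k).restrict, ← integral_div]
  refine integral_mono_ae ((h.integrableOn_exp hη i j).div_const _)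
    (integrable_finsetSum _ fun k _ => (h.integrable_weight θ η k).restrict) ?_
  filter_upwards [ae_restrict_mem (h.measurableSet i)] with x hx
  refine half_exp_le_sum_softmax (t := θ j - η * b x i) _ A hj
    (mul_nonneg hη (h.nonneg i j x hx)) ?_ fun k hk => ?_
  · simp only [Pi.sub_apply, Pi.smul_apply, smul_eq_mul]; ring
  · refine (mul_le_mul_of_nonneg_right hnK (Real.exp_pos _).le).trans ?_
    rw [← Real.exp_add]
    refine Real.exp_le_exp.2 ?_
    have h1 := hK k hk
    have h2 := mul_nonneg hη (h.nonneg i k x hx)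
    simp only [Pi.sub_apply, Pi.smul_apply, smul_eq_mul]
    linarith

/-- A fixed set of indices cannot dominate the others by a large gap as `η → ∞`. -/
lemma exists_no_gap [NeZero n] (h : IsLaplacePartition μ b S T c ca) {θ : ℝ → Fin n → ℝ}
    (hθ : ∀ᶠ η in atTop, ∀ j, ∫ x, softmax (θ η - η • b x) j ∂μ = μ.real (S j))
    (A : Finset (Fin n)) :
    ∃ K : ℝ, 0 ≤ K ∧ (A.Nonempty → A ≠ Finset.univ → ∀ᶠ η in atTop,
      ∃ j ∈ A, ∃ i ∉ A, θ η j < θ η i + K) := by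
  by_cases hA : A.Nonempty ∧ A ≠ Finset.univ
  swap
  · exact ⟨0, le_rfl, fun h1 h2 => absurd ⟨h1, h2⟩ hA⟩
  obtain ⟨i₀, hi₀, j₀, hj₀, hc⟩ := h.connected A hA.1 hA.2
  set E : Fin n → Fin n → ℝ → ℝ := fun i j η =>
    η * ∫ x in S i, Real.exp (-(η * (b x j - b x i))) ∂μ with hE
  set Ct := ∑ j ∈ A, ∑ i ∈ Aᶜ, c j i with hCt
  -- If every potential in A exceeded every one outside by K, the flux into A would be at least
  -- about c_{i₀j₀}/(2η) and the flux out at most about e^{-K} Ct/η. This K makes the two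
  -- incompatible with flux balance.
  obtain ⟨K, hK0, hKn, hKC⟩ : ∃ K : ℝ, 0 ≤ K ∧ (n : ℝ) ≤ Real.exp K ∧
      Real.exp (-K) * Ct < c i₀ j₀ / 2 := by
    have h1 : Tendsto (fun K : ℝ => Real.exp (-K) * Ct) atTop (𝓝 (0 * Ct)) :=
      (Real.tendsto_exp_neg_atTop_nhds_zero).mul_const _
    rw [zero_mul] at h1
    exact ((eventually_ge_atTop 0).and ((Real.tendsto_exp_atTop.eventually_ge_atTop (n : ℝ)).and
      (h1.eventually (gt_mem_nhds (half_pos hc))))).exists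
  refine ⟨K, hK0, fun _ _ => ?_⟩
  have hij₀ : i₀ ≠ j₀ := fun e => hi₀ (e ▸ hj₀)
  have t1 : Tendsto (fun η => Real.exp (-K) * ∑ j ∈ A, ∑ i ∈ Aᶜ, E j i η) atTop
      (𝓝 (Real.exp (-K) * Ct)) := by
    refine Tendsto.const_mul _ (tendsto_finsetSum _ fun j hj => tendsto_finsetSum _ fun i hi => ?_)
    exact h.tendsto_integral_exp fun e => (Finset.mem_compl.1 hi) (e ▸ hj)
  have t2 : Tendsto (fun η => E i₀ j₀ η / 2) atTop (𝓝 (c i₀ j₀ / 2)) :=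
    (h.tendsto_integral_exp hij₀).div_const 2
  filter_upwards [t1.eventually_lt t2 hKC, hθ, eventually_gt_atTop 0] with η hlt hη hη0
  by_contra! hcon
  have hb := h.flux_balance_set hη A
  have l1 : (∫ x in S i₀, Real.exp (-(η * (b x j₀ - b x i₀))) ∂μ) / 2
      ≤ ∑ j ∈ A, ∑ i ∈ Aᶜ, flux μ b S (θ η) η i j := by
    refine (h.le_sum_flux hη0.le hj₀ hKn fun k hk => hcon j₀ hj₀ k hk).trans ?_
    refine Finset.sum_le_sum fun j _ => ?_
    exact Finset.single_le_sum (f := fun i => flux μ b S (θ η) η i j)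
      (fun i _ => flux_nonneg _ _ _ _) (Finset.mem_compl.2 hi₀)
  have l2 : ∑ j ∈ A, ∑ i ∈ Aᶜ, flux μ b S (θ η) η j i
      ≤ ∑ j ∈ A, ∑ i ∈ Aᶜ, Real.exp (-K) *
        ∫ x in S j, Real.exp (-(η * (b x i - b x j))) ∂μ :=
    Finset.sum_le_sum fun j hj => Finset.sum_le_sum fun i hi =>
      h.flux_le hη0.le (hcon j hj i (Finset.mem_compl.1 hi))
  have l3 : η * ∑ j ∈ A, ∑ i ∈ Aᶜ, Real.exp (-K) *
      ∫ x in S j, Real.exp (-(η * (b x i - b x j))) ∂μ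
      = Real.exp (-K) * ∑ j ∈ A, ∑ i ∈ Aᶜ, E j i η := by
    simp only [hE, Finset.mul_sum]
    refine Finset.sum_congr rfl fun j _ => Finset.sum_congr rfl fun i _ => by ring
  have l4 : E i₀ j₀ η / 2
      = η * ((∫ x in S i₀, Real.exp (-(η * (b x j₀ - b x i₀))) ∂μ) / 2) := by
    simp only [hE]; ring
  rw [← l3, l4] at hlt
  have := lt_of_mul_lt_mul_left hlt hη0.le
  linarith

lemma exists_bound [NeZero n] (h : IsLaplacePartition μ b S T c ca) {θ : ℝ → Fin n → ℝ}
    (hθ : ∀ᶠ η in atTop, ∀ j, ∫ x, softmax (θ η - η • b x) j ∂μ = μ.real (S j)) :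
    ∃ K : ℝ, ∀ᶠ η in atTop, ∀ i j, θ η j - θ η i ≤ K := by
  choose K hK0 hK using h.exists_no_gap hθ
  have hle : ∀ A, K A ≤ ∑ A, K A := fun A =>
    Finset.single_le_sum (fun A _ => hK0 A) (Finset.mem_univ A)
  -- The sum over all cuts is a single gap constant valid for each of them; the factor n comes from
  -- `sub_le_of_no_gap`.
  refine ⟨n * ∑ A, K A, ?_⟩
  have : ∀ᶠ η in atTop, ∀ A : Finset (Fin n), A.Nonempty → A ≠ Finset.univ →
      ∃ j ∈ A, ∃ i ∉ A, θ η j < θ η i + K A := by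
    rw [eventually_all]
    intro A
    by_cases h1 : A.Nonempty
    · by_cases h2 : A = Finset.univ
      · exact Eventually.of_forall fun _ _ h => absurd h2 h
      · filter_upwards [hK A h1 h2] with η hη _ _ using hη
    · exact Eventually.of_forall fun _ h => absurd h h1
  filter_upwards [this] with η hη i j
  refine sub_le_of_no_gap (Finset.sum_nonneg fun A _ => hK0 A) (fun A h1 h2 => ?_) i j
  obtain ⟨j', hj', i', hi', hlt⟩ := hη A h1 h2
  exact ⟨j', hj', i', hi', hlt.trans_le (by linarith [hle A])⟩

end IsLaplacePartition

/-! ### Limits of fluxes and of excess costs. -/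

namespace IsLaplacePartition

variable {X : Type*} [MeasurableSpace X] {μ : Measure X} [IsProbabilityMeasure μ]
  {b : X → Fin n → ℝ} {S : Fin n → Set X} {T : Fin n → Fin n → ℝ → Set X} {c : Fin n → Fin n → ℝ}
  {ca : Fin n → Fin n → ℝ → ℝ}

lemma integral_exp_half : ∫ s in Ioi (0 : ℝ), Real.exp (-(1 / 2) * s) = 2 := by
  rw [integral_exp_mul_Ioi (by norm_num)]
  norm_num

lemma abs_mul_logistic_le {v : ℝ → ℝ} {C₀ K δ s : ℝ} (hv0 : ∀ s, 0 ≤ s → 0 ≤ v s)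
    (hv : ∀ s, 0 ≤ s → v s * Real.exp (-s) ≤ C₀ * Real.exp (-(1 / 2) * s)) (hδ : δ ≤ K)
    (hs : 0 ≤ s) : |v s * logistic δ s| ≤ Real.exp K * C₀ * Real.exp (-(1 / 2) * s) := by
  rw [abs_of_nonneg (mul_nonneg (hv0 s hs) (logistic_nonneg _ _))]
  calc v s * logistic δ s ≤ v s * (Real.exp δ * Real.exp (-s)) :=
        mul_le_mul_of_nonneg_left (logistic_le δ s) (hv0 s hs)
    _ = Real.exp δ * (v s * Real.exp (-s)) := by ring
    _ ≤ Real.exp K * (C₀ * Real.exp (-(1 / 2) * s)) :=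
        mul_le_mul (Real.exp_le_exp.2 hδ) (hv s hs) (mul_nonneg (hv0 s hs) (Real.exp_pos _).le)
          (Real.exp_pos _).le
    _ = _ := by ring

/-- Asymptotics of a weighted flux between two cells: only the two-point interaction matters. -/
lemma tendsto_weighted_flux [NeZero n] (h : IsLaplacePartition μ b S T c ca) {θ : ℝ → Fin n → ℝ}
    {K : ℝ} (hK : ∀ᶠ η in atTop, ∀ i j, θ η j - θ η i ≤ K) {i j : Fin n} (hij : i ≠ j)
    {v : ℝ → ℝ} (hvm : Measurable v) {C₀ : ℝ} (hv0 : ∀ s, 0 ≤ s → 0 ≤ v s)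
    (hv : ∀ s, 0 ≤ s → v s * Real.exp (-s) ≤ C₀ * Real.exp (-(1 / 2) * s)) :
    Tendsto (fun η => η * ∫ x in S i, v (η * (b x j - b x i)) * softmax (θ η - η • b x) j ∂μ
      - c i j * ∫ s in Ioi (0 : ℝ), v s * logistic (θ η j - θ η i) s) atTop (𝓝 0) := by
  have hφm : ∀ η, Measurable fun s => v s * logistic (θ η j - θ η i) s := fun η =>
    hvm.mul (measurable_logistic _)
  have hφb : ∀ᶠ η in atTop, ∀ s, 0 ≤ s → |v s * logistic (θ η j - θ η i) s|
      ≤ Real.exp K * C₀ * Real.exp (-(1 / 2) * s) := by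
    filter_upwards [hK] with η hη s hs using abs_mul_logistic_le hv0 hv (hη i j) hs
  set I : ℝ → ℝ := fun η => ∫ s in Ioi (0 : ℝ), v s * logistic (θ η j - θ η i) s with hI
  set Y : ℝ → ℝ := fun η =>
    η * ∫ x in S i, v (η * (b x j - b x i)) * softmax (θ η - η • b x) j ∂μ with hY
  -- U bounds the flux from above by the two-point weight on all of S_i. L integrates the same
  -- weight over the part of S_i where third slacks are at least a, and bounds the flux from below
  -- up to a factor tending to 1.
  set U : ℝ → ℝ := fun η =>
    η * ∫ x in S i, v (η * (b x j - b x i)) * logistic (θ η j - θ η i) (η * (b x j - b x i)) ∂μ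
    with hU
  set L : ℝ → ℝ → ℝ := fun a η => η * ∫ x in T i j a,
    v (η * (b x j - b x i)) * logistic (θ η j - θ η i) (η * (b x j - b x i)) ∂μ with hL
  set B : ℝ := Real.exp K * C₀ * 2 with hB
  have hIB : ∀ᶠ η in atTop, 0 ≤ I η ∧ I η ≤ B := by
    filter_upwards [hφb] with η hη
    refine ⟨setIntegral_nonneg measurableSet_Ioi fun s hs =>
      mul_nonneg (hv0 s (le_of_lt hs)) (logistic_nonneg _ _), ?_⟩
    rw [hB, ← integral_exp_half, ← integral_const_mul]
    refine (le_abs_self _).trans ?_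
    rw [← Real.norm_eq_abs]
    refine norm_integral_le_of_norm_le (integrableOn_exp_half.const_mul _) ?_
    filter_upwards [ae_restrict_mem measurableSet_Ioi] with s hs using hη s (le_of_lt hs)
  have hUt : Tendsto (fun η => U η - c i j * I η) atTop (𝓝 0) :=
    tendsto_of_hasLaplaceLimit (h.measurable_excess i j) (h.laplace i j hij) hφm hφb
  obtain ⟨a₀, ha₀, hLap⟩ := h.laplace_inner i j hij
  have hLt : ∀ a, 0 < a → a ≤ a₀ → Tendsto (fun η => L a η - ca i j a * I η) atTop (𝓝 0) :=
    fun a h1 h2 => tendsto_of_hasLaplaceLimit (h.measurable_excess i j) (hLap a h1 h2) hφm hφb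
  have hφint : ∀ᶠ η in atTop, IntegrableOn (fun x => v (η * (b x j - b x i))
      * logistic (θ η j - θ η i) (η * (b x j - b x i))) (S i) μ := by
    filter_upwards [hφb, eventually_ge_atTop 0] with η hη hη0
    exact integrableOn_of_bound (φ := fun s => v s * logistic (θ η j - θ η i) s)
      (h.measurable_excess i j) (h.measurableSet i) (fun x hx => h.nonneg i j x hx) hη0 (hφm η) hη
  have hle : ∀ η, 0 ≤ η → ∀ x ∈ S i, softmax (θ η - η • b x) j
      ≤ logistic (θ η j - θ η i) (η * (b x j - b x i)) := by
    intro η hη x hx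
    refine softmax_le_logistic _ hij ?_
    simp only [Pi.sub_apply, Pi.smul_apply, smul_eq_mul]; ring
  have hmw : ∀ η, Measurable fun x => v (η * (b x j - b x i)) * softmax (θ η - η • b x) j := by
    intro η
    refine (hvm.comp ((h.measurable_excess i j).const_mul η)).mul ?_
    exact (continuous_softmax j).measurable.comp
      (measurable_const.sub (h.measurable.const_smul η))
  have hwint : ∀ᶠ η in atTop, IntegrableOn (fun x => v (η * (b x j - b x i))
      * softmax (θ η - η • b x) j) (S i) μ := by
    filter_upwards [hφint, eventually_ge_atTop 0] with η hη hη0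
    refine hη.mono' (hmw η).aestronglyMeasurable ?_
    filter_upwards [ae_restrict_mem (h.measurableSet i)] with x hx
    have h0 := hv0 _ (mul_nonneg hη0 (h.nonneg i j x hx))
    rw [Real.norm_of_nonneg (mul_nonneg h0 (softmax_nonneg _ _))]
    exact mul_le_mul_of_nonneg_left (hle η hη0 x hx) h0
  have hYU : ∀ᶠ η in atTop, Y η ≤ U η := by
    filter_upwards [hφint, hwint, eventually_ge_atTop 0] with η h1 h2 hη0
    refine mul_le_mul_of_nonneg_left (setIntegral_mono_on h2 h1 (h.measurableSet i)
      fun x hx => ?_) hη0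
    exact mul_le_mul_of_nonneg_left (hle η hη0 x hx)
      (hv0 _ (mul_nonneg hη0 (h.nonneg i j x hx)))
  -- On T i j a each third index has relative weight at most e^{K - ηa}, by the spread bound K and
  -- the excess bound a.
  have hLY : ∀ a, ∀ᶠ η in atTop, L a η / (1 + n * Real.exp (K - η * a)) ≤ Y η := by
    intro a
    filter_upwards [hφint, hwint, eventually_ge_atTop 0, hK] with η h1 h2 hη0 hKη
    have hden : 0 < 1 + n * Real.exp (K - η * a) := by positivity
    simp only [hL, hY]
    rw [mul_div_assoc, ← integral_div]
    refine mul_le_mul_of_nonneg_left ?_ hη0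
    have hsub := h.inner_subset i j a
    calc ∫ x in T i j a, v (η * (b x j - b x i))
            * logistic (θ η j - θ η i) (η * (b x j - b x i)) / (1 + n * Real.exp (K - η * a)) ∂μ
        ≤ ∫ x in T i j a, v (η * (b x j - b x i)) * softmax (θ η - η • b x) j ∂μ := by
          refine setIntegral_mono_on ((h1.mono_set hsub).div_const _) (h2.mono_set hsub)
            (h.measurableSet_inner i j a) fun x hx => ?_
          rw [mul_div_assoc]
          refine mul_le_mul_of_nonneg_left ?_
            (hv0 _ (mul_nonneg hη0 (h.nonneg i j x (hsub hx))))
          refine logistic_le_softmax _ hij ?_ (Real.exp_pos _).le fun k hki hkj => ?_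
          · simp only [Pi.sub_apply, Pi.smul_apply, smul_eq_mul]; ring
          · refine Real.exp_le_exp.2 ?_
            have h3 := hKη i k
            have h4 := mul_le_mul_of_nonneg_left (h.inner_le i j a x hx k hki hkj) hη0
            simp only [Pi.sub_apply, Pi.smul_apply, smul_eq_mul]
            linarith
      _ ≤ _ := by
          refine setIntegral_mono_set h2 ?_ hsub.eventuallyLE
          filter_upwards [ae_restrict_mem (h.measurableSet i)] with x hx
          exact mul_nonneg (hv0 _ (mul_nonneg hη0 (h.nonneg i j x hx))) (softmax_nonneg _ _)
  rw [Metric.tendsto_nhds]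
  intro ε hε
  -- The cutoff a is fixed before η → ∞; B bounds the integrals I uniformly, so replacing c by ca
  -- costs less than ε/2.
  obtain ⟨a, ha, ha2, hca⟩ : ∃ a, 0 < a ∧ a ≤ a₀ ∧ |ca i j a - c i j| * B < ε / 2 := by
    have h1 : Tendsto (fun a => |ca i j a - c i j| * B) (𝓝[>] 0) (𝓝 0) := by
      have := (((h.tendsto_const i j hij).sub_const (c i j)).abs).mul_const B
      simpa using this
    have h2 : ∀ᶠ a in 𝓝[>] (0 : ℝ), a ∈ Ioc 0 a₀ := Ioc_mem_nhdsGT ha₀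
    obtain ⟨a, h3, h4⟩ := (h2.and (h1.eventually (gt_mem_nhds (half_pos hε)))).exists
    exact ⟨a, h3.1, h3.2, h4⟩
  have hr : Tendsto (fun η : ℝ => 1 + n * Real.exp (K - η * a)) atTop (𝓝 1) := by
    have h1 : Tendsto (fun η : ℝ => K - η * a) atTop atBot :=
      tendsto_const_nhds.add_atBot (tendsto_neg_atTop_atBot.comp (tendsto_id.atTop_mul_const ha))
    simpa using ((Real.tendsto_exp_atBot.comp h1).const_mul (n : ℝ)).const_add 1
  have hl1 : Tendsto (fun η => (L a η - ca i j a * I η) / (1 + n * Real.exp (K - η * a))) atTop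
      (𝓝 0) := by
    have := (hLt a ha ha2).div hr one_ne_zero
    rw [zero_div] at this
    exact this
  have hl2 : Tendsto (fun η : ℝ => |ca i j a / (1 + n * Real.exp (K - η * a)) - c i j| * B) atTop
      (𝓝 (|ca i j a - c i j| * B)) := by
    have h1 : Tendsto (fun η : ℝ => ca i j a / (1 + n * Real.exp (K - η * a))) atTop
        (𝓝 (ca i j a)) := by
      have := (tendsto_const_nhds (x := ca i j a)).div hr one_ne_zero
      rw [div_one] at this
      exact this
    exact ((h1.sub_const _).abs).mul_const B
  filter_upwards [hUt.eventually (gt_mem_nhds hε), hYU, hLY a, hIB,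
    hl1.eventually (lt_mem_nhds (show -(ε / 2) < 0 by linarith)),
    hl2.eventually (gt_mem_nhds hca)] with η e1 e2 e3 e4 e5 e6
  rw [Real.dist_eq, sub_zero, abs_lt]
  constructor
  · have h1 : L a η / (1 + n * Real.exp (K - η * a)) - c i j * I η
        = (L a η - ca i j a * I η) / (1 + n * Real.exp (K - η * a))
          + (ca i j a / (1 + n * Real.exp (K - η * a)) - c i j) * I η := by ring
    have h2 : -(|ca i j a / (1 + n * Real.exp (K - η * a)) - c i j| * B)
        ≤ (ca i j a / (1 + n * Real.exp (K - η * a)) - c i j) * I η := by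
      refine neg_le_of_abs_le ?_
      rw [abs_mul, abs_of_nonneg e4.1]
      exact mul_le_mul_of_nonneg_left e4.2 (abs_nonneg _)
    change -ε < Y η - c i j * I η
    linarith
  · change Y η - c i j * I η < ε
    linarith

lemma tendsto_flux [NeZero n] (h : IsLaplacePartition μ b S T c ca) {θ : ℝ → Fin n → ℝ}
    {K : ℝ} (hK : ∀ᶠ η in atTop, ∀ i j, θ η j - θ η i ≤ K) {i j : Fin n} (hij : i ≠ j) :
    Tendsto (fun η => η * flux μ b S (θ η) η i j
      - c i j * Real.log (1 + Real.exp (θ η j - θ η i))) atTop (𝓝 0) := by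
  have := h.tendsto_weighted_flux hK hij (v := fun _ => 1) (C₀ := 1) measurable_const
    (fun _ _ => zero_le_one) (fun s hs => by
      rw [one_mul, one_mul]; exact Real.exp_le_exp.2 (by linarith))
  simp only [one_mul, integral_logistic] at this
  exact this

/-- The potentials of neighbouring cells agree in the limit. -/
lemma tendsto_mul_sq_sub [NeZero n] (h : IsLaplacePartition μ b S T c ca) {θ : ℝ → Fin n → ℝ}
    (hθ : ∀ᶠ η in atTop, ∀ j, ∫ x, softmax (θ η - η • b x) j ∂μ = μ.real (S j))
    {K : ℝ} (hK : ∀ᶠ η in atTop, ∀ i j, θ η j - θ η i ≤ K) (i j : Fin n) :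
    Tendsto (fun η => c i j * (θ η j - θ η i) ^ 2) atTop (𝓝 0) := by
  -- The net flux between i and j is asymptotically c_ij(θ_j - θ_i)/η, and the net fluxes at j sum
  -- to 0: the weighted graph Laplacian of θ tends to 0.
  have hlap : ∀ j, Tendsto (fun η => ∑ i, c i j * (θ η j - θ η i)) atTop (𝓝 0) := by
    intro j
    have h1 : Tendsto (fun η => ∑ i, ((η * flux μ b S (θ η) η j i - η * flux μ b S (θ η) η i j)
        + c i j * (θ η j - θ η i))) atTop (𝓝 (∑ _i : Fin n, 0)) := by
      refine tendsto_finsetSum _ fun i _ => ?_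
      by_cases hij : i = j
      · subst hij
        simp
      · have h2 := h.tendsto_flux hK hij
        have h3 := h.tendsto_flux hK (Ne.symm hij)
        have h4 := h3.sub h2
        rw [sub_zero] at h4
        refine h4.congr fun η => ?_
        rw [h.const_symm j i]
        have h5 := log_one_add_exp_sub (θ η j - θ η i)
        rw [neg_sub] at h5
        linear_combination (c i j) * h5
    rw [Finset.sum_const_zero] at h1
    refine h1.congr' ?_
    filter_upwards [hθ] with η hη
    rw [Finset.sum_add_distrib, Finset.sum_sub_distrib, ← Finset.mul_sum, ← Finset.mul_sum,
      h.flux_balance hη j, sub_self, zero_add]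
  -- Pairing the Laplacian with θ - θ_0, which is bounded by K; subtracting θ_0 is what makes
  -- boundedness of differences enough.
  have hE : Tendsto (fun η => ∑ j, (θ η j - θ η 0) * ∑ i, c i j * (θ η j - θ η i)) atTop
      (𝓝 (∑ _j : Fin n, 0)) := by
    refine tendsto_finsetSum _ fun j _ => ?_
    refine bdd_le_mul_tendsto_zero' K ?_ (hlap j)
    filter_upwards [hK] with η hη
    rw [abs_le]
    exact ⟨by linarith [hη j 0], hη 0 j⟩
  rw [Finset.sum_const_zero] at hE
  -- Summation by parts, using the symmetry of c: the pairing is half the Dirichlet energy, all of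
  -- whose terms are nonnegative.
  have hE2 : ∀ η, ∑ j, ∑ i, c i j * (θ η j - θ η i) ^ 2
      = 2 * ∑ j, (θ η j - θ η 0) * ∑ i, c i j * (θ η j - θ η i) := by
    intro η
    have h1 : ∑ j, ∑ i, (θ η i - θ η 0) * (c i j * (θ η j - θ η i))
        = -∑ j, (θ η j - θ η 0) * ∑ i, c i j * (θ η j - θ η i) := by
      rw [Finset.sum_comm, ← Finset.sum_neg_distrib]
      refine Finset.sum_congr rfl fun i _ => ?_
      rw [Finset.mul_sum, ← Finset.sum_neg_distrib]
      refine Finset.sum_congr rfl fun j _ => ?_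
      rw [h.const_symm i j]; ring
    rw [two_mul]
    nth_rewrite 2 [← neg_neg (∑ j, (θ η j - θ η 0) * ∑ i, c i j * (θ η j - θ η i))]
    rw [← h1, ← sub_eq_add_neg, ← Finset.sum_sub_distrib]
    refine Finset.sum_congr rfl fun j _ => ?_
    rw [Finset.mul_sum, ← Finset.sum_sub_distrib]
    refine Finset.sum_congr rfl fun i _ => ?_
    ring
  refine squeeze_zero (fun η => mul_nonneg (h.const_nonneg i j) (sq_nonneg _)) (fun η => ?_)
    (by simpa using hE.const_mul 2)
  rw [← hE2]
  have h0 : ∀ i j, 0 ≤ c i j * (θ η j - θ η i) ^ 2 := fun i j =>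
    mul_nonneg (h.const_nonneg i j) (sq_nonneg _)
  exact (Finset.single_le_sum (f := fun i => c i j * (θ η j - θ η i) ^ 2) (fun i _ => h0 i j)
    (Finset.mem_univ i)).trans (Finset.single_le_sum
      (f := fun j => ∑ i, c i j * (θ η j - θ η i) ^ 2)
      (fun j _ => Finset.sum_nonneg fun i _ => h0 i j) (Finset.mem_univ j))

lemma integrableOn_mul_exp_neg : IntegrableOn (fun s : ℝ => s * Real.exp (-s)) (Ioi 0) := by
  refine Integrable.mono' (integrableOn_exp_half.const_mul 2) (by fun_prop) ?_
  filter_upwards [ae_restrict_mem measurableSet_Ioi] with s hs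
  rw [Real.norm_of_nonneg (mul_nonneg (le_of_lt hs) (Real.exp_pos _).le)]
  exact mul_exp_neg_le

lemma integral_mul_exp_neg : ∫ s in Ioi (0 : ℝ), s * Real.exp (-s) = 1 := by
  have := Real.integral_rpow_mul_exp_neg_mul_Ioi (a := 2) (r := 1) two_pos one_pos
  rw [Real.Gamma_two, show (2 : ℝ) - 1 = 1 by norm_num] at this
  simpa using this

lemma integrableOn_mul_logistic (δ : ℝ) : IntegrableOn (fun s => s * logistic δ s) (Ioi 0) := by
  refine Integrable.mono' (integrableOn_mul_exp_neg.const_mul (Real.exp δ))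
    (measurable_id.mul (measurable_logistic δ)).aestronglyMeasurable ?_
  filter_upwards [ae_restrict_mem measurableSet_Ioi] with s hs
  rw [Real.norm_of_nonneg (mul_nonneg (le_of_lt hs) (logistic_nonneg _ _))]
  calc s * logistic δ s ≤ s * (Real.exp δ * Real.exp (-s)) :=
        mul_le_mul_of_nonneg_left (logistic_le δ s) (le_of_lt hs)
    _ = _ := by ring

lemma abs_integral_mul_logistic_sub_le (δ : ℝ) :
    |(∫ s in Ioi (0 : ℝ), s * logistic δ s) - ∫ s in Ioi (0 : ℝ), s * logistic 0 s|
      ≤ |Real.exp δ - 1| := by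
  rw [← integral_sub (integrableOn_mul_logistic δ) (integrableOn_mul_logistic 0),
    ← Real.norm_eq_abs, show |Real.exp δ - 1|
      = ∫ s in Ioi (0 : ℝ), |Real.exp δ - 1| * (s * Real.exp (-s)) by
    rw [integral_const_mul, integral_mul_exp_neg, mul_one]]
  refine norm_integral_le_of_norm_le (integrableOn_mul_exp_neg.const_mul _) ?_
  filter_upwards [ae_restrict_mem measurableSet_Ioi] with s hs
  rw [← mul_sub, norm_mul, Real.norm_of_nonneg (le_of_lt hs), Real.norm_eq_abs]
  calc s * |logistic δ s - logistic 0 s| ≤ s * (|Real.exp δ - 1| * Real.exp (-s)) :=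
        mul_le_mul_of_nonneg_left (abs_logistic_sub_le δ s) (le_of_lt hs)
    _ = _ := by ring

/-- This is `tendsto_weighted_flux` with v(s) = s, one power of η being absorbed into s = η(b_j -
b_i). Where c_ij = 0 the behaviour of θ_j - θ_i is irrelevant; where c_ij > 0 it tends to 0, so the
integral tends to its value at δ = 0. -/
lemma tendsto_cost_flux [NeZero n] (h : IsLaplacePartition μ b S T c ca) {θ : ℝ → Fin n → ℝ}
    (hθ : ∀ᶠ η in atTop, ∀ j, ∫ x, softmax (θ η - η • b x) j ∂μ = μ.real (S j)) (i j : Fin n) :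
    Tendsto (fun η => η ^ 2 * ∫ x in S i, softmax (θ η - η • b x) j * (b x j - b x i) ∂μ) atTop
      (𝓝 (c i j * ((riemannZeta 2).re / 2))) := by
  obtain ⟨K, hK⟩ := h.exists_bound hθ
  by_cases hij : i = j
  · subst hij
    simp [h.const_self]
  have h1 := h.tendsto_weighted_flux hK hij (v := fun s => s) (C₀ := 2) measurable_id
    (fun s hs => hs) (fun s _ => mul_exp_neg_le)
  have h2 : Tendsto (fun η => c i j * ∫ s in Ioi (0 : ℝ), s * logistic (θ η j - θ η i) s) atTop
      (𝓝 (c i j * ((riemannZeta 2).re / 2))) := by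
    rcases (h.const_nonneg i j).eq_or_lt with h0 | h0
    · simp [← h0]
    · refine Tendsto.const_mul _ ?_
      have h3 := (h.tendsto_mul_sq_sub hθ hK i j).const_mul (c i j)⁻¹
      simp only [mul_zero, inv_mul_cancel_left₀ h0.ne'] at h3
      have h4 : Tendsto (fun η => θ η j - θ η i) atTop (𝓝 0) := by
        rw [tendsto_zero_iff_abs_tendsto_zero]
        have := h3.sqrt
        simpa [Function.comp_def, Real.sqrt_sq_eq_abs] using this
      have h5 : Tendsto (fun η => |Real.exp (θ η j - θ η i) - 1|) atTop (𝓝 0) := by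
        have := (((Real.continuous_exp.tendsto 0).comp h4).sub_const 1).abs
        simpa using this
      rw [← integral_mul_logistic_zero, tendsto_iff_norm_sub_tendsto_zero]
      exact squeeze_zero (fun _ => norm_nonneg _)
        (fun η => abs_integral_mul_logistic_sub_le _) h5
  have h3 := h1.add h2
  rw [zero_add] at h3
  refine h3.congr fun η => ?_
  rw [sub_add_cancel, pow_two, mul_assoc]
  congr 1
  rw [← integral_const_mul]
  congr 1 with x
  ring

/-- Second-order asymptotics of the suboptimality of softmax weights with the correct marginals. -/
theorem tendsto_suboptimality [NeZero n] (h : IsLaplacePartition μ b S T c ca) {θ : ℝ → Fin n → ℝ}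
    (hθ : ∀ᶠ η in atTop, ∀ j, ∫ x, softmax (θ η - η • b x) j ∂μ = μ.real (S j))
    (hint : ∀ j, Integrable (fun x => b x j) μ) :
    Tendsto (fun η => η ^ 2 * ∫ x, ∑ j, softmax (θ η - η • b x) j * (b x j - ⨅ k, b x k) ∂μ) atTop
      (𝓝 (((riemannZeta 2).re / 2) * ∑ i, ∑ j, c i j)) := by
  have h1 : Tendsto (fun η => ∑ i, ∑ j,
      η ^ 2 * ∫ x in S i, softmax (θ η - η • b x) j * (b x j - b x i) ∂μ) atTop
      (𝓝 (∑ i, ∑ j, c i j * ((riemannZeta 2).re / 2))) :=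
    tendsto_finsetSum _ fun i _ => tendsto_finsetSum _ fun j _ => h.tendsto_cost_flux hθ i j
  simp only [← Finset.sum_mul] at h1
  rw [mul_comm]
  refine h1.congr fun η => ?_
  have hmin : ∀ i, ∀ x ∈ S i, ⨅ k, b x k = b x i := fun i x hx =>
    le_antisymm (ciInf_le (Finite.bddBelow_range _) i)
      (le_ciInf fun k => by linarith [h.nonneg i k x hx])
  have hprod : ∀ j, ∀ F : X → ℝ, Integrable F μ →
      Integrable (fun x => softmax (θ η - η • b x) j * F x) μ := by
    intro j F hF
    refine hF.norm.mono' ((h.integrable_weight (θ η) η j).1.mul hF.1) (ae_of_all _ fun x => ?_)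
    rw [norm_mul, Real.norm_of_nonneg (softmax_nonneg _ _)]
    exact mul_le_of_le_one_left (norm_nonneg _) (softmax_le_one _ _)
  have hI : Integrable (fun x => ⨅ k, b x k) μ := by
    have := integrable_comp_sub (μ := μ) iInf_mono_pi iInf_add_const (Integrable.of_eval hint) 0
    simpa using this
  have hsum : Integrable
      (fun x => ∑ j, softmax (θ η - η • b x) j * (b x j - ⨅ k, b x k)) μ :=
    integrable_finsetSum _ fun j _ => hprod j _ ((hint j).sub hI)
  have hcell : ∀ i j, Integrable (fun x => softmax (θ η - η • b x) j * (b x j - b x i))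
      (μ.restrict (S i)) := fun i j => (hprod j _ ((hint j).sub (hint i))).restrict
  rw [h.integral_eq_sum_cells hsum, Finset.mul_sum]
  refine Finset.sum_congr rfl fun i _ => ?_
  rw [← Finset.mul_sum, ← integral_finsetSum _ fun j _ => hcell i j]
  congr 1
  refine setIntegral_congr_fun (h.measurableSet i) fun x hx => ?_
  simp only [hmin i x hx]

end IsLaplacePartition

/-! ### Connectedness of the adjacency graph of the cells. -/

/-- The orthogonal projection onto a hyperplane does not increase the `(d - 1)`-dimensional
Hausdorff measure: if a set is null, then so is its shadow. -/
lemma volume_image_orthogonalProjection_eq_zero {w : EuclideanSpace ℝ (Fin d)} (hw : w ≠ 0)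
    {N : Set (EuclideanSpace ℝ (Fin d))} (hN : Measure.euclideanHausdorffMeasure (d - 1) N = 0) :
    volume ((Submodule.span ℝ {w})ᗮ.orthogonalProjectionOnto '' N) = 0 := by
  rw [← hausdorff_orthogonal_eq_volume hw]
  rw [Measure.euclideanHausdorffMeasure_def] at hN ⊢
  rw [Measure.smul_apply, ENNReal.smul_def, smul_eq_mul, mul_eq_zero] at hN ⊢
  refine hN.imp id fun h => ?_
  exact le_antisymm ((hausdorffMeasure_orthogonalProjectionOnto_le _ _ _ (by positivity)).trans
    h.le) zero_le

/-- Two closed sets which cover a convex open set and both have interior points in it meet in a set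
of positive `(d - 1)`-dimensional measure. -/
lemma hausdorff_inter_ne_zero {C D B : Set (EuclideanSpace ℝ (Fin d))} (hC : IsClosed C)
    (hD : IsClosed D) (hB : IsOpen B) (hBc : Convex ℝ B) (hcov : B ⊆ C ∪ D)
    {p q : EuclideanSpace ℝ (Fin d)} (hp : p ∈ interior C) (hpB : p ∈ B) (hq : q ∈ interior D)
    (hqB : q ∈ B) (hpq : p ≠ q) :
    Measure.euclideanHausdorffMeasure (d - 1) (C ∩ D ∩ B) ≠ 0 := by
  intro h0
  set w := q - p with hw
  have hw0 : w ≠ 0 := sub_ne_zero.2 hpq.symm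
  set K := (Submodule.span ℝ {w})ᗮ with hK
  set P := K.orthogonalProjectionOnto with hP
  have hnull : volume ((fun v => v + -P p) '' (P '' (C ∩ D ∩ B))) = 0 := by
    rw [image_add_right, measure_preimage_add_right]
    exact volume_image_orthogonalProjection_eq_zero hw0 h0
  -- For every u in this open neighbourhood of 0 the segment from p+u to q+u runs from C to D inside
  -- B, so by connectedness it meets C ∩ D. It projects to the single point P p + u, so the shadow
  -- of C ∩ D ∩ B contains a translate of O.
  set O : Set K := {u | p + (u : EuclideanSpace ℝ (Fin d)) ∈ interior C ∩ B ∧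
    q + (u : EuclideanSpace ℝ (Fin d)) ∈ interior D ∩ B} with hO
  have hOo : IsOpen O :=
    ((isOpen_interior.inter hB).preimage (by fun_prop : Continuous fun u : K =>
      p + (u : EuclideanSpace ℝ (Fin d)))).inter
    ((isOpen_interior.inter hB).preimage (by fun_prop : Continuous fun u : K =>
      q + (u : EuclideanSpace ℝ (Fin d))))
  have hOne : O.Nonempty := ⟨0, by simp [hO, hp, hpB, hq, hqB]⟩
  refine (hOo.measure_pos volume hOne).ne' (measure_mono_null ?_ hnull)
  rintro u ⟨⟨hu1, hu2⟩, hu3, hu4⟩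
  have hseg : segment ℝ (p + (u : EuclideanSpace ℝ (Fin d))) (q + u) ⊆ B :=
    hBc.segment_subset hu2 hu4
  obtain ⟨x, hx, hxC, hxD⟩ := isPreconnected_closed_iff.1
    (convex_segment (𝕜 := ℝ) (p + (u : EuclideanSpace ℝ (Fin d))) (q + u)).isPreconnected C D hC hD
    (hseg.trans hcov) ⟨_, left_mem_segment ℝ _ _, interior_subset hu1⟩
    ⟨_, right_mem_segment ℝ _ _, interior_subset hu3⟩
  refine ⟨P x, ⟨x, ⟨⟨hxC, hxD⟩, hseg hx⟩, rfl⟩, ?_⟩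
  rw [segment_eq_image'] at hx
  obtain ⟨s, -, rfl⟩ := hx
  have h1 : P w = 0 := by
    have : w ∈ Kᗮ := by
      rw [hK]
      exact Submodule.le_orthogonal_orthogonal _ (Submodule.mem_span_singleton_self w)
    exact Submodule.orthogonalProjectionOnto_eq_zero_iff.2 this
  have h2 : P (u : EuclideanSpace ℝ (Fin d)) = u :=
    K.orthogonalProjectionOnto_mem_subspace_eq_self u
  have h3 : p + (u : EuclideanSpace ℝ (Fin d)) + s • (q + u - (p + u)) = p + u + s • w := by
    rw [hw]; congr 2; abel
  simp only [h3, map_add, map_smul, h1, h2]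
  simp

lemma slack_lineMap (y : Fin n → EuclideanSpace ℝ (Fin d)) (g : EuclideanSpace ℝ (Fin d) → ℝ)
    (i j : Fin n) (x x' : EuclideanSpace ℝ (Fin d)) (s : ℝ) :
    slack y g i j (AffineMap.lineMap x x' s)
      = (1 - s) * slack y g i j x + s * slack y g i j x' := by
  rw [AffineMap.lineMap_apply_module]
  simp only [slack_eq_inner, inner_add_right, inner_smul_right]
  ring

/-- Otherwise every point of the cell would lie on one of finitely many bisectors, all of which are
null. -/
lemma exists_forall_slack_pos {μ : Measure (EuclideanSpace ℝ (Fin d))} [IsProbabilityMeasure μ]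
    (hac : μ ≪ volume)
    {y : Fin n → EuclideanSpace ℝ (Fin d)} (hy : Function.Injective y)
    (g : EuclideanSpace ℝ (Fin d) → ℝ) {j : Fin n} (hj : μ (powerCell y g j) ≠ 0) :
    ∃ x, ∀ k, k ≠ j → 0 < slack y g j k x := by
  by_contra! hcon
  refine hj (measure_mono_null (t := ⋃ k, ⋃ (_ : k ≠ j), {x | slack y g j k x = 0}) ?_ ?_)
  · intro x hx
    obtain ⟨k, hk, hle⟩ := hcon x
    exact mem_iUnion₂.2 ⟨k, hk, le_antisymm hle (mem_powerCell_iff.1 hx k)⟩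
  · exact measure_iUnion_null fun k => measure_iUnion_null fun hk =>
      measure_slack_eq_zero hac hy g hk.symm

lemma mem_interior_powerCell {y : Fin n → EuclideanSpace ℝ (Fin d)}
    {g : EuclideanSpace ℝ (Fin d) → ℝ} {j : Fin n} {x : EuclideanSpace ℝ (Fin d)}
    (hx : ∀ k, k ≠ j → 0 < slack y g j k x) : x ∈ interior (powerCell y g j) := by
  rw [mem_interior_iff_mem_nhds]
  have : ∀ k, ∀ᶠ x' in 𝓝 x, 0 ≤ slack y g j k x' := by
    intro k
    by_cases hk : k = j
    · subst hk
      exact Eventually.of_forall fun x' => (slack_self y g k x').ge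
    · exact ((continuous_slack y g j k).continuousAt.eventually_const_lt (hx k hk)).mono
        fun _ h => h.le
  filter_upwards [eventually_all.2 this] with x' hx'
  exact mem_powerCell_iff.2 hx'

/-- Points of a cell with nonempty interior are limits of points with positive slacks. -/
lemma exists_mem_forall_slack_pos {y : Fin n → EuclideanSpace ℝ (Fin d)}
    {g : EuclideanSpace ℝ (Fin d) → ℝ} {j : Fin n} {x₀ z : EuclideanSpace ℝ (Fin d)}
    (hx₀ : ∀ k, k ≠ j → 0 < slack y g j k x₀) (hz : z ∈ powerCell y g j)
    {B : Set (EuclideanSpace ℝ (Fin d))} (hB : B ∈ 𝓝 z) :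
    ∃ p ∈ B, ∀ k, k ≠ j → 0 < slack y g j k p := by
  have h1 : Tendsto (fun s : ℝ => AffineMap.lineMap z x₀ s) (𝓝[>] 0) (𝓝 z) := by
    have : Continuous fun s : ℝ => AffineMap.lineMap z x₀ s := AffineMap.lineMap_continuous
    have h2 := this.tendsto 0
    rw [AffineMap.lineMap_apply_zero] at h2
    exact h2.mono_left nhdsWithin_le_nhds
  have h3 : ∀ᶠ s : ℝ in 𝓝[>] 0, s ∈ Ioo (0 : ℝ) 1 := Ioo_mem_nhdsGT one_pos
  obtain ⟨s, hs, hs'⟩ := ((h1.eventually hB).and h3).exists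
  refine ⟨_, hs, fun k hk => ?_⟩
  rw [slack_lineMap]
  have := mul_nonneg (sub_pos.2 hs'.2).le (mem_powerCell_iff.1 hz k)
  have := mul_pos hs'.1 (hx₀ k hk)
  linarith

lemma HasRegularDensity.measure_compl_interior_support
    {μ : Measure (EuclideanSpace ℝ (Fin d))} [IsProbabilityMeasure μ]
    {ρ : EuclideanSpace ℝ (Fin d) → ℝ≥0}
    (hμ : HasRegularDensity μ ρ) (hac : μ ≪ volume) : μ (interior μ.support)ᶜ = 0 := by
  have h1 : (interior μ.support)ᶜ ⊆ μ.supportᶜ ∪ frontier μ.support := by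
    intro x hx
    by_cases h : x ∈ μ.support
    · right; exact ⟨subset_closure h, hx⟩
    · left; exact h
  exact measure_mono_null h1 (measure_union_null Measure.measure_compl_support
    (hac hμ.frontier_null))

/-- The graph of cells with common faces of positive mass is connected. -/
lemma HasRegularDensity.exists_faceMass_pos
    {μ : Measure (EuclideanSpace ℝ (Fin d))} [IsProbabilityMeasure μ]
    {ρ : EuclideanSpace ℝ (Fin d) → ℝ≥0}
    (hμ : HasRegularDensity μ ρ) (hac : μ ≪ volume)
    {y : Fin n → EuclideanSpace ℝ (Fin d)} (hy : Function.Injective y)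
    {g : EuclideanSpace ℝ (Fin d) → ℝ} (hcell : ∀ i, μ (powerCell y g i) ≠ 0)
    {A : Finset (Fin n)} (hA : A.Nonempty) (hA' : A ≠ Finset.univ) :
    ∃ i ∉ A, ∃ j ∈ A, faceMass ρ y g i j ≠ 0 := by
  by_contra! hcon
  set U := interior μ.support with hU
  have hU0 : μ Uᶜ = 0 := hμ.measure_compl_interior_support hac
  set CA := ⋃ j ∈ A, powerCell y g j with hCA
  set CB := ⋃ i ∈ Aᶜ, powerCell y g i with hCB
  have hCAc : IsClosed CA :=
    A.finite_toSet.isClosed_biUnion fun j _ => isClosed_powerCell y g j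
  have hCBc : IsClosed CB :=
    (Aᶜ).finite_toSet.isClosed_biUnion fun j _ => isClosed_powerCell y g j
  obtain ⟨j₀, hj₀⟩ := hA
  obtain ⟨i₀, hi₀⟩ : ∃ i, i ∉ A := by
    by_contra! h; exact hA' (Finset.eq_univ_iff_forall.2 h)
  have : NeZero n := ⟨fun hn => by subst hn; exact i₀.elim0⟩
  have hcov : ∀ x, x ∈ CA ∪ CB := by
    intro x
    have hx : x ∈ ⋃ i, powerCell y g i := by rw [iUnion_powerCell]; trivial
    obtain ⟨i, hi⟩ := mem_iUnion.1 hx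
    by_cases h : i ∈ A
    · exact Or.inl (mem_iUnion₂.2 ⟨i, h, hi⟩)
    · exact Or.inr (mem_iUnion₂.2 ⟨i, Finset.mem_compl.2 h, hi⟩)
  -- Both groups of cells meet the connected set U, since each cell has positive mass and U has full
  -- mass. Being closed and covering, the two groups share a point of U.
  have hmeet : ∀ i, (U ∩ powerCell y g i).Nonempty := by
    intro i
    by_contra h
    rw [not_nonempty_iff_eq_empty] at h
    refine hcell i (measure_mono_null (fun x hx => ?_) hU0)
    intro hxU
    have : x ∈ U ∩ powerCell y g i := ⟨hxU, hx⟩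
    simp [h] at this
  obtain ⟨z, hzU, hzA, hzB⟩ := isPreconnected_closed_iff.1 hμ.connected.isPreconnected CA CB
    hCAc hCBc (fun x _ => hcov x)
    ((hmeet j₀).mono fun x hx => ⟨hx.1, mem_iUnion₂.2 ⟨j₀, hj₀, hx.2⟩⟩)
    ((hmeet i₀).mono fun x hx => ⟨hx.1, mem_iUnion₂.2 ⟨i₀, Finset.mem_compl.2 hi₀, hx.2⟩⟩)
  obtain ⟨j, hj, hzj⟩ := mem_iUnion₂.1 hzA
  obtain ⟨i, hi, hzi⟩ := mem_iUnion₂.1 hzB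
  have hij : i ≠ j := fun h => Finset.mem_compl.1 hi (h ▸ hj)
  obtain ⟨r, hr, hrU⟩ := Metric.isOpen_iff.1 isOpen_interior z hzU
  obtain ⟨xj, hxj⟩ := exists_forall_slack_pos hac hy g (hcell j)
  obtain ⟨xi, hxi⟩ := exists_forall_slack_pos hac hy g (hcell i)
  obtain ⟨p, hpB, hp⟩ := exists_mem_forall_slack_pos hxj hzj (Metric.ball_mem_nhds z hr)
  obtain ⟨q, hqB, hq⟩ := exists_mem_forall_slack_pos hxi hzi (Metric.ball_mem_nhds z hr)
  have hpq : p ≠ q := by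
    rintro rfl
    have h1 := hp i hij
    have h2 := hq j hij.symm
    rw [slack_swap] at h1
    linarith
  refine hausdorff_inter_ne_zero hCAc hCBc Metric.isOpen_ball (convex_ball z r)
    (fun x _ => hcov x)
    (interior_mono (subset_biUnion_of_mem (u := fun j => powerCell y g j) hj)
      (mem_interior_powerCell hp)) hpB
    (interior_mono (subset_biUnion_of_mem (u := fun j => powerCell y g j) hi)
      (mem_interior_powerCell hq)) hqB hpq ?_
  -- Since the density is positive on U, a face without mass is Hausdorff-null inside U; if all
  -- faces across the cut were so, this would contradict `hausdorff_inter_ne_zero` on a ball around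
  -- z.
  refine measure_mono_null (t := ⋃ j ∈ A, ⋃ i ∈ Aᶜ, powerCell y g i ∩ powerCell y g j ∩ U) ?_ ?_
  · rintro x ⟨⟨hxA, hxB⟩, hx⟩
    obtain ⟨j, hj, hxj⟩ := mem_iUnion₂.1 hxA
    obtain ⟨i, hi, hxi⟩ := mem_iUnion₂.1 hxB
    exact mem_iUnion₂.2 ⟨j, hj, mem_iUnion₂.2 ⟨i, hi, ⟨hxi, hxj⟩, hrU hx⟩⟩
  · refine (measure_biUnion_null_iff A.countable_toSet).2 fun j hj =>
      (measure_biUnion_null_iff (Aᶜ).countable_toSet).2 fun i hi => ?_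
    have h0 := hcon i (Finset.mem_compl.1 hi) j hj
    rw [faceMass, lintegral_eq_zero_iff hμ.measurable.coe_nnreal_ennreal] at h0
    have hm : MeasurableSet (powerCell y g i ∩ powerCell y g j) :=
      ((isClosed_powerCell y g i).inter (isClosed_powerCell y g j)).measurableSet
    have h1 := (ae_restrict_iff' hm).1 h0
    refine measure_mono_null ?_ h1
    rintro x ⟨hx, hxU⟩ h
    have := h hx
    simp only [Pi.zero_apply, ENNReal.coe_eq_zero] at this
    exact (hμ.pos x hxU).ne' this

/-! ### Continuity of the slices for compactly supported densities. -/

/-- Proper affine hyperplanes of a finite-dimensional inner product space are null. -/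
lemma volume_inner_eq_zero {E : Type*} [NormedAddCommGroup E] [InnerProductSpace ℝ E]
    [FiniteDimensional ℝ E] [MeasurableSpace E] [BorelSpace E] {v : E} (hv : v ≠ 0) (c : ℝ) :
    volume {z : E | inner ℝ v z = c} = 0 := by
  rcases eq_empty_or_nonempty {z : E | inner ℝ v z = c} with h | ⟨z₀, hz₀⟩
  · rw [h, measure_empty]
  have h1 : {z : E | inner ℝ v z = c}
      = (fun z => z + -z₀) ⁻¹' ((innerSL ℝ v).ker : Set E) := by
    ext z
    have hz₀' : inner ℝ v z₀ = c := hz₀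
    simp [inner_add_right, hz₀', add_neg_eq_zero]
  rw [h1, measure_preimage_add_right]
  refine Measure.addHaar_submodule _ _ fun htop => hv ?_
  have : v ∈ (innerSL ℝ v).ker := by rw [htop]; trivial
  simpa using this

lemma slack_hyperplaneParam {y : Fin n → EuclideanSpace ℝ (Fin d)} (hy : Function.Injective y)
    (g : EuclideanSpace ℝ (Fin d) → ℝ) {i j : Fin n} (hij : i ≠ j) (t : ℝ)
    (z : (Submodule.span ℝ {(2 : ℝ) • (y i - y j)})ᗮ) :
    slack y g i j (hyperplaneParam ((2 : ℝ) • (y i - y j)) (slackConst y g i j) t z) = t := by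
  rw [slack_eq_inner]
  exact inner_hyperplaneParam (two_smul_sub_ne_zero hy hij) (slackConst y g i j) t z

lemma norm_le_norm_hyperplaneParam (w : EuclideanSpace ℝ (Fin d)) (κ t : ℝ)
    (z : (Submodule.span ℝ {w})ᗮ) : ‖z‖ ≤ ‖hyperplaneParam w κ t z‖ := by
  have h : (Submodule.span ℝ {w})ᗮ.orthogonalProjectionOnto (hyperplaneParam w κ t z) = z := by
    rw [hyperplaneParam, map_add, map_smul,
      Submodule.orthogonalProjectionOnto_mem_subspace_eq_self,
      Submodule.orthogonalProjectionOnto_orthogonal_apply_eq_zero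
        (Submodule.mem_span_singleton_self w), smul_zero, add_zero]
  conv_lhs => rw [← h]
  exact Submodule.norm_orthogonalProjectionOnto_apply_le _ _

/-- If all cells have positive mass, then no third bisector contains a bisector of two sites. -/
lemma slack_const_ne_zero {μ : Measure (EuclideanSpace ℝ (Fin d))} [IsProbabilityMeasure μ]
    (hac : μ ≪ volume) {y : Fin n → EuclideanSpace ℝ (Fin d)} (hy : Function.Injective y)
    {g : EuclideanSpace ℝ (Fin d) → ℝ} (hcell : ∀ i, μ (powerCell y g i) ≠ 0)
    {i j k : Fin n} (hik : i ≠ k) (hjk : j ≠ k) {α β : ℝ}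
    (h : ∀ x, slack y g i k x = β * slack y g i j x + α) : α ≠ 0 := by
  rintro rfl
  have hnull : ∀ l p q, p ≠ q → ∃ x ∈ powerCell y g l, slack y g p q x ≠ 0 := by
    intro l p q hpq
    by_contra! hcon
    exact hcell l (measure_mono_null hcon (measure_slack_eq_zero hac hy g hpq))
  -- If Δ_ik = βΔ_ij, then Δ_jk = (β - 1)Δ_ij, and the sign conditions put one whole cell into a
  -- bisector: cell i for β ≤ 0, cell k for 0 < β ≤ 1, cell j for β > 1.
  rcases le_or_gt β 0 with hβ | hβ
  · obtain ⟨x, hx, hne⟩ := hnull i i k hik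
    have h1 := mem_powerCell_iff.1 hx j
    have h2 := mem_powerCell_iff.1 hx k
    have h3 := h x
    exact hne (le_antisymm (by nlinarith) h2)
  rcases le_or_gt β 1 with hβ1 | hβ1
  · obtain ⟨x, hx, hne⟩ := hnull k j k hjk
    have h1 := mem_powerCell_iff.1 hx i
    have h2 := mem_powerCell_iff.1 hx j
    have h3 := h x
    rw [slack_swap] at h1 h2
    have h4 := slack_sub y g i j k x
    have h5 : slack y g i j x ≤ 0 := by nlinarith
    exact hne (le_antisymm (by linarith) (by nlinarith))
  · obtain ⟨x, hx, hne⟩ := hnull j j k hjk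
    have h1 := mem_powerCell_iff.1 hx i
    have h2 := mem_powerCell_iff.1 hx k
    have h3 := h x
    rw [slack_swap] at h1
    have h4 := slack_sub y g i j k x
    exact hne (le_antisymm (by nlinarith) h2)

/-- On the bisector of two sites, small level sets of a third slack are null. -/
lemma exists_forall_ae_slack_ne {μ : Measure (EuclideanSpace ℝ (Fin d))} [IsProbabilityMeasure μ]
    (hac : μ ≪ volume) {y : Fin n → EuclideanSpace ℝ (Fin d)} (hy : Function.Injective y)
    {g : EuclideanSpace ℝ (Fin d) → ℝ} (hcell : ∀ i, μ (powerCell y g i) ≠ 0)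
    {i j k : Fin n} (hij : i ≠ j) (hik : i ≠ k) (hjk : j ≠ k) :
    ∃ a₀ > 0, ∀ a ∈ Icc (0 : ℝ) a₀, ∀ᵐ z,
      slack y g i k (hyperplaneParam ((2 : ℝ) • (y i - y j)) (slackConst y g i j) 0 z) ≠ a := by
  set w := (2 : ℝ) • (y i - y j) with hw
  set w' := (2 : ℝ) • (y i - y k) with hw'
  set P := (Submodule.span ℝ {w})ᗮ.orthogonalProjectionOnto with hP
  by_cases hPw : P w' = 0
  -- Parallel bisectors: the third slack is a nonzero constant on the bisector of y_i and y_j, so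
  -- levels a ≥ 0 up to half its absolute value are never attained.
  · obtain ⟨β, hβ⟩ : ∃ β : ℝ, β • w = w' := by
      have := Submodule.orthogonalProjectionOnto_eq_zero_iff.1 hPw
      rw [Submodule.orthogonal_orthogonal] at this
      exact Submodule.mem_span_singleton.1 this
    have haff : ∀ x, slack y g i k x
        = β * slack y g i j x + (slackConst y g i k - β * slackConst y g i j) := by
      intro x
      rw [slack_eq_inner, slack_eq_inner, ← hw', ← hβ, inner_smul_left, slackConst, slackConst]
      simp only [conj_trivial]
      ring
    have hα := slack_const_ne_zero hac hy hcell hik hjk haff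
    refine ⟨|slackConst y g i k - β * slackConst y g i j| / 2, half_pos (abs_pos.2 hα),
      fun a ha => ae_of_all _ fun z hz => ?_⟩
    rw [haff, slack_hyperplaneParam hy g hij, mul_zero, zero_add] at hz
    rw [hz] at ha hα
    rw [abs_of_nonneg ha.1] at ha
    have := ha.2
    have := lt_of_le_of_ne ha.1 hα.symm
    linarith
  -- Here the third slack is a nonconstant affine function on the bisector, so every level set is
  -- null and any a₀ would do.
  · refine ⟨1, one_pos, fun a _ => ?_⟩
    rw [ae_iff]
    refine measure_mono_null ?_ (volume_inner_eq_zero hPw (a - slackConst y g i k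
      - ((0 - slackConst y g i j) / ‖w‖ ^ 2) * inner ℝ w' w))
    intro z hz
    have hz' := not_not.1 hz
    have h1 : inner ℝ (P w') z = inner ℝ w' (z : EuclideanSpace ℝ (Fin d)) := by
      rw [hP, Submodule.inner_orthogonalProjectionOnto_eq_of_mem_right]
    rw [slack_eq_inner, hyperplaneParam, inner_add_right, inner_smul_right, ← hw'] at hz'
    change inner ℝ (P w') z = _
    rw [h1, slackConst]
    linarith

section
variable {μ : Measure (EuclideanSpace ℝ (Fin d))} {ρ : EuclideanSpace ℝ (Fin d) → ℝ≥0}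
  {y : Fin n → EuclideanSpace ℝ (Fin d)} {g : EuclideanSpace ℝ (Fin d) → ℝ} {i j : Fin n}

/-- The parameter z is the orthogonal projection of the point it parametrizes, so ‖z‖ ≤ R on the
support for every t. A constant on a ball therefore dominates uniformly in t and a. -/
lemma IsCompactContinuous.exists_dominating (h : IsCompactContinuous μ ρ y g) (i j : Fin n) :
    ∃ G : (Submodule.span ℝ {(2 : ℝ) • (y i - y j)})ᗮ → ℝ≥0∞, ∫⁻ z, G z ≠ ∞ ∧
      ∀ t a z, (shrunkCell y g i j a).indicator (fun x => (ρ x : ℝ≥0∞))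
        (hyperplaneParam ((2 : ℝ) • (y i - y j)) (slackConst y g i j) t z) ≤ G z := by
  obtain ⟨C, hC⟩ := h.bounded
  obtain ⟨R, hR⟩ := h.isCompact.isBounded.subset_closedBall 0
  refine ⟨(Metric.closedBall 0 R).indicator fun _ => (C : ℝ≥0∞), ?_, fun t a z => ?_⟩
  · rw [lintegral_indicator_const Metric.isClosed_closedBall.measurableSet]
    exact (ENNReal.mul_lt_top ENNReal.coe_lt_top
      (isCompact_closedBall _ _).measure_lt_top).ne
  · refine (indicator_le_self _ _ _).trans ?_
    by_cases hz : z ∈ Metric.closedBall 0 R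
    · rw [indicator_of_mem hz]
      exact ENNReal.coe_le_coe.2 (hC _)
    · rw [h.eq_zero]
      · simp
      · intro hx
        refine hz ?_
        have := hR hx
        rw [mem_closedBall_zero_iff] at this ⊢
        exact (norm_le_norm_hyperplaneParam _ _ _ _).trans this

/-- Off the support ρ vanishes locally and in the interior it is continuous, so the face hypothesis
is needed only on the boundary. -/
lemma IsCompactContinuous.ae_continuousAt (h : IsCompactContinuous μ ρ y g)
    (hy : Function.Injective y) (hij : i ≠ j) :
    ∀ᵐ z, hyperplaneParam ((2 : ℝ) • (y i - y j)) (slackConst y g i j) 0 z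
        ∈ powerCell y g i ∩ powerCell y g j →
      ContinuousAt ρ (hyperplaneParam ((2 : ℝ) • (y i - y j)) (slackConst y g i j) 0 z) := by
  have hm : MeasurableSet (powerCell y g i ∩ powerCell y g j) :=
    ((isClosed_powerCell y g i).inter (isClosed_powerCell y g j)).measurableSet
  have h1 := ae_restrict_of_ae
    (s := {x | inner ℝ ((2 : ℝ) • (y i - y j)) x + slackConst y g i j = 0})
    ((ae_restrict_iff' hm).1 (h.continuousAt_face i j hij))
  rw [← map_hyperplaneParam (two_smul_sub_ne_zero hy hij)] at h1
  filter_upwards [ae_of_ae_map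
    (isometry_hyperplaneParam _ _ _).continuous.measurable.aemeasurable h1] with z hz hmem
  set x := hyperplaneParam ((2 : ℝ) • (y i - y j)) (slackConst y g i j) 0 z
  by_cases hs : x ∈ μ.support
  · by_cases hi : x ∈ interior μ.support
    · exact h.continuousOn.continuousAt (isOpen_interior.mem_nhds hi)
    · exact hz hmem ⟨subset_closure hs, hi⟩
  · have : ρ =ᶠ[𝓝 x] fun _ => 0 := by
      filter_upwards [Measure.isClosed_support.isOpen_compl.mem_nhds hs] with x' hx'
      exact h.eq_zero x' hx'
    exact continuousAt_const.congr this.symm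

lemma mem_shrunkCell_of_lt {a : ℝ} (ha : 0 ≤ a) {x : EuclideanSpace ℝ (Fin d)}
    (hj : 0 ≤ slack y g i j x) (hx : ∀ k, k ≠ i → k ≠ j → a ≤ slack y g i k x) :
    x ∈ shrunkCell y g i j a := by
  refine ⟨mem_powerCell_iff.2 fun k => ?_, hx⟩
  by_cases hki : k = i
  · rw [hki, slack_self]
  by_cases hkj : k = j
  · rwa [hkj]
  exact ha.trans (hx k hki hkj)

/-- Since no third slack equals a at φ(0), either one is strictly below a and the indicator vanishes
nearby, or all are strictly above and membership persists for t ≥ 0. Continuity of ρ matters only in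
the second case, where φ(0) lies on the face. -/
lemma tendsto_indicator_shrunkCell {a : ℝ} (ha : 0 ≤ a)
    {φ : ℝ → EuclideanSpace ℝ (Fin d)} (hφ : ContinuousAt φ 0)
    (hφj : ∀ t, slack y g i j (φ t) = t) (hne : ∀ k, k ≠ i → k ≠ j → slack y g i k (φ 0) ≠ a)
    (hρ : φ 0 ∈ powerCell y g i ∩ powerCell y g j → ContinuousAt ρ (φ 0)) :
    Tendsto (fun t => (shrunkCell y g i j a).indicator (fun x => (ρ x : ℝ≥0∞)) (φ t)) (𝓝[≥] 0)
      (𝓝 ((shrunkCell y g i j a).indicator (fun x => (ρ x : ℝ≥0∞)) (φ 0))) := by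
  have hs : ∀ k, Tendsto (fun t => slack y g i k (φ t)) (𝓝[≥] 0) (𝓝 (slack y g i k (φ 0))) :=
    fun k => ((continuous_slack y g i k).continuousAt.comp hφ).tendsto.mono_left
      nhdsWithin_le_nhds
  by_cases hlt : ∃ k, k ≠ i ∧ k ≠ j ∧ slack y g i k (φ 0) < a
  · obtain ⟨k, hki, hkj, hk⟩ := hlt
    rw [indicator_of_notMem fun hmem => absurd (hmem.2 k hki hkj) (not_le.2 hk)]
    refine tendsto_const_nhds.congr' ?_
    filter_upwards [(hs k).eventually_lt_const hk] with t ht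
    rw [indicator_of_notMem fun hmem => absurd (hmem.2 k hki hkj) (not_le.2 ht)]
  · push Not at hlt
    have hmem0 : φ 0 ∈ shrunkCell y g i j a := mem_shrunkCell_of_lt ha (hφj 0).ge hlt
    have hface : φ 0 ∈ powerCell y g i ∩ powerCell y g j := by
      refine ⟨hmem0.1, mem_powerCell_iff.2 fun k => ?_⟩
      rw [← slack_sub y g i j k, hφj 0, sub_zero]
      exact mem_powerCell_iff.1 hmem0.1 k
    rw [indicator_of_mem hmem0]
    have hev : ∀ᶠ t in 𝓝[≥] 0, ∀ k, k ≠ i → k ≠ j → a ≤ slack y g i k (φ t) := by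
      refine eventually_all.2 fun k => ?_
      by_cases hki : k = i
      · exact Eventually.of_forall fun t h => absurd hki h
      by_cases hkj : k = j
      · exact Eventually.of_forall fun t _ h => absurd hkj h
      filter_upwards [(hs k).eventually_const_lt
        (lt_of_le_of_ne (hlt k hki hkj) (hne k hki hkj).symm)] with t ht _ _
      exact ht.le
    have hlim : Tendsto (fun t => (ρ (φ t) : ℝ≥0∞)) (𝓝[≥] 0) (𝓝 (ρ (φ 0) : ℝ≥0∞)) :=
      ENNReal.tendsto_coe.2 (((hρ hface).comp hφ).tendsto.mono_left nhdsWithin_le_nhds)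
    refine hlim.congr' ?_
    filter_upwards [hev, self_mem_nhdsWithin] with t ht ht0
    rw [indicator_of_mem (mem_shrunkCell_of_lt ha (by rw [hφj]; exact ht0) ht)]

lemma tendsto_indicator_shrunkCell_zero {x : EuclideanSpace ℝ (Fin d)}
    (hx : slack y g i j x = 0) (hne : ∀ k, k ≠ i → k ≠ j → slack y g i k x ≠ 0) :
    Tendsto (fun a => (shrunkCell y g i j a).indicator (fun x => (ρ x : ℝ≥0∞)) x) (𝓝[≥] 0)
      (𝓝 ((shrunkCell y g i j 0).indicator (fun x => (ρ x : ℝ≥0∞)) x)) := by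
  refine tendsto_const_nhds.congr' ?_
  by_cases hlt : ∃ k, k ≠ i ∧ k ≠ j ∧ slack y g i k x < 0
  · obtain ⟨k, hki, hkj, hk⟩ := hlt
    have hnot : ∀ a, x ∉ shrunkCell y g i j a := fun a hmem =>
      absurd (mem_powerCell_iff.1 hmem.1 k) (not_le.2 hk)
    refine Eventually.of_forall fun a => ?_
    simp only [indicator_of_notMem (hnot _)]
  · push Not at hlt
    have hev : ∀ᶠ a : ℝ in 𝓝[≥] 0, ∀ k, k ≠ i → k ≠ j → a ≤ slack y g i k x := by
      refine eventually_all.2 fun k => ?_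
      by_cases hki : k = i
      · exact Eventually.of_forall fun t h => absurd hki h
      by_cases hkj : k = j
      · exact Eventually.of_forall fun t _ h => absurd hkj h
      have hpos := lt_of_le_of_ne (hlt k hki hkj) (hne k hki hkj).symm
      filter_upwards [nhdsWithin_le_nhds (Iio_mem_nhds hpos)] with a ha _ _
      exact (mem_Iio.1 ha).le
    filter_upwards [hev, self_mem_nhdsWithin] with a ha ha0
    rw [indicator_of_mem (mem_shrunkCell_of_lt le_rfl hx.ge hlt),
      indicator_of_mem (mem_shrunkCell_of_lt ha0 hx.ge ha)]

lemma measurable_indicator_shrunkCell (hρ : Measurable ρ) (t a : ℝ) :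
    Measurable fun z => (shrunkCell y g i j a).indicator (fun x => (ρ x : ℝ≥0∞))
      (hyperplaneParam ((2 : ℝ) • (y i - y j)) (slackConst y g i j) t z) :=
  (hρ.coe_nnreal_ennreal.indicator (isClosed_shrunkCell y g i j a).measurableSet).comp
    (isometry_hyperplaneParam _ _ _).continuous.measurable

/-- The densities of compactly supported measures satisfy the regularity along hyperplanes. -/
theorem IsCompactContinuous.continuousSlices [IsProbabilityMeasure μ]
    (h : IsCompactContinuous μ ρ y g) (hρ : Measurable ρ) (hac : μ ≪ volume)
    (hy : Function.Injective y) (hcell : ∀ i, μ (powerCell y g i) ≠ 0) :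
    ContinuousSlices ρ y g := by
  intro i j hij
  obtain ⟨G, hG, hle⟩ := h.exists_dominating i j
  obtain ⟨a₀, ha₀, hne⟩ : ∃ a₀ > 0, ∀ a ∈ Icc (0 : ℝ) a₀, ∀ᵐ z, ∀ k, k ≠ i → k ≠ j →
      slack y g i k (hyperplaneParam ((2 : ℝ) • (y i - y j)) (slackConst y g i j) 0 z) ≠ a := by
    have : ∀ k, ∃ b > 0, k ≠ i → k ≠ j → ∀ a ∈ Icc (0 : ℝ) b, ∀ᵐ z, slack y g i k
        (hyperplaneParam ((2 : ℝ) • (y i - y j)) (slackConst y g i j) 0 z) ≠ a := by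
      intro k
      by_cases hk : k ≠ i ∧ k ≠ j
      · obtain ⟨b, hb, hb'⟩ := exists_forall_ae_slack_ne hac hy hcell hij hk.1.symm hk.2.symm
        exact ⟨b, hb, fun _ _ => hb'⟩
      · exact ⟨1, one_pos, fun h1 h2 => absurd ⟨h1, h2⟩ hk⟩
    choose b hb hb' using this
    have : Nonempty (Fin n) := ⟨i⟩
    obtain ⟨k₀, hk₀⟩ := Finite.exists_min b
    refine ⟨b k₀, hb k₀, fun a ha => ae_all_iff.2 fun k => ?_⟩
    by_cases hk : k ≠ i ∧ k ≠ j
    · filter_upwards [hb' k hk.1 hk.2 a ⟨ha.1, ha.2.trans (hk₀ k)⟩] with z hz _ _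
      exact hz
    · exact ae_of_all _ fun z h1 h2 => absurd ⟨h1, h2⟩ hk
  refine ⟨?_, ⟨a₀, ha₀, fun a ha => ?_⟩, ?_⟩
  · rw [sliceMass_eq_lintegral hρ hy g hij]
    exact (lintegral_mono (hle 0 0)).trans_lt hG.lt_top
  · unfold ContinuousWithinAt
    simp only [sliceMass_eq_lintegral hρ hy g hij]
    refine tendsto_lintegral_filter_of_dominated_convergence G
      (Eventually.of_forall fun t => measurable_indicator_shrunkCell hρ t a)
      (Eventually.of_forall fun t => ae_of_all _ fun z => hle t a z) hG ?_
    filter_upwards [hne a ha, h.ae_continuousAt hy hij] with z hz hz'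
    exact tendsto_indicator_shrunkCell
      (φ := fun t => hyperplaneParam ((2 : ℝ) • (y i - y j)) (slackConst y g i j) t z) ha.1
      ((continuous_hyperplaneParam _ _).comp (by fun_prop : Continuous fun t : ℝ =>
        (t, z))).continuousAt (fun t => slack_hyperplaneParam hy g hij t z) hz hz'
  · unfold ContinuousWithinAt
    simp only [sliceMass_eq_lintegral hρ hy g hij]
    refine tendsto_lintegral_filter_of_dominated_convergence G
      (Eventually.of_forall fun a => measurable_indicator_shrunkCell hρ 0 a)
      (Eventually.of_forall fun a => ae_of_all _ fun z => hle 0 a z) hG ?_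
    filter_upwards [hne 0 ⟨le_rfl, ha₀.le⟩] with z hz
    exact tendsto_indicator_shrunkCell_zero (slack_hyperplaneParam hy g hij 0 z) hz

end

/-! ### Assembly of the two forms of the theorem. -/

lemma sum_symm_eq_two_mul_sum_Ioi {F : Fin n → Fin n → ℝ} (hs : ∀ i j, F i j = F j i)
    (h0 : ∀ i, F i i = 0) : ∑ i, ∑ j, F i j = 2 * ∑ i, ∑ j ∈ Finset.Ioi i, F i j := by
  have h1 := Finset.sum_sum_Ioi_add_eq_sum_sum_off_diag fun i j => F i j
  have h2 : ∀ i, ∑ j ∈ {i}ᶜ, F j i = ∑ j, F i j := by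
    intro i
    rw [← Finset.sum_compl_add_sum {i}, Finset.sum_singleton, h0, add_zero]
    exact Finset.sum_congr rfl fun j _ => hs j i
  simp only [h2] at h1
  rw [← h1, Finset.mul_sum]
  refine Finset.sum_congr rfl fun i _ => ?_
  rw [Finset.mul_sum]
  refine Finset.sum_congr rfl fun j _ => ?_
  rw [hs j i, two_mul]

lemma sliceMass_zero_le (ρ : EuclideanSpace ℝ (Fin d) → ℝ≥0)
    (y : Fin n → EuclideanSpace ℝ (Fin d)) (g : EuclideanSpace ℝ (Fin d) → ℝ) (i j : Fin n)
    (a : ℝ) : sliceMass ρ y g i j 0 a ≤ sliceMass ρ y g i j 0 0 := by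
  refine lintegral_mono_set fun x hx => ⟨?_, hx.2⟩
  rw [shrunkCell_zero]
  exact hx.1.1

section
variable {μ ν : Measure (EuclideanSpace ℝ (Fin d))} [IsProbabilityMeasure μ]
  [IsProbabilityMeasure ν] {ρ : EuclideanSpace ℝ (Fin d) → ℝ≥0}
  {y : Fin n → EuclideanSpace ℝ (Fin d)} {f g : EuclideanSpace ℝ (Fin d) → ℝ}

lemma HasRegularDensity.absolutelyContinuous (hμ : HasRegularDensity μ ρ) : μ ≪ volume := by
  rw [hμ.eq_withDensity]
  exact withDensity_absolutelyContinuous _ _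

lemma HasRegularDensity.hasLaplaceLimit (hμ : HasRegularDensity μ ρ) (hy : Function.Injective y)
    {i j : Fin n} (hij : i ≠ j) {a : ℝ}
    (hc : ContinuousWithinAt (fun t => sliceMass ρ y g i j t a) (Ici 0) 0)
    (hfin : sliceMass ρ y g i j 0 a ≠ ∞) :
    HasLaplaceLimit ((μ.restrict (shrunkCell y g i j a)).map (slack y g i j))
      ((sliceMass ρ y g i j 0 a).toReal / (2 * ‖y i - y j‖)) := by
  have : IsFiniteMeasure (volume.withDensity fun x => (ρ x : ℝ≥0∞)) := by
    rw [← hμ.eq_withDensity]; infer_instance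
  rw [hμ.eq_withDensity]
  exact hasLaplaceLimit_map_slack hμ.measurable hy hij hc hfin

lemma IsSemidiscrete.measure_powerCell_ne_zero (h : IsSemidiscrete μ ν y) (hac : μ ≪ volume)
    (hfg : IsOptimalPotential μ ν f g) (i : Fin n) : μ (powerCell y g i) ≠ 0 := by
  intro h0
  have h1 := h.measureReal_powerCell hac hfg i
  rw [Measure.real, h0] at h1
  exact (h.real_pos i).ne h1

/-- The geometry enters the abstract asymptotics here: the excesses of the reduced costs are the
slacks, and the inner sets are the shrunken cells. Continuity in t gives the Laplace limits,
continuity in a gives the convergence of the inner constants. -/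
lemma HasRegularDensity.isLaplacePartition (hμ : HasRegularDensity μ ρ)
    (hy : Function.Injective y) (hcell : ∀ i, μ (powerCell y g i) ≠ 0) [NeZero n]
    (hs : ContinuousSlices ρ y g) :
    IsLaplacePartition μ (fun x => siteCost y x - g ∘ y) (powerCell y g) (shrunkCell y g)
      (fun i j => (faceMass ρ y g i j).toReal / (2 * ‖y i - y j‖))
      (fun i j a => (sliceMass ρ y g i j 0 a).toReal / (2 * ‖y i - y j‖)) := by
  have hac := hμ.absolutelyContinuous
  have hsl : ∀ i j, (fun x => (siteCost y x - g ∘ y) j - (siteCost y x - g ∘ y) i)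
      = slack y g i j := by
    intro i j; ext x; simp only [siteCost, slack, Pi.sub_apply, Function.comp_apply]; ring
  have hsl' : ∀ i j x, (siteCost y x - g ∘ y) j - (siteCost y x - g ∘ y) i = slack y g i j x :=
    fun i j x => congrFun (hsl i j) x
  refine
    { measurable := (continuous_siteCost y).measurable.sub_const _
      measurableSet := fun i => (isClosed_powerCell y g i).measurableSet
      nonneg := fun i j x hx => (mem_powerCell_iff.1 hx j).trans_eq (hsl' i j x).symm
      sum_restrict := sum_restrict_powerCell hac hy g
      measurableSet_inner := fun i j a => (isClosed_shrunkCell y g i j a).measurableSet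
      inner_subset := fun i j a x hx => hx.1
      inner_le := fun i j a x hx k hki hkj => (hx.2 k hki hkj).trans_eq (hsl' i k x).symm
      const_nonneg := fun i j => by positivity
      const_symm := fun i j => by rw [faceMass_comm, norm_sub_rev]
      const_self := fun i => by simp
      laplace := fun i j hij => ?_
      laplace_inner := fun i j hij => ?_
      tendsto_const := fun i j hij => ?_
      connected := fun A hA hA' => ?_ }
  · obtain ⟨hfin, ⟨a₀, ha₀, hc⟩, -⟩ := hs i j hij
    have := hμ.hasLaplaceLimit hy hij (hc 0 ⟨le_rfl, ha₀.le⟩) hfin.ne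
    rw [shrunkCell_zero, sliceMass_zero_zero] at this
    rwa [hsl]
  · obtain ⟨hfin, ⟨a₀, ha₀, hc⟩, -⟩ := hs i j hij
    refine ⟨a₀, ha₀, fun a ha haa => ?_⟩
    rw [hsl]
    exact hμ.hasLaplaceLimit hy hij (hc a ⟨ha.le, haa⟩)
      ((sliceMass_zero_le ρ y g i j a).trans_lt hfin).ne
  · obtain ⟨hfin, -, hc⟩ := hs i j hij
    rw [← sliceMass_zero_zero]
    exact ((ENNReal.tendsto_toReal hfin.ne).comp
      (hc.tendsto.mono_left (nhdsWithin_mono 0 Ioi_subset_Ici_self))).div_const _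
  · obtain ⟨i, hi, j, hj, hne⟩ := hμ.exists_faceMass_pos hac hy hcell hA hA'
    have hij : i ≠ j := fun h => hi (h ▸ hj)
    refine ⟨i, hi, j, hj, div_pos (ENNReal.toReal_pos hne ?_)
      (mul_pos two_pos (norm_pos_iff.2 (sub_ne_zero.2 (hy.ne hij))))⟩
    rw [← sliceMass_zero_zero]
    exact (hs i j hij).1.ne

/-- The general form of the asymptotics. -/
theorem IsSemidiscrete.tendsto_cost_sub (h : IsSemidiscrete μ ν y) (hμ : HasRegularDensity μ ρ)
    (hfg : IsOptimalPotential μ ν f g) (hs : ContinuousSlices ρ y g)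
    {π : ℝ → Measure (EuclideanSpace ℝ (Fin d) × EuclideanSpace ℝ (Fin d))}
    (hπ : ∀ η, 0 < η → IsEntropicOptimal μ ν η (π η)) :
    Tendsto (fun η : ℝ => η ^ 2 * ((cost (π η)).toReal - (W2sq μ ν).toReal)) atTop
      (𝓝 ((riemannZeta 2).re / 2 * ∑ i, ∑ j ∈ Finset.Ioi i,
        (faceMass ρ y g i j).toReal / ‖y i - y j‖)) := by
  have := h.neZero
  have hac := hμ.absolutelyContinuous
  have hP := hμ.isLaplacePartition h.injective (h.measure_powerCell_ne_zero hac hfg) hs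
  have hex : ∀ η : ℝ, ∃ θ : Fin n → ℝ, 0 < η →
      (∀ i, ∫ x, softmax (θ - η • (siteCost y x - g ∘ y)) i ∂μ = ν.real {y i}) ∧
      (cost (π η)).toReal - (W2sq μ ν).toReal
        = ∫ x, ∑ i, softmax (θ - η • (siteCost y x - g ∘ y)) i
            * (‖x - y i‖ ^ 2 - g (y i) - cTransform y (g ∘ y) x) ∂μ := by
    intro η
    by_cases hη : 0 < η
    · obtain ⟨θ, hθ⟩ := h.exists_softmax_reducedCost hac hη hfg (hπ η hη)
      exact ⟨θ, fun _ => hθ⟩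
    · exact ⟨0, fun h => absurd h hη⟩
  choose θ hθ using hex
  have hlim := hP.tendsto_suboptimality (θ := θ)
    (by
      filter_upwards [eventually_gt_atTop 0] with η hη j
      rw [h.measureReal_powerCell hac hfg]
      exact (hθ η hη).1 j)
    (fun j => (h.integrable_siteCost.eval j).sub (integrable_const _))
  -- Each unordered pair is counted twice, once from either side of the face, which cancels the 2 in
  -- the denominator 2‖y_i - y_j‖.
  have hsum : ∑ i, ∑ j, (faceMass ρ y g i j).toReal / (2 * ‖y i - y j‖)
      = ∑ i, ∑ j ∈ Finset.Ioi i, (faceMass ρ y g i j).toReal / ‖y i - y j‖ := by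
    rw [sum_symm_eq_two_mul_sum_Ioi (fun i j => by rw [faceMass_comm, norm_sub_rev])
      (fun i => by simp), Finset.mul_sum]
    refine Finset.sum_congr rfl fun i _ => ?_
    rw [Finset.mul_sum]
    refine Finset.sum_congr rfl fun j _ => ?_
    rw [← div_div, div_right_comm, mul_div_cancel₀ _ two_ne_zero]
  rw [← hsum]
  refine hlim.congr' ?_
  filter_upwards [eventually_gt_atTop 0] with η hη
  rw [(hθ η hη).2]
  rfl

end

lemma isLittleO_of_tendsto_sq_mul {F : ℝ → ℝ} {W c S : ℝ}
    (h : Tendsto (fun η : ℝ => η ^ 2 * (F η - W)) atTop (𝓝 (c / 2 * S))) :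
    (fun η : ℝ => F η - (W + c / (2 * η ^ 2) * S)) =o[atTop] fun η : ℝ => (η ^ 2)⁻¹ := by
  rw [isLittleO_iff_tendsto' (by
    filter_upwards [eventually_gt_atTop 0] with η hη h0
    exact absurd h0 (by positivity))]
  have h1 := h.sub_const (c / 2 * S)
  rw [sub_self] at h1
  refine h1.congr' ?_
  filter_upwards [eventually_gt_atTop 0] with η hη
  field_simp
  ring

end SemidiscreteOT

end

theorem theorem1 {d n : ℕ} (μ ν : Measure (EuclideanSpace ℝ (Fin d)))
    [IsProbabilityMeasure μ] [IsProbabilityMeasure ν]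
    (y : Fin n → EuclideanSpace ℝ (Fin d)) (hy : Function.Injective y)
    (hν_supp : ν (range y)ᶜ = 0) (hν_pos : ∀ i, 0 < ν {y i})
    (ρ : EuclideanSpace ℝ (Fin d) → ℝ≥0) (hμ : SemidiscreteOT.HasRegularDensity μ ρ) :
    -- the entropic optimal coupling exists and is unique, and optimal potentials exist
    (∀ η : ℝ, 0 < η → ∃! π, SemidiscreteOT.IsEntropicOptimal μ ν η π) ∧
    (∃ f g, SemidiscreteOT.IsOptimalPotential μ ν f g) ∧
    ∀ (π : ℝ → Measure (EuclideanSpace ℝ (Fin d) × EuclideanSpace ℝ (Fin d)))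
      (f g : EuclideanSpace ℝ (Fin d) → ℝ),
      (∀ η, 0 < η → SemidiscreteOT.IsEntropicOptimal μ ν η (π η)) →
      SemidiscreteOT.IsOptimalPotential μ ν f g →
      -- the general form
      (SemidiscreteOT.ContinuousSlices ρ y g →
        Tendsto (fun η : ℝ => η ^ 2 *
            ((SemidiscreteOT.cost (π η)).toReal - (SemidiscreteOT.W2sq μ ν).toReal)) atTop
          (𝓝 ((riemannZeta 2).re / 2 * ∑ i, ∑ j ∈ Finset.Ioi i,
            (SemidiscreteOT.sliceMass ρ y g i j 0 0).toReal / ‖y i - y j‖))) ∧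
      -- the form for compactly supported measures
      (SemidiscreteOT.IsCompactContinuous μ ρ y g →
        (fun η : ℝ => (SemidiscreteOT.cost (π η)).toReal -
            ((SemidiscreteOT.W2sq μ ν).toReal +
              (riemannZeta 2).re / (2 * η ^ 2) * ∑ i, ∑ j ∈ Finset.Ioi i,
                (SemidiscreteOT.faceMass ρ y g i j).toReal / ‖y i - y j‖))
          =o[atTop] fun η : ℝ => (η ^ 2)⁻¹) := by
  have h : SemidiscreteOT.IsSemidiscrete μ ν y := ⟨hy, hν_supp, hν_pos, hμ.secondMoment⟩
  have hac := hμ.absolutelyContinuous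
  refine ⟨fun η hη => h.existsUnique_isEntropicOptimal hη, h.exists_isOptimalPotential,
    fun π f g hπ hfg => ⟨fun hs => ?_, fun hc => ?_⟩⟩
  · simp only [SemidiscreteOT.sliceMass_zero_zero]
    exact h.tendsto_cost_sub hμ hfg hs hπ
  · exact SemidiscreteOT.isLittleO_of_tendsto_sq_mul (h.tendsto_cost_sub hμ hfg
      (hc.continuousSlices hμ.measurable hac hy (h.measure_powerCell_ne_zero hac hfg)) hπ)
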